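/- Let $\mathbf S$ be a closed disc with a finite set $\mathbf M$ of at least four marked points on its boundary and a set $\mathbf P$ of at most one puncture in its interior. A curve is a path in $\mathbf S$ with endpoints in $\mathbf M\cup\mathbf P$ that does not meet $\mathbf M\cup\mathbf P$ at interior times and is neither null-homotopic nor homotopic to a boundary segment; curves are taken up to homotopy relative to their endpoints, through paths that do not meet $\mathbf M\cup\mathbf P$ at interior times, and up to inversion. For curves $\gamma_1,\gamma_2$, $\mathrm{Int}^\circ(\gamma_1,\gamma_2)$ is the minimal number of pairs $(t_1,t_2)\in(0,1)^2$ with $\gamma_1(t_1)=\gamma_2(t_2)$ over all representatives. An arc is a curve without self-intersections (its endpoints may coincide, in which case it is a loop). A tagged arc $\alpha$ is an arc $\bar\alpha$ each of whose two ends is tagged plain or notched, such that ends on the boundary are plain and both ends of a loop have the same tag. It is admissible if $\bar\alpha$ does not cut out a once-punctured monogon. Tagged arcs $\alpha,\beta$ are compatible if $\mathrm{Int}^\circ(\bar\alpha,\bar\beta)=0$; if, when $\bar\alpha\neq\bar\beta$, their ends at any common endpoint have the same tag; and if, when $\bar\alpha=\bar\beta$, at least one end of $\alpha$ has the same tag as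 the corresponding end of $\beta$. A tagged triangulation is a maximal set of pairwise compatible admissible tagged arcs. For tagged arcs $\alpha,\beta$ put $\mathrm{Int}(\alpha|\beta)=A+B+C+D$, where $A=\mathrm{Int}^\circ(\bar\alpha,\bar\beta)$; $B=0$ unless $\bar\alpha$ is a loop, based at $a$ say, in which case, if $\bar\beta$ meets $\bar\alpha$ (in minimal position) at interior points $b_1,\dots,b_m$ in this order along $\bar\beta$, $-B$ is the number of segments $[b_i,b_{i+1}]$ of $\bar\beta$ that form, together with segments $[a,b_i]$ and $[a,b_{i+1}]$ of $\bar\alpha$, the sides of a contractible triangle disjoint from the punctures; $C=-1$ if $\bar\alpha=\bar\beta$ and $C=0$ otherwise; and $D$ is the number of ends of $\beta$ that are incident to an endpoint of $\alpha$ and carry there a tag different from that of $\alpha$. For a tagged triangulation $\mathbf T$ and a finite multiset $\mathcal M$ of tagged arcs, the intersection vector of $\mathcal M$ is $\underline{\mathrm{Int}}_{\mathbf T}(\mathcal M)=\bigl(\sum_{\alpha\in\mathcal M}\mathrm{Int}(\mathbf a|\alpha)\bigr)_{\mathbf a\in\mathbf T}$. Theorem. Let $\mathbf T$ be a tagged triangulation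 of $(\mathbf S,\mathbf M,\mathbf P)$, and let $\mathcal M,\mathcal N$ be two finite multisets of pairwise compatible admissible tagged arcs. If $\underline{\mathrm{Int}}_{\mathbf T}(\mathcal M)=\underline{\mathrm{Int}}_{\mathbf T}(\mathcal N)$, then $\mathcal M=\mathcal N$. -/

import Mathlib

open scoped unitInterval

noncomputable section

/-- A disc with at least four marked points on its boundary and at most one puncture in its
interior. The disc is the closed unit disc of the complex plane. -/
structure MarkedDisc where
  /-- the boundary marked points -/
  marked : Finset ℂ
  /-- the punctures -/
  punctures : Finset ℂ
  norm_marked : ∀ z ∈ marked, ‖z‖ = 1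
  norm_punctures : ∀ z ∈ punctures, ‖z‖ < 1
  four_le_card_marked : 4 ≤ marked.card
  card_punctures_le_one : punctures.card ≤ 1

/-- The two possible tags of an end of an arc. -/
inductive ArcTag
  | plain
  | notched

/-- The reversed map `t ↦ f (1 - t)`. -/
def reverseMap (f : C(I, ℂ)) : C(I, ℂ) := f.comp ⟨σ, unitInterval.continuous_symm⟩

namespace MarkedDisc

variable (X : MarkedDisc)

/-- The set of all marked points and punctures. -/
def vertices : Set ℂ := {z | z ∈ X.marked ∨ z ∈ X.punctures}

/-- `f` is a path in the disc from the vertex `x` to the vertex `y` that meets no vertex at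
interior times. -/
def IsPathBetween (x y : ℂ) (f : C(I, ℂ)) : Prop :=
  x ∈ X.vertices ∧ y ∈ X.vertices ∧ f 0 = x ∧ f 1 = y ∧ (∀ t, ‖f t‖ ≤ 1) ∧
    ∀ t, 0 < t → t < 1 → f t ∉ X.vertices

/-- Homotopy relative to the endpoints, through paths that meet no vertex at interior times. -/
def Homotopic (f g : C(I, ℂ)) : Prop :=
  ContinuousMap.HomotopicWith f g (X.IsPathBetween (f 0) (f 1))

/-- `f` can be contracted to its base point; during the contraction, up to the final moment, no
vertex is met at interior times. -/
def NullHomotopic (f : C(I, ℂ)) : Prop :=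
  ∃ H : C(I × I, ℂ), (∀ t, H (0, t) = f t) ∧ (∀ t, H (1, t) = f 0) ∧
    (∀ s, H (s, 0) = f 0 ∧ H (s, 1) = f 0) ∧ (∀ s t, ‖H (s, t)‖ ≤ 1) ∧
    ∀ s t, s < 1 → 0 < t → t < 1 → H (s, t) ∉ X.vertices

/-- `g` runs injectively along the boundary circle from one marked point to a next one. -/
def IsBoundarySegment (g : C(I, ℂ)) : Prop :=
  Function.Injective g ∧ (∀ t, ‖g t‖ = 1) ∧ X.IsPathBetween (g 0) (g 1) g

/-- Curves on the marked disc. -/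
structure Curve where
  toMap : C(I, ℂ)
  isPath : X.IsPathBetween (toMap 0) (toMap 1) toMap
  not_nullHomotopic : ¬ X.NullHomotopic toMap
  not_boundary : ∀ g, X.IsBoundarySegment g → ¬ X.Homotopic toMap g

variable {X}

theorem Homotopic.endpoints {f g : C(I, ℂ)} (h : X.Homotopic f g) : g 0 = f 0 ∧ g 1 = f 1 := by
  obtain ⟨F⟩ := h
  obtain ⟨-, -, h0, h1, -⟩ := F.prop 1
  refine ⟨?_, ?_⟩
  · simpa using h0
  · simpa using h1

theorem Homotopic.symm {f g : C(I, ℂ)} (h : X.Homotopic f g) : X.Homotopic g f := by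
  have e := h.endpoints
  unfold Homotopic at *
  rw [e.1, e.2]
  exact ContinuousMap.HomotopicWith.symm h

theorem Homotopic.trans {f g k : C(I, ℂ)} (h : X.Homotopic f g) (h' : X.Homotopic g k) :
    X.Homotopic f k := by
  have e := h.endpoints
  unfold Homotopic at *
  rw [e.1, e.2] at h'
  exact ContinuousMap.HomotopicWith.trans h h'

theorem Curve.homotopic_refl (c : X.Curve) : X.Homotopic c.toMap c.toMap :=
  ContinuousMap.HomotopicWith.refl _ c.isPath

@[simp] theorem _root_.reverseMap_apply (f : C(I, ℂ)) (t : I) : reverseMap f t = f (σ t) := rfl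

@[simp] theorem _root_.reverseMap_reverseMap (f : C(I, ℂ)) : reverseMap (reverseMap f) = f := by
  ext t; simp

theorem IsPathBetween.reverse {x y : ℂ} {f : C(I, ℂ)} (h : X.IsPathBetween x y f) :
    X.IsPathBetween y x (reverseMap f) := by
  obtain ⟨hx, hy, h0, h1, hn, hv⟩ := h
  refine ⟨hy, hx, by simpa using h1, by simpa using h0, fun t => hn _, fun t ht ht' => hv _ ?_ ?_⟩
  · exact unitInterval.pos_iff_ne_zero.2 fun h => ht'.ne (by simpa using congrArg σ h)
  · exact unitInterval.lt_one_iff_ne_one.2 fun h => ht.ne' (by simpa using congrArg σ h)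

theorem Homotopic.reverse {f g : C(I, ℂ)} (h : X.Homotopic f g) :
    X.Homotopic (reverseMap f) (reverseMap g) := by
  obtain ⟨F⟩ := h
  refine ⟨⟨⟨⟨fun p => F (p.1, σ p.2), by fun_prop⟩, ?_, ?_⟩, fun s => ?_⟩⟩
  · intro t; simp
  · intro t; simp
  · have := (F.prop s).reverse
    simp only [reverseMap_apply, unitInterval.symm_zero, unitInterval.symm_one]
    exact this

variable (X)

/-- Curves are considered up to homotopy and up to taking inverses. -/
instance curveSetoid : Setoid X.Curve where
  r c d := X.Homotopic c.toMap d.toMap ∨ X.Homotopic c.toMap (reverseMap d.toMap)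
  iseqv :=
    { refl := fun c => Or.inl c.homotopic_refl
      symm := by
        rintro c d (h | h)
        · exact Or.inl h.symm
        · exact Or.inr (by simpa using h.symm.reverse)
      trans := by
        rintro c d e (h | h) (h' | h')
        · exact Or.inl (h.trans h')
        · exact Or.inr (h.trans h')
        · exact Or.inr (h.trans h'.reverse)
        · exact Or.inl (h.trans (by simpa using h'.reverse)) }

/-- Equivalence classes of curves. -/
abbrev CurveClass : Type := Quotient X.curveSetoid

variable {X}

/-- A curve that does not meet itself, except that its two endpoints may coincide. -/
def Curve.IsSimple (c : X.Curve) : Prop := Set.InjOn c.toMap (Set.Ioo 0 1)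

/-- A curve is a loop if its endpoints coincide. -/
def Curve.IsLoop (c : X.Curve) : Prop := c.toMap 0 = c.toMap 1

/-- A curve is an arc if, up to homotopy, it has no self-intersections. -/
def Curve.IsArc (c : X.Curve) : Prop :=
  ∃ d : X.Curve, X.Homotopic c.toMap d.toMap ∧ d.IsSimple

/-- The pairs of interior times at which two curves meet. -/
def Curve.crossings (c d : X.Curve) : Set (I × I) :=
  {p | 0 < p.1 ∧ p.1 < 1 ∧ 0 < p.2 ∧ p.2 < 1 ∧ c.toMap p.1 = d.toMap p.2}

/-- The intersection number of two classes of curves: the minimal number of intersections of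
representatives. -/
def crossingNumber (α β : X.CurveClass) : ℕ :=
  sInf {n : ℕ | ∃ c d : X.Curve, ⟦c⟧ = α ∧ ⟦d⟧ = β ∧ (c.crossings d).encard = n}

/-- The class of `α` cuts out a once-punctured monogon: it is represented by a simple loop whose
interior (in the sense of Jordan's theorem) contains exactly one puncture. -/
def CutsOutPuncturedMonogon (α : X.CurveClass) : Prop :=
  ∃ c : X.Curve, ⟦c⟧ = α ∧ c.IsSimple ∧ c.IsLoop ∧
    ∃! p : ℂ, p ∈ X.punctures ∧ p ∉ Set.range c.toMap ∧
      Bornology.IsBounded (connectedComponentIn (Set.range c.toMap)ᶜ p)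

variable (X)

/-- An oriented arc with a tag at its start and a tag at its end; boundary ends are tagged plain,
and both ends of a loop are tagged in the same way. -/
structure TaggedCurve where
  curve : X.Curve
  isArc : curve.IsArc
  tagStart : ArcTag
  tagEnd : ArcTag
  plain_start : curve.toMap 0 ∈ X.marked → tagStart = ArcTag.plain
  plain_end : curve.toMap 1 ∈ X.marked → tagEnd = ArcTag.plain
  loop : curve.IsLoop → tagStart = tagEnd

/-- Tagged curves are equivalent if their curves are homotopic with the same tags, or if this
holds after inverting one of them. -/
instance taggedSetoid : Setoid X.TaggedCurve where
  r a b :=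
    (X.Homotopic a.curve.toMap b.curve.toMap ∧ a.tagStart = b.tagStart ∧ a.tagEnd = b.tagEnd) ∨
    (X.Homotopic a.curve.toMap (reverseMap b.curve.toMap) ∧
      a.tagStart = b.tagEnd ∧ a.tagEnd = b.tagStart)
  iseqv :=
    { refl := fun a => Or.inl ⟨a.curve.homotopic_refl, rfl, rfl⟩
      symm := by
        rintro a b (⟨h, h1, h2⟩ | ⟨h, h1, h2⟩)
        · exact Or.inl ⟨h.symm, h1.symm, h2.symm⟩
        · exact Or.inr ⟨by simpa using h.symm.reverse, h2.symm, h1.symm⟩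
      trans := by
        rintro a b c (⟨h, h1, h2⟩ | ⟨h, h1, h2⟩) (⟨k, k1, k2⟩ | ⟨k, k1, k2⟩)
        · exact Or.inl ⟨h.trans k, h1.trans k1, h2.trans k2⟩
        · exact Or.inr ⟨h.trans k, h1.trans k1, h2.trans k2⟩
        · exact Or.inr ⟨h.trans k.reverse, h1.trans k2, h2.trans k1⟩
        · exact Or.inl ⟨h.trans (by simpa using k.reverse), h1.trans k2, h2.trans k1⟩ }

/-- Tagged arcs. -/
abbrev TaggedArc : Type := Quotient X.taggedSetoid

namespace TaggedArc

variable {X}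

/-- The underlying untagged arc. -/
def underlying (α : X.TaggedArc) : X.CurveClass :=
  Quotient.map (sa := X.taggedSetoid) (sb := X.curveSetoid) TaggedCurve.curve
    (fun _ _ h => h.imp And.left And.left) α

/-- The two ends of a tagged arc: each is recorded as its endpoint together with its tag. -/
def ends (α : X.TaggedArc) : Multiset (ℂ × ArcTag) :=
  Quotient.lift (s := X.taggedSetoid)
    (fun a : X.TaggedCurve =>
      ({(a.curve.toMap 0, a.tagStart), (a.curve.toMap 1, a.tagEnd)} : Multiset (ℂ × ArcTag)))
    (by
      rintro a b (⟨h, h1, h2⟩ | ⟨h, h1, h2⟩)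
      · have e := h.endpoints
        simp only [h1, h2, e.1, e.2]
      · have e := h.endpoints
        simp only [reverseMap_apply, unitInterval.symm_zero, unitInterval.symm_one] at e
        simp only [h1, h2, e.1, e.2]
        exact Multiset.pair_comm _ _) α

/-- A tagged arc is admissible if it does not cut out a once-punctured monogon. -/
def IsAdmissible (α : X.TaggedArc) : Prop := ¬ CutsOutPuncturedMonogon α.underlying

/-- Compatibility of tagged arcs. -/
def Compatible (α β : X.TaggedArc) : Prop :=
  crossingNumber α.underlying β.underlying = 0 ∧
  (α.underlying ≠ β.underlying → ∀ e ∈ α.ends, ∀ e' ∈ β.ends, e.1 = e'.1 → e.2 = e'.2) ∧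
  (α.underlying = β.underlying → ∃ a b : X.TaggedCurve, ⟦a⟧ = α ∧ ⟦b⟧ = β ∧
    X.Homotopic a.curve.toMap b.curve.toMap ∧ (a.tagStart = b.tagStart ∨ a.tagEnd = b.tagEnd))

/-- The part `A` of the intersection number. -/
def intA (α β : X.TaggedArc) : ℤ := crossingNumber α.underlying β.underlying

/-- Let `c` be a loop with base point `a`. The segment of `d` between the times `t < t'` joins
consecutive intersections with `c` and, with two segments of `c` from `a`, which leave `a` along
different ends of `c`, it forms the three sides of a contractible triangle disjoint from the
punctures. The triangle is a map of the square that sends one side of the square to `a`. -/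
def IsTriangleSegment (c d : C(I, ℂ)) (t t' : I) : Prop :=
  0 < t ∧ t < t' ∧ t' < 1 ∧ (∀ u v, t < u → u < t' → 0 < v → v < 1 → c v ≠ d u) ∧
  ∃ s s' : I, 0 < s ∧ s < 1 ∧ 0 < s' ∧ s' < 1 ∧ c s = d t ∧ c s' = d t' ∧
  ∃ F : C(I × I, ℂ), (∀ z, ‖F z‖ ≤ 1 ∧ F z ∉ X.punctures) ∧
    (∀ v, F (0, v) = c 0) ∧ (∀ v, F (1, v) = d (Set.Icc.convexComb t t' v)) ∧
    (((∀ u, F (u, 0) = c (Set.Icc.convexComb 0 s u)) ∧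
      ∀ u, F (u, 1) = c (Set.Icc.convexComb 1 s' u)) ∨
     ((∀ u, F (u, 0) = c (Set.Icc.convexComb 1 s u)) ∧
      ∀ u, F (u, 1) = c (Set.Icc.convexComb 0 s' u)))

open Classical in
/-- The part `B` of the intersection number: zero unless the first arc is a loop, in which case it
is the negative of the number of triangle segments of the second arc, for simple representatives
with the minimal number of intersections. -/
def intB (α β : X.TaggedArc) : ℤ :=
  if ∃ c : X.Curve, ⟦c⟧ = α.underlying ∧ c.IsLoop then
    -((sInf {n : ℕ | ∃ c d : X.Curve, ⟦c⟧ = α.underlying ∧ ⟦d⟧ = β.underlying ∧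
      c.IsSimple ∧ d.IsSimple ∧
      (c.crossings d).encard = crossingNumber α.underlying β.underlying ∧
      {p : I × I | IsTriangleSegment (X := X) c.toMap d.toMap p.1 p.2}.encard = n} : ℕ) : ℤ)
  else 0

open Classical in
/-- The part `C` of the intersection number. -/
def intC (α β : X.TaggedArc) : ℤ := if α.underlying = β.underlying then -1 else 0

open Classical in
/-- The part `D` of the intersection number: the number of ends of `β` that are incident to an
endpoint of `α` and carry there a tag different from the one of `α`. -/
def intD (α β : X.TaggedArc) : ℤ :=
  (β.ends.countP fun e => ∃ e' ∈ α.ends, e'.1 = e.1 ∧ e'.2 ≠ e.2 : ℕ)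

/-- The intersection number of two tagged arcs. -/
def int (α β : X.TaggedArc) : ℤ := intA α β + intB α β + intC α β + intD α β

end TaggedArc

variable {X}

/-- A tagged triangulation: a maximal collection of pairwise compatible admissible tagged arcs. -/
def IsTaggedTriangulation (T : Set X.TaggedArc) : Prop :=
  Maximal (fun U : Set X.TaggedArc =>
    (∀ α ∈ U, TaggedArc.IsAdmissible α) ∧ U.Pairwise TaggedArc.Compatible) T

/-- The intersection vector of a finite multiset of tagged arcs with respect to `T`. -/
def intVector (T : Set X.TaggedArc) (M : Multiset X.TaggedArc) : T → ℤ :=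
  fun a => (M.map fun α => TaggedArc.int a.1 α).sum

end MarkedDisc

end

/-! An admissible arc is never a loop: loops at the puncture contract, and a loop at a marked point
contracts, meets itself or encloses the puncture once. Hence the correction B vanishes, and an arc
is described by discrete data. Without a puncture it is a diagonal of a polygon. With a puncture,
the punctured disc is covered by the upper half-plane, the marked points lift to a sequence indexed
by the integers with period n, an arc between marked points lifts to a chord {i, k} with 2 ≤ k - i <
n, unique up to translation by n, and an arc to the puncture is a vertex modulo n with a tag
(`classification`).

Interlaced endpoints force two paths to meet, since otherwise a logarithm of their difference on the
square would change by 2π around the boundary. Parabolas with a common leading coefficient and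
radial paths meet no more often than that. So intersection numbers count interleaved lifts
(`crossingNumber_chordCurve`, `crossingNumber_chordCurve_radialCurve`), and the theorem becomes one
about systems of noncrossing chords.

For such a system the number attached to a chord is the number of crossings minus the multiplicity
of the chord. The two are never both nonzero, so each is determined. The crossings with the sides of
a triangle determine how the system passes through it, hence the numbers of the sides and one
diagonal of a quadrilateral determine that of the other diagonal (`quadrilateral`). Induction on the
number of crossings with a dissection then gives all chords of a polygon (`polygon_determined`),
which settles the disc without punctures.

With a puncture, a window of two periods together with one extra vertex standing for the puncture is
again a polygon (`extended_determined`). This sees positions but not tags, so tags have to be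
removed first. A pair of arcs with opposite tags at one vertex is traded for the loop that encloses
it. Two cases arise. If some arc of the triangulation at the puncture has a nonpositive number, it
is compatible with both systems; at most one arc type then has the other tag, and it is traded for a
loop (`IsSystem.eq_of_sum_le`). If all these numbers are positive, trading pairs leaves a single tag
in each system, and it remains to see that the number of arcs tagged differently from the
triangulation is the same for both (`IsSystem.eq_of_sum_pos`). When the triangulation has both tags
this is read off from their two numbers; otherwise it follows by comparing the sectors into which
the triangulation cuts the neighbourhood of the puncture (`otherTag_le`). -/

noncomputable section

/-! ### Systems of chords of a polygon whose vertices are integers -/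

/-- The chords `{i, k}` and `{c, d}` cross, for `i < k` and `c < d`. -/
def Interleave (i k c d : ℤ) : Prop := (i < c ∧ c < k ∧ k < d) ∨ (c < i ∧ i < d ∧ d < k)

namespace ChordSystem

open Classical in
/-- The indicator function of a proposition. -/
def indic (P : Prop) : ℤ := if P then 1 else 0

theorem indic_pos {P : Prop} (h : P) : indic P = 1 := if_pos h
theorem indic_neg {P : Prop} (h : ¬ P) : indic P = 0 := if_neg h
theorem indic_nonneg (P : Prop) : 0 ≤ indic P := by unfold indic; split_ifs <;> decide
theorem indic_congr {P Q : Prop} (h : P ↔ Q) : indic P = indic Q := by rw [propext h]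

/-- The number of members of `L` with the property `P`. -/
def cnt {α : Type*} (L : Multiset α) (P : α → Prop) : ℤ := (L.map fun p => indic (P p)).sum

/-! ### Counting the members of a multiset with a given property -/

section cnt

variable {α : Type*} {L : Multiset α} {P Q R : α → Prop}

theorem cnt_nonneg : 0 ≤ cnt L P :=
  Multiset.sum_nonneg fun x hx => by
    obtain ⟨p, -, rfl⟩ := Multiset.mem_map.1 hx; exact indic_nonneg _

theorem cnt_eq_zero_iff : cnt L P = 0 ↔ ∀ p ∈ L, ¬ P p := by
  induction L using Multiset.induction with
  | empty => simp [cnt]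
  | cons a s ih =>
    have h0 : cnt (a ::ₘ s) P = indic (P a) + cnt s P := by simp [cnt]
    have h1 := cnt_nonneg (L := s) (P := P)
    have h2 := indic_nonneg (P a)
    rw [h0]
    simp only [Multiset.mem_cons, forall_eq_or_imp]
    rw [← ih]
    by_cases h : P a
    · rw [indic_pos h]; simp only [h]; constructor
      · intro; omega
      · tauto
    · rw [indic_neg h]; simp [h]

theorem cnt_pos_iff : 0 < cnt L P ↔ ∃ p ∈ L, P p := by
  have h1 := cnt_nonneg (L := L) (P := P)
  have h2 := cnt_eq_zero_iff (L := L) (P := P)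
  constructor
  · intro h; by_contra hc; push Not at hc; have := h2.2 hc; omega
  · rintro ⟨p, hp, h⟩
    rcases h1.lt_or_eq with h' | h'
    · exact h'
    · exact absurd h (h2.1 h'.symm p hp)

theorem cnt_congr (h : ∀ p ∈ L, (P p ↔ Q p)) : cnt L P = cnt L Q := by
  unfold cnt
  rw [Multiset.map_congr rfl fun p hp => indic_congr (h p hp)]

theorem cnt_mono (h : ∀ p ∈ L, P p → Q p) : cnt L P ≤ cnt L Q := by
  unfold cnt
  refine Multiset.sum_map_le_sum_map _ _ fun p hp => ?_
  by_cases hP : P p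
  · rw [indic_pos hP, indic_pos (h p hp hP)]
  · rw [indic_neg hP]; exact indic_nonneg _

theorem cnt_split (Q : α → Prop) : cnt L P = cnt L (fun p => P p ∧ Q p) + cnt L (fun p => P p ∧ ¬ Q p) := by
  unfold cnt
  rw [← Multiset.sum_map_add]
  refine congrArg _ (Multiset.map_congr rfl fun p _ => ?_)
  unfold indic; split_ifs <;> first | rfl | tauto

theorem cnt_eq_add (h : ∀ p ∈ L, (P p ↔ Q p ∨ R p)) (h' : ∀ p ∈ L, ¬ (Q p ∧ R p)) :
    cnt L P = cnt L Q + cnt L R := by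
  rw [cnt_split Q, cnt_congr (Q := Q) (fun p hp => by have := h p hp; tauto)]
  rw [cnt_congr (P := fun p => P p ∧ ¬ Q p) (Q := R) (fun p hp => by
    have := h p hp; have := h' p hp; tauto)]

/-- If the properties `P` and `Q` are nested on `L`, the number of members with both of them is
the minimum of the two numbers. -/
theorem cnt_and_of_nested (h : ∀ p ∈ L, ∀ q ∈ L, P p → ¬ Q p → Q q → ¬ P q → False) :
    cnt L (fun p => P p ∧ Q p) = min (cnt L P) (cnt L Q) := by
  by_cases hPQ : ∀ p ∈ L, P p → Q p
  · have h1 := cnt_mono hPQ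
    rw [min_eq_left h1]
    exact cnt_congr fun p hp => by have := hPQ p hp; tauto
  · push Not at hPQ
    obtain ⟨p, hp, h1, h2⟩ := hPQ
    have hQP : ∀ q ∈ L, Q q → P q := fun q hq hQ => by
      by_contra hP; exact h p hp q hq h1 h2 hQ hP
    rw [min_eq_right (cnt_mono hQP)]
    exact cnt_congr fun p hp => by have := hQP p hp; tauto

theorem cnt_eq_zero_or (h : ∀ p ∈ L, ∀ q ∈ L, P p → Q q → False) : cnt L P = 0 ∨ cnt L Q = 0 := by
  by_contra hc
  push Not at hc
  obtain ⟨p, hp, h1⟩ := (cnt_pos_iff (L := L) (P := P)).1 (lt_of_le_of_ne cnt_nonneg hc.1.symm)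
  obtain ⟨q, hq, h2⟩ := (cnt_pos_iff (L := L) (P := Q)).1 (lt_of_le_of_ne cnt_nonneg hc.2.symm)
  exact h p hp q hq h1 h2

theorem cnt_eq_count [DecidableEq α] (a : α) : cnt L (fun p => p = a) = L.count a := by
  induction L using Multiset.induction with
  | empty => simp [cnt]
  | cons b s ih =>
    have h0 : cnt (b ::ₘ s) (fun p => p = a) = indic (b = a) + cnt s (fun p => p = a) := by
      simp [cnt]
    rw [h0, ih, Multiset.count_cons]
    by_cases h : b = a
    · rw [indic_pos h, if_pos h.symm]; push_cast; ring
    · rw [indic_neg h, if_neg (Ne.symm h)]; simp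

theorem cnt_bind {β : Type*} (s : Multiset β) (f : β → Multiset α) :
    cnt (s.bind f) P = (s.map fun b => cnt (f b) P).sum := by
  unfold cnt
  rw [Multiset.map_bind, Multiset.sum_bind]

end cnt

/-! ### Noncrossing systems in triangles, quadrilaterals and polygons -/

/-- A multiset of pairwise noncrossing chords. -/
structure IsNonCrossing (L : Multiset (ℤ × ℤ)) : Prop where
  lt : ∀ p ∈ L, p.1 < p.2
  not_cross : ∀ p ∈ L, ∀ q ∈ L, ¬ Interleave p.1 p.2 q.1 q.2

/-- The number of members of `L` crossing `{i, k}`. -/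
def crossCount (L : Multiset (ℤ × ℤ)) (i k : ℤ) : ℤ := cnt L fun p => Interleave i k p.1 p.2

/-- The multiplicity of `{i, k}` in `L`. -/
def mult (L : Multiset (ℤ × ℤ)) (i k : ℤ) : ℤ := cnt L fun p => p.1 = i ∧ p.2 = k

/-- The intersection number of `{i, k}` with `L`. -/
def inter (L : Multiset (ℤ × ℤ)) (i k : ℤ) : ℤ := crossCount L i k - mult L i k

/-- A member equal to {i, k} and a member crossing {i, k} would cross each other. -/
theorem IsNonCrossing.mult_eq_zero_or {L : Multiset (ℤ × ℤ)} (h : IsNonCrossing L) (i k : ℤ) :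
    mult L i k = 0 ∨ crossCount L i k = 0 :=
  cnt_eq_zero_or fun p hp q hq h1 h2 => h.not_cross p hp q hq (by rw [h1.1, h1.2]; exact h2)

/-- Two nonnegative numbers, one of which is zero, are the positive and the negative part of their
difference. -/
theorem crossCount_mult_congr {L K : Multiset (ℤ × ℤ)} (hL : IsNonCrossing L) (hK : IsNonCrossing K)
    {i k : ℤ} (h : inter L i k = inter K i k) :
    crossCount L i k = crossCount K i k ∧ mult L i k = mult K i k := by
  have h1 := hL.mult_eq_zero_or i k
  have h2 := hK.mult_eq_zero_or i k
  have h3 : 0 ≤ mult L i k := cnt_nonneg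
  have h4 : 0 ≤ mult K i k := cnt_nonneg
  have h5 : 0 ≤ crossCount L i k := cnt_nonneg
  have h6 : 0 ≤ crossCount K i k := cnt_nonneg
  unfold inter at h
  omega

/-- The chord `p` has the vertex `x`. -/
def Touch (x : ℤ) (p : ℤ × ℤ) : Prop := p.1 = x ∨ p.2 = x

/-- The members of `L` that cut off the vertex `x` of the triangle `x, y, z`. -/
def corner (L : Multiset (ℤ × ℤ)) (i k c d : ℤ) : ℤ :=
  cnt L fun p => Interleave i k p.1 p.2 ∧ Interleave c d p.1 p.2

/-- The members of `L` that have the vertex `x` and cross `{y, z}`. -/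
def fan (L : Multiset (ℤ × ℤ)) (x y z : ℤ) : ℤ :=
  cnt L fun p => Touch x p ∧ Interleave y z p.1 p.2

section triangle

variable {L K : Multiset (ℤ × ℤ)} {x y z : ℤ}

/-- A chord that crosses one side of a triangle either crosses exactly one other side, cutting off
their common vertex, or ends at the opposite vertex. -/
theorem triangle_sides (hL : IsNonCrossing L) (hxy : x < y) (hyz : y < z) :
    crossCount L x y = corner L x y x z + corner L x y y z + fan L z x y ∧
    crossCount L y z = corner L x y y z + corner L x z y z + fan L x y z ∧
    crossCount L x z = corner L x y x z + corner L x z y z + fan L y x z := by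
  unfold crossCount corner fan Touch
  refine ⟨?_, ?_, ?_⟩ <;>
  · rw [← cnt_eq_add (P := fun p => _ ∨ _) (fun p _ => Iff.rfl), ← cnt_eq_add (fun p _ => Iff.rfl)]
    · refine cnt_congr fun p hp => ?_
      have := hL.lt p hp
      unfold Interleave; omega
    · intro p hp; have := hL.lt p hp; unfold Interleave; omega
    · intro p hp; have := hL.lt p hp; unfold Interleave; omega

/-- Members ending at different vertices and crossing the opposite sides would cross inside the
triangle; so would a member ending at a vertex and one cutting that vertex off. -/
theorem triangle_exclusive (hL : IsNonCrossing L) (hxy : x < y) (hyz : y < z) :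
    (fan L x y z = 0 ∨ fan L y x z = 0) ∧ (fan L x y z = 0 ∨ fan L z x y = 0) ∧
    (fan L y x z = 0 ∨ fan L z x y = 0) ∧ (fan L x y z = 0 ∨ corner L x y x z = 0) ∧
    (fan L y x z = 0 ∨ corner L x y y z = 0) ∧ (fan L z x y = 0 ∨ corner L x z y z = 0) := by
  unfold corner fan Touch
  refine ⟨?_, ?_, ?_, ?_, ?_, ?_⟩ <;>
  · refine cnt_eq_zero_or fun p hp q hq h1 h2 => hL.not_cross p hp q hq ?_
    have := hL.lt p hp
    have := hL.lt q hq
    unfold Interleave at *; omega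

/-- The way in which a noncrossing system passes through a triangle is determined by the numbers
of its intersections with the sides. -/
theorem triangle_determined (hL : IsNonCrossing L) (hK : IsNonCrossing K) (hxy : x < y)
    (hyz : y < z) (h1 : crossCount L x y = crossCount K x y)
    (h2 : crossCount L y z = crossCount K y z) (h3 : crossCount L x z = crossCount K x z) :
    corner L x y x z = corner K x y x z ∧ corner L x y y z = corner K x y y z ∧
    corner L x z y z = corner K x z y z ∧ fan L x y z = fan K x y z ∧
    fan L y x z = fan K y x z ∧ fan L z x y = fan K z x y := by
  obtain ⟨a1, a2, a3⟩ := triangle_sides hL hxy hyz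
  obtain ⟨b1, b2, b3⟩ := triangle_sides hK hxy hyz
  obtain ⟨c1, c2, c3, c4, c5, c6⟩ := triangle_exclusive hL hxy hyz
  obtain ⟨d1, d2, d3, d4, d5, d6⟩ := triangle_exclusive hK hxy hyz
  have e1 : 0 ≤ corner L x y x z := cnt_nonneg
  have e2 : 0 ≤ corner L x y y z := cnt_nonneg
  have e3 : 0 ≤ corner L x z y z := cnt_nonneg
  have e4 : 0 ≤ fan L x y z := cnt_nonneg
  have e5 : 0 ≤ fan L y x z := cnt_nonneg
  have e6 : 0 ≤ fan L z x y := cnt_nonneg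
  have f1 : 0 ≤ corner K x y x z := cnt_nonneg
  have f2 : 0 ≤ corner K x y y z := cnt_nonneg
  have f3 : 0 ≤ corner K x z y z := cnt_nonneg
  have f4 : 0 ≤ fan K x y z := cnt_nonneg
  have f5 : 0 ≤ fan K y x z := cnt_nonneg
  have f6 : 0 ≤ fan K z x y := cnt_nonneg
  -- A₁, A₂, A₃ are the corners at x, y, z and A₄, A₅, A₆ the fans there. A nonzero fan excludes the
  -- other fans and the corner at its vertex, so it is the positive part of the excess of the
  -- opposite side over the two other sides. The corners are then found from their pairwise sums.
  have fan_eq : ∀ A₁ A₂ A₃ A₄ A₅ A₆ : ℤ, 0 ≤ A₁ → 0 ≤ A₂ → 0 ≤ A₃ → 0 ≤ A₄ → 0 ≤ A₅ → 0 ≤ A₆ →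
      (A₄ = 0 ∨ A₅ = 0) → (A₄ = 0 ∨ A₆ = 0) → (A₅ = 0 ∨ A₆ = 0) → (A₄ = 0 ∨ A₁ = 0) →
      (A₅ = 0 ∨ A₂ = 0) → (A₆ = 0 ∨ A₃ = 0) →
      A₄ = max 0 ((A₂ + A₃ + A₄) - (A₁ + A₂ + A₆) - (A₁ + A₃ + A₅)) ∧
      A₅ = max 0 ((A₁ + A₃ + A₅) - (A₁ + A₂ + A₆) - (A₂ + A₃ + A₄)) ∧
      A₆ = max 0 ((A₁ + A₂ + A₆) - (A₂ + A₃ + A₄) - (A₁ + A₃ + A₅)) := by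
    intros; omega
  obtain ⟨g1, g2, g3⟩ := fan_eq _ _ _ _ _ _ e1 e2 e3 e4 e5 e6 c1 c2 c3 c4 c5 c6
  obtain ⟨k1, k2, k3⟩ := fan_eq _ _ _ _ _ _ f1 f2 f3 f4 f5 f6 d1 d2 d3 d4 d5 d6
  rw [← a1, ← a2, ← a3, h1, h2, h3, b1, b2, b3] at g1 g2 g3
  rw [← k1] at g1
  rw [← k2] at g2
  rw [← k3] at g3
  rw [a1, b1] at h1
  rw [a2, b2] at h2
  rw [a3, b3] at h3
  clear c1 c2 c3 c4 c5 c6 d1 d2 d3 d4 d5 d6 k1 k2 k3 a1 a2 a3 b1 b2 b3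
  refine ⟨?_, ?_, ?_, g1, g2, g3⟩ <;> omega

end triangle

/-- A member that crosses {b, d} but not {a, c} remains in one of the two triangles cut off by {a,
c}. There it cuts off b or d, or runs from a or c to an opposite side; {a, c} itself also belongs
here and is counted with the triangle at b. -/
theorem crossing_triangle_split {L : Multiset (ℤ × ℤ)} (hL : IsNonCrossing L) {a b c d : ℤ}
    (hab : a < b) (hbc : b < c) (hcd : c < d) :
    cnt L (fun p => Interleave b d p.1 p.2 ∧ ¬ Interleave a c p.1 p.2) =
      corner L a b b c + fan L a b c + fan L c a b + mult L a c
      + (corner L a d c d + fan L a c d + fan L c a d) := by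
  have lt := hL.lt
  rw [cnt_split fun p => a ≤ p.1 ∧ p.2 ≤ c]
  unfold corner fan mult Touch
  congr 1
  · rw [cnt_congr (Q := fun p => ((((a < p.1 ∧ p.1 < b) ∧ b < p.2 ∧ p.2 < c) ∨
        p.1 = a ∧ b < p.2 ∧ p.2 < c) ∨ p.2 = c ∧ a < p.1 ∧ p.1 < b) ∨ p.1 = a ∧ p.2 = c),
      cnt_eq_add (fun p _ => Iff.rfl), cnt_eq_add (fun p _ => Iff.rfl),
      cnt_eq_add (fun p _ => Iff.rfl)]
    · congr 1
      congr 1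
      · congr 1
        · refine cnt_congr fun p hp => ?_
          have := lt p hp
          unfold Interleave; omega
        · refine cnt_congr fun p hp => ?_
          have := lt p hp
          unfold Interleave; omega
      · refine cnt_congr fun p hp => ?_
        have := lt p hp
        unfold Interleave; omega
    · intro p hp; omega
    · intro p hp; omega
    · intro p hp; omega
    · intro p hp
      have := lt p hp
      unfold Interleave; omega
  · rw [cnt_congr (Q := fun p => (((c < p.1 ∧ p.1 < d) ∧ (p.2 < a ∨ d < p.2) ∨
        (c < p.2 ∧ p.2 < d) ∧ (p.1 < a ∨ d < p.1)) ∨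
        p.1 = a ∧ c < p.2 ∧ p.2 < d) ∨ (p.1 = c ∧ d < p.2 ∨ p.2 = c ∧ p.1 < a)),
      cnt_eq_add (fun p _ => Iff.rfl), cnt_eq_add (fun p _ => Iff.rfl)]
    · congr 1
      · congr 1
        · refine cnt_congr fun p hp => ?_
          have := lt p hp
          unfold Interleave; omega
        · refine cnt_congr fun p hp => ?_
          have := lt p hp
          unfold Interleave; omega
      · refine cnt_congr fun p hp => ?_
        have := lt p hp
        unfold Interleave; omega
    · intro p hp; have := lt p hp; omega
    · intro p hp; have := lt p hp; omega
    · intro p hp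
      have := lt p hp
      unfold Interleave; omega

/-- The number of crossings of a system with the second diagonal of a quadrilateral that also
cross the first one, minus the multiplicity of the second diagonal, as a function of the number
`n` of crossings with the first diagonal and of the numbers of corners at its two ends. -/
def diagonalExcess (n α₁ γ₁ α₂ γ₂ : ℤ) : ℤ :=
  (α₁ - min α₁ (n - γ₂)) + (α₂ - min (n - γ₁) α₂) - (min (n - γ₁) (n - γ₂) - min α₁ (n - γ₂)
    - min (n - γ₁) α₂ + min α₁ α₂)

set_option maxHeartbeats 1000000 in
/-- A formula for the intersection number with one diagonal of a quadrilateral, in terms of the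
passage of the system through the two triangles cut off by the other diagonal. -/
theorem inter_diagonal {L : Multiset (ℤ × ℤ)} (hL : IsNonCrossing L) {a b c d : ℤ} (hab : a < b)
    (hbc : b < c) (hcd : c < d) :
    inter L b d = diagonalExcess (crossCount L a c) (corner L a b a c) (corner L a c b c)
      (corner L a c a d) (corner L a c c d) + (corner L a b b c + fan L a b c + fan L c a b
      + mult L a c + (corner L a d c d + fan L a c d + fan L c a d)) := by
  have lt := hL.lt
  have nest : ∀ P Q : ℤ × ℤ → Prop,
      (∀ p q : ℤ × ℤ, p.1 < p.2 → q.1 < q.2 → P p → ¬ Q p → Q q → ¬ P q →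
        Interleave p.1 p.2 q.1 q.2) →
      cnt L (fun p => P p ∧ Q p) = min (cnt L P) (cnt L Q) := fun P Q h =>
    cnt_and_of_nested fun p hp q hq h1 h2 h3 h4 =>
      hL.not_cross p hp q hq (h p q (lt p hp) (lt q hq) h1 h2 h3 h4)
  -- The members crossing {a, c} are ordered by their crossing points, from a to c. On the side of b
  -- they first cross {a, b} (these form P1), then end at b (completing P2), then cross {b, c};
  -- likewise Q1 and Q2 on the side of d. All four are initial segments, so their overlaps are
  -- minima. P1 without Q2 and Q1 without P2 are the members crossing both diagonals. The members
  -- {b, d} are those in P2 and Q2 but in neither P1 nor Q1, and are counted by inclusion and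
  -- exclusion.
  set X := fun (i k : ℤ) (p : ℤ × ℤ) => Interleave i k p.1 p.2 with hX
  set P1 := fun p => X a b p ∧ X a c p with hP1
  set P2 := fun p => X a c p ∧ ¬ X b c p with hP2
  set Q1 := fun p => X a c p ∧ X a d p with hQ1
  set Q2 := fun p => X a c p ∧ ¬ X c d p with hQ2
  have n11 := nest P1 Q1 (by intro p q; simp only [P1, Q1, X]; unfold Interleave; omega)
  have n12 := nest P1 Q2 (by intro p q; simp only [P1, Q2, X]; unfold Interleave; omega)
  have n21 := nest P2 Q1 (by intro p q; simp only [P2, Q1, X]; unfold Interleave; omega)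
  have n22 := nest P2 Q2 (by intro p q; simp only [P2, Q2, X]; unfold Interleave; omega)
  have sP1 : cnt L P1 = corner L a b a c := rfl
  have sQ1 : cnt L Q1 = corner L a c a d := rfl
  have sP2 : crossCount L a c = corner L a c b c + cnt L P2 := cnt_split (X b c)
  have sQ2 : crossCount L a c = corner L a c c d + cnt L Q2 := cnt_split (X c d)
  have t1 : cnt L P1 = cnt L (fun p => P1 p ∧ Q2 p) + cnt L (fun p => P1 p ∧ ¬ Q2 p) := cnt_split Q2
  have t2 : cnt L Q1 = cnt L (fun p => Q1 p ∧ P2 p) + cnt L (fun p => Q1 p ∧ ¬ P2 p) := cnt_split P2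
  have t2' : cnt L (fun p => Q1 p ∧ P2 p) = cnt L (fun p => P2 p ∧ Q1 p) :=
    cnt_congr fun p _ => and_comm
  -- the multiplicity of the diagonal
  have u1 : cnt L (fun p => P2 p ∧ Q2 p) = cnt L (fun p => P2 p ∧ Q1 p)
      + cnt L (fun p => (P2 p ∧ Q2 p) ∧ ¬ Q1 p) := by
    rw [cnt_split Q1]
    congr 1
    refine cnt_congr fun p hp => ?_
    have := lt p hp
    simp only [P2, Q2, Q1, X]; unfold Interleave; omega
  have u2 : cnt L (fun p => P1 p ∧ Q2 p) = cnt L (fun p => P1 p ∧ Q1 p)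
      + cnt L (fun p => (P1 p ∧ Q2 p) ∧ ¬ Q1 p) := by
    rw [cnt_split Q1]
    congr 1
    refine cnt_congr fun p hp => ?_
    have := lt p hp
    simp only [P1, Q2, Q1, X]; unfold Interleave; omega
  have u3 : cnt L (fun p => (P2 p ∧ Q2 p) ∧ ¬ Q1 p) = cnt L (fun p => (P1 p ∧ Q2 p) ∧ ¬ Q1 p)
      + mult L b d := by
    refine cnt_eq_add (fun p hp => ?_) (fun p hp => ?_) <;>
    · have := lt p hp
      simp only [P1, P2, Q2, Q1, X]; unfold Interleave; omega
  -- the crossings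
  have v1 : crossCount L b d = cnt L (fun p => X b d p ∧ X a c p)
      + cnt L (fun p => X b d p ∧ ¬ X a c p) := cnt_split (X a c)
  have v2 : cnt L (fun p => X b d p ∧ X a c p) = cnt L (fun p => P1 p ∧ ¬ Q2 p)
      + cnt L (fun p => Q1 p ∧ ¬ P2 p) := by
    have r1 : cnt L (fun p => P1 p ∧ ¬ Q2 p) =
        cnt L (fun p => (a < p.1 ∧ p.1 < b) ∧ c < p.2 ∧ p.2 < d) := cnt_congr fun p hp => by
      have := lt p hp
      simp only [P1, Q2, X]; unfold Interleave; omega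
    have r2 : cnt L (fun p => Q1 p ∧ ¬ P2 p) =
        cnt L (fun p => (b < p.1 ∧ p.1 < c) ∧ d < p.2 ∨ (b < p.2 ∧ p.2 < c) ∧ p.1 < a) :=
      cnt_congr fun p hp => by
        have := lt p hp
        simp only [P2, Q1, X]; unfold Interleave; omega
    rw [r1, r2]
    refine cnt_eq_add (fun p hp => ?_) (fun p hp => by omega)
    have := lt p hp
    simp only [X]; unfold Interleave; omega
  have v3 : cnt L (fun p => X b d p ∧ ¬ X a c p) = corner L a b b c + fan L a b c + fan L c a b
      + mult L a c + (corner L a d c d + fan L a c d + fan L c a d) :=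
    crossing_triangle_split hL hab hbc hcd
  unfold inter
  have w1 : cnt L P2 = crossCount L a c - corner L a c b c := by omega
  have w2 : cnt L Q2 = crossCount L a c - corner L a c c d := by omega
  rw [sP1, sQ1] at n11
  rw [sP1, w2] at n12
  rw [w1, sQ1] at n21
  rw [w1, w2] at n22
  unfold diagonalExcess
  rw [← n11, ← n12, ← n21, ← n22]
  change crossCount L b d - mult L b d = _
  omega

/-- The intersection numbers with the sides and one diagonal of a quadrilateral determine the
intersection number with the other diagonal. -/
theorem quadrilateral {L K : Multiset (ℤ × ℤ)} (hL : IsNonCrossing L) (hK : IsNonCrossing K)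
    {a b c d : ℤ} (hab : a < b) (hbc : b < c) (hcd : c < d) (h1 : inter L a b = inter K a b)
    (h2 : inter L b c = inter K b c) (h3 : inter L c d = inter K c d)
    (h4 : inter L a d = inter K a d) (h5 : inter L a c = inter K a c) :
    inter L b d = inter K b d := by
  obtain ⟨g1, -⟩ := crossCount_mult_congr hL hK h1
  obtain ⟨g2, -⟩ := crossCount_mult_congr hL hK h2
  obtain ⟨g3, -⟩ := crossCount_mult_congr hL hK h3
  obtain ⟨g4, -⟩ := crossCount_mult_congr hL hK h4
  obtain ⟨g5, g6⟩ := crossCount_mult_congr hL hK h5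
  obtain ⟨e1, e2, e3, e4, e5, e6⟩ := triangle_determined hL hK hab hbc g1 g2 g5
  obtain ⟨f1, f2, f3, f4, f5, f6⟩ := triangle_determined hL hK (hab.trans hbc) hcd g5 g3 g4
  rw [inter_diagonal hL hab hbc hcd, inter_diagonal hK hab hbc hcd, e1, e2, e3, e4, e6, f1, f2, f3, f4, f5, g5, g6]

/-- The image of a system under the reflection `i ↦ -i`. -/
def reflect (L : Multiset (ℤ × ℤ)) : Multiset (ℤ × ℤ) := L.map fun p => (-p.2, -p.1)

theorem inter_reflect (L : Multiset (ℤ × ℤ)) (i k : ℤ) :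
    inter (reflect L) (-k) (-i) = inter L i k := by
  unfold inter crossCount mult cnt reflect
  simp only [Multiset.map_map, Function.comp_def]
  congr 1 <;>
  · refine congrArg _ (Multiset.map_congr rfl fun p _ => indic_congr ?_)
    try simp only [Interleave]
    omega

theorem IsNonCrossing.reflect {L : Multiset (ℤ × ℤ)} (h : IsNonCrossing L) :
    IsNonCrossing (reflect L) := by
  refine ⟨fun p hp => ?_, fun p hp q hq => ?_⟩
  · obtain ⟨p, hp', rfl⟩ := Multiset.mem_map.1 hp
    have := h.lt p hp'
    simpa
  · obtain ⟨p, hp', rfl⟩ := Multiset.mem_map.1 hp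
    obtain ⟨q, hq', rfl⟩ := Multiset.mem_map.1 hq
    have := h.not_cross p hp' q hq'
    unfold Interleave at *
    omega

/-- The reflection reverses the order of the vertices and so exchanges the two diagonals. -/
theorem quadrilateral' {L K : Multiset (ℤ × ℤ)} (hL : IsNonCrossing L) (hK : IsNonCrossing K)
    {a b c d : ℤ} (hab : a < b) (hbc : b < c) (hcd : c < d) (h1 : inter L a b = inter K a b)
    (h2 : inter L b c = inter K b c) (h3 : inter L c d = inter K c d)
    (h4 : inter L a d = inter K a d) (h5 : inter L b d = inter K b d) :
    inter L a c = inter K a c := by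
  rw [← inter_reflect L, ← inter_reflect K] at *
  exact quadrilateral hL.reflect hK.reflect (neg_lt_neg hcd) (neg_lt_neg hbc) (neg_lt_neg hab)
    h3 h2 h1 h4 h5

open Classical in
/-- Two noncrossing systems have the same intersection numbers with all chords of a polygon if
they have the same intersection numbers with the chords that do not cross any member of a given
set of pairwise noncrossing chords. -/
theorem polygon_determined {L K : Multiset (ℤ × ℤ)} (hL : IsNonCrossing L) (hK : IsNonCrossing K)
    (V : Set ℤ) (S : Finset (ℤ × ℤ)) (hSV : ∀ p ∈ S, p.1 ∈ V ∧ p.2 ∈ V ∧ p.1 < p.2)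
    (hS : ∀ p ∈ S, ∀ q ∈ S, ¬ Interleave p.1 p.2 q.1 q.2)
    (h : ∀ i ∈ V, ∀ k ∈ V, i < k → (∀ p ∈ S, ¬ Interleave i k p.1 p.2) →
      inter L i k = inter K i k) :
    ∀ i ∈ V, ∀ k ∈ V, i < k → inter L i k = inter K i k := by
  -- Induction on the number of members of S crossed by {i, k}: a crossed member {x, y} is the other
  -- diagonal of the quadrilateral with vertices i, k, x, y, and it is itself uncrossed.
  have key : ∀ N : ℕ, ∀ i ∈ V, ∀ k ∈ V, i < k →
      (S.filter fun p => Interleave i k p.1 p.2).card = N → inter L i k = inter K i k := by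
    intro N
    induction N using Nat.strong_induction_on with
    | _ N ih =>
    intro i hi k hk hik hN
    by_cases hc : ∀ p ∈ S, ¬ Interleave i k p.1 p.2
    · exact h i hi k hk hik hc
    push Not at hc
    obtain ⟨⟨x, y⟩, hp, hx⟩ := hc
    obtain ⟨hxV, hyV, hxy⟩ := hSV _ hp
    simp only at hxV hyV hxy hx
    have hxyeq : inter L x y = inter K x y := h x hxV y hyV hxy fun q hq => hS _ hp q hq
    -- the sides of the quadrilateral cross fewer members of `S`
    have side : ∀ a ∈ V, ∀ b ∈ V, a < b → (a = i ∨ a = k ∨ a = x ∨ a = y) →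
        (b = i ∨ b = k ∨ b = x ∨ b = y) → ¬ (a = i ∧ b = k) → ¬ (a = x ∧ b = y) →
        inter L a b = inter K a b := by
      intro a ha b hb hab h1 h2 h3 h4
      refine ih _ ?_ a ha b hb hab rfl
      rw [← hN]
      -- A member of S that crosses a side does not cross {x, y}, so it crosses {i, k} as well. The
      -- count drops because {x, y} crosses {i, k} but no side.
      refine Finset.card_lt_card ⟨fun q hq => ?_, fun hsub => ?_⟩
      · rw [Finset.mem_filter] at hq ⊢
        refine ⟨hq.1, ?_⟩
        have g1 := hS _ hp q hq.1
        have g2 := (hSV q hq.1).2.2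
        have g3 := hq.2
        unfold Interleave at *
        simp only at g1
        omega
      · have := hsub (Finset.mem_filter.2 ⟨hp, hx⟩)
        rw [Finset.mem_filter] at this
        have g3 := this.2
        unfold Interleave at *
        simp only at g3
        omega
    rcases hx with hx | hx
    · exact quadrilateral' hL hK hx.1 hx.2.1 hx.2.2
        (side i hi x hxV (by omega) (by omega) (by omega) (by omega) (by omega))
        (side x hxV k hk (by omega) (by omega) (by omega) (by omega) (by omega))
        (side k hk y hyV (by omega) (by omega) (by omega) (by omega) (by omega))
        (side i hi y hyV (by omega) (by omega) (by omega) (by omega) (by omega)) hxyeq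
    · exact quadrilateral hL hK hx.1 hx.2.1 hx.2.2
        (side x hxV i hi (by omega) (by omega) (by omega) (by omega) (by omega))
        (side i hi y hyV (by omega) (by omega) (by omega) (by omega) (by omega))
        (side y hyV k hk (by omega) (by omega) (by omega) (by omega) (by omega))
        (side x hxV k hk (by omega) (by omega) (by omega) (by omega) (by omega)) hxyeq
  exact fun i hi k hk hik => key _ i hi k hk hik rfl

end ChordSystem

/-! ### Arcs of a once-punctured polygon, in the universal cover -/

/-- The arcs of a once-punctured polygon with `n` vertices. The vertices of the universal cover are
the integers: a chord lifts to the chord from `i` to `k`, and `rad j τ` joins the vertex `j` to the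
puncture, where it is tagged by `τ`. -/
inductive CombArc
  | chord (i k : ℤ)
  | rad (j : ℤ) (τ : Bool)

namespace CombArc

open ChordSystem

variable {n : ℤ}

/-- Deck transformations. -/
def shift (n t : ℤ) : CombArc → CombArc
  | chord i k => chord (i + t * n) (k + t * n)
  | rad j τ => rad (j + t * n) τ

/-- Chords are required to join vertices that are not adjacent. -/
def Valid (n : ℤ) : CombArc → Prop
  | chord i k => 2 ≤ k - i ∧ k - i < n
  | rad _ _ => True

/-- The chosen representatives modulo deck transformations. -/
def Normalized (n : ℤ) : CombArc → Prop
  | chord i _ => 0 ≤ i ∧ i < n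
  | rad j _ => 0 ≤ j ∧ j < n

/-- Compatibility of arcs. -/
def Compat (n : ℤ) : CombArc → CombArc → Prop
  | chord i k, chord c d => ∀ t : ℤ, ¬ Interleave i k (c + t * n) (d + t * n)
  | chord i k, rad j _ => ∀ t : ℤ, ¬ (i < j + t * n ∧ j + t * n < k)
  | rad j _, chord i k => ∀ t : ℤ, ¬ (i < j + t * n ∧ j + t * n < k)
  | rad j τ, rad c ρ => τ = ρ ∨ n ∣ j - c

/-- An integer to the right of all vertices under consideration, in the role of the puncture. -/
def cusp (n : ℤ) : ℤ := 10 * n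

/-- The lifts of an arc that matter for the vertices between `-n` and `2 * n`. -/
def lifts (n : ℤ) : CombArc → Multiset (ℤ × ℤ)
  | chord i k => (Finset.Icc (-3 : ℤ) 3).val.map fun t => (i + t * n, k + t * n)
  | rad j _ => (Finset.Icc (-3 : ℤ) 3).val.map fun t => (j + t * n, cusp n)

/-- The arcs that are considered in the extended systems: chords of length `n`, which are loops
around the puncture, are admitted. -/
def Extended (n : ℤ) : CombArc → Prop
  | chord i k => (0 ≤ i ∧ i < n) ∧ 2 ≤ k - i ∧ k - i ≤ n
  | rad j _ => 0 ≤ j ∧ j < n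

/-- The set of all lifts of the arcs of a tagged triangulation. -/
structure IsTriangulation (n : ℤ) (T : Set CombArc) : Prop where
  valid : ∀ α ∈ T, Valid n α
  shift : ∀ α ∈ T, ∀ t, shift n t α ∈ T
  compat : ∀ α ∈ T, ∀ β ∈ T, Compat n α β
  maximal : ∀ α, Valid n α → (∀ β ∈ T, Compat n α β) → α ∈ T

theorem mul_add_le_mul {t s : ℤ} (hn : 0 < n) (h : t < s) : t * n + n ≤ s * n := by
  have : (t + 1) * n ≤ s * n := mul_le_mul_of_nonneg_right h hn.le
  linarith

theorem cnt_lifts_chord (i k : ℤ) (P : ℤ × ℤ → Prop) :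
    cnt (lifts n (chord i k)) P =
      ∑ t ∈ Finset.Icc (-3 : ℤ) 3, indic (P (i + t * n, k + t * n)) := by
  unfold cnt lifts
  rw [Multiset.map_map]; rfl

theorem cnt_lifts_rad (j : ℤ) (τ : Bool) (P : ℤ × ℤ → Prop) :
    cnt (lifts n (rad j τ)) P =
      ∑ t ∈ Finset.Icc (-3 : ℤ) 3, indic (P (j + t * n, cusp n)) := by
  unfold cnt lifts
  rw [Multiset.map_map]; rfl

theorem mem_lifts_chord {i k : ℤ} {p : ℤ × ℤ} : p ∈ lifts n (chord i k) ↔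
    ∃ t : ℤ, (-3 ≤ t ∧ t ≤ 3) ∧ p = (i + t * n, k + t * n) := by
  simp only [lifts, Multiset.mem_map, Finset.mem_val, Finset.mem_Icc, eq_comm]

theorem mem_lifts_rad {j : ℤ} {τ : Bool} {p : ℤ × ℤ} : p ∈ lifts n (rad j τ) ↔
    ∃ t : ℤ, (-3 ≤ t ∧ t ≤ 3) ∧ p = (j + t * n, cusp n) := by
  simp only [lifts, Multiset.mem_map, Finset.mem_val, Finset.mem_Icc, eq_comm]

theorem window_bounds {t : ℤ} (hn : 0 < n) (ht : -3 ≤ t ∧ t ≤ 3) :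
    -(3 * n) ≤ t * n ∧ t * n ≤ 3 * n := by
  constructor <;> nlinarith

/-- Within the window all ends other than the cusp are at most 6n, and arcs to the puncture start at
most at 4n; this is why 10n can serve as a vertex to the right of all others. -/
theorem lifts_bounds (hn : 0 < n) {α : CombArc} (hα : Extended n α) {p : ℤ × ℤ}
    (hp : p ∈ lifts n α) : 2 ≤ p.2 - p.1 ∧
      (p.2 ≤ 6 * n ∧ p.2 - p.1 ≤ n ∨ p.2 = cusp n ∧ p.1 ≤ 4 * n) := by
  cases α with
  | chord i k =>
    obtain ⟨t, ht, rfl⟩ := mem_lifts_chord.1 hp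
    have := window_bounds hn ht
    obtain ⟨h1, h2⟩ := hα
    simp only
    omega
  | rad j τ =>
    obtain ⟨t, ht, rfl⟩ := mem_lifts_rad.1 hp
    have := window_bounds hn ht
    obtain ⟨h1, h2⟩ := hα
    have : cusp n = 10 * n := rfl
    refine ⟨?_, Or.inr ⟨rfl, ?_⟩⟩ <;>
    · simp only; omega

/-- Two representatives in the same orbit of deck transformations are equal. -/
theorem eq_of_add_mul {c c' t t' : ℤ} (hc : 0 ≤ c ∧ c < n) (hc' : 0 ≤ c' ∧ c' < n)
    (h : c + t * n = c' + t' * n) : c = c' ∧ t = t' := by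
  have hn : 0 < n := by omega
  rcases lt_trichotomy t t' with h' | h' | h'
  · have := mul_add_le_mul hn h'; omega
  · subst h'; omega
  · have := mul_add_le_mul hn h'; omega

theorem sum_window_eq_single {f : ℤ → ℤ} {t : ℤ} (ht : -3 ≤ t ∧ t ≤ 3)
    (h : ∀ s, -3 ≤ s ∧ s ≤ 3 → s ≠ t → f s = 0) : ∑ s ∈ Finset.Icc (-3 : ℤ) 3, f s = f t :=
  Finset.sum_eq_single t (fun s hs hst => h s (Finset.mem_Icc.1 hs) hst)
    (fun hc => absurd (Finset.mem_Icc.2 ht) hc)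

section mult

variable {M : Multiset CombArc} (hM : ∀ α ∈ M, Extended n α)
include hM

/-- Representatives start in [0, n), so a given lift comes from one representative and one
translation only. -/
theorem mult_bind_chord {c d t : ℤ} (hcd : Extended n (chord c d)) (ht : -3 ≤ t ∧ t ≤ 3) :
    mult (M.bind (lifts n)) (c + t * n) (d + t * n) = cnt M fun α => α = chord c d := by
  have hn : 0 < n := by obtain ⟨h1, h2⟩ := hcd; omega
  unfold mult
  rw [cnt_bind, cnt]
  refine congrArg _ (Multiset.map_congr rfl fun α hα => ?_)
  have hα' := hM α hα
  by_cases h : α = chord c d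
  · subst h
    rw [indic_pos rfl, cnt_lifts_chord, sum_window_eq_single ht]
    · exact indic_pos ⟨rfl, rfl⟩
    · intro s _ hst
      refine indic_neg fun h => hst ?_
      exact (eq_of_add_mul hcd.1 hcd.1 h.1).2
  · rw [indic_neg h, cnt_eq_zero_iff]
    intro p hp hpe
    cases α with
    | chord i k =>
      obtain ⟨s, hs, rfl⟩ := mem_lifts_chord.1 hp
      obtain ⟨h1, h2⟩ := eq_of_add_mul hα'.1 hcd.1 hpe.1
      subst h1 h2
      have h3 : k = d := by have := hpe.2; simp only at this; omega
      exact h (by rw [h3])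
    | rad j τ =>
      obtain ⟨s, hs, rfl⟩ := mem_lifts_rad.1 hp
      have := window_bounds hn ht
      obtain ⟨h1, h2⟩ := hcd
      have h3 := hpe.2
      simp only [cusp] at h3
      omega

theorem mult_bind_rad {c : ℤ} (hc : 0 ≤ c ∧ c < n) :
    mult (M.bind (lifts n)) c (cusp n) = cnt M fun α => ∃ τ, α = rad c τ := by
  have hn : 0 < n := by omega
  unfold mult
  rw [cnt_bind, cnt]
  refine congrArg _ (Multiset.map_congr rfl fun α hα => ?_)
  have hα' := hM α hα
  by_cases h : ∃ τ, α = rad c τ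
  · rw [indic_pos h]
    obtain ⟨τ, rfl⟩ := h
    rw [cnt_lifts_rad, sum_window_eq_single (t := 0) (by omega)]
    · exact indic_pos ⟨by simp, rfl⟩
    · intro s _ hst
      refine indic_neg fun h => hst ?_
      exact (eq_of_add_mul (t' := 0) hc hc (by simpa using h.1)).2
  · rw [indic_neg h, cnt_eq_zero_iff]
    intro p hp hpe
    cases α with
    | chord i k =>
      obtain ⟨s, hs, rfl⟩ := mem_lifts_chord.1 hp
      have := window_bounds hn hs
      obtain ⟨h1, h2⟩ := hα'
      have h3 := hpe.2
      simp only [cusp] at h3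
      omega
    | rad j τ =>
      obtain ⟨s, hs, rfl⟩ := mem_lifts_rad.1 hp
      have h1 : j = c := (eq_of_add_mul (t' := 0) hα' hc (by simpa using hpe.1)).1
      subst h1
      exact h ⟨τ, rfl⟩

end mult

theorem inter_side_eq_zero {M : Multiset CombArc} (hM : ∀ α ∈ M, Extended n α) (hn : 0 < n)
    {i : ℤ} : inter (M.bind (lifts n)) i (i + 1) = 0 := by
  have h1 : crossCount (M.bind (lifts n)) i (i + 1) = 0 := by
    refine cnt_eq_zero_iff.2 fun p _ => ?_
    unfold Interleave; omega
  have h2 : mult (M.bind (lifts n)) i (i + 1) = 0 := by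
    refine cnt_eq_zero_iff.2 fun p hp hpe => ?_
    obtain ⟨α, hα, hp'⟩ := Multiset.mem_bind.1 hp
    have := lifts_bounds hn (hM α hα) hp'
    omega
  rw [inter, h1, h2]; rfl

set_option maxHeartbeats 1000000 in
/-- If two extended systems have the same intersection numbers with the arcs of a triangulation
that contains an arc from the vertex `u` to the puncture, they contain the same chords, and the
same numbers of arcs from each vertex to the puncture. -/
theorem extended_determined (hn : 4 ≤ n) {T : Set CombArc} (hT : IsTriangulation n T) {u : ℤ}
    (hu : 0 ≤ u ∧ u < n) {τ : Bool} (hTu : rad u τ ∈ T) {M N : Multiset CombArc}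
    (hM : ∀ α ∈ M, Extended n α) (hN : ∀ α ∈ N, Extended n α)
    (hL : IsNonCrossing (M.bind (lifts n))) (hK : IsNonCrossing (N.bind (lifts n)))
    (hchord : ∀ i k, chord i k ∈ T → -n ≤ i → k ≤ 2 * n →
      inter (M.bind (lifts n)) i k = inter (N.bind (lifts n)) i k)
    (hrad : ∀ j, rad j τ ∈ T → -n ≤ j → j ≤ 2 * n →
      inter (M.bind (lifts n)) j (cusp n) = inter (N.bind (lifts n)) j (cusp n))
    (hloop : rad u (!τ) ∈ T → ∀ w, w = u ∨ w = u - n →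
      inter (M.bind (lifts n)) w (w + n) = inter (N.bind (lifts n)) w (w + n)) :
    (∀ c d, cnt M (fun α => α = chord c d) = cnt N (fun α => α = chord c d)) ∧
    ∀ c, cnt M (fun α => ∃ ρ, α = rad c ρ) = cnt N (fun α => ∃ ρ, α = rad c ρ) := by
  classical
  have hn0 : 0 < n := by omega
  set B := cusp n with hB
  have hB' : B = 10 * n := rfl
  have hTw : ∀ w, w = u ∨ w = u - n ∨ w = u + n → rad w τ ∈ T := by
    intro w hw
    rcases hw with rfl | rfl | rfl
    · exact hTu
    · simpa [shift, sub_eq_add_neg] using hT.shift _ hTu (-1)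
    · simpa [shift] using hT.shift _ hTu 1
  have not_cover : ∀ c d, chord c d ∈ T → ∀ j ρ, rad j ρ ∈ T → ¬ (c < j ∧ j < d) := by
    intro c d h1 j ρ h2
    simpa using hT.compat _ h1 _ h2 0
  have not_cross : ∀ c d, chord c d ∈ T → ∀ i k, chord i k ∈ T → ¬ Interleave c d i k := by
    intro c d h1 j ρ h2
    simpa using hT.compat _ h1 _ h2 0
  have only_u : ∀ c, rad c (!τ) ∈ T → n ∣ u - c ∧ rad u (!τ) ∈ T := by
    intro c hc
    have h := hT.compat _ hTu _ hc
    have h' : n ∣ u - c := by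
      rcases h with h | h
      · exact absurd h.symm (Bool.not_ne_self τ)
      · exact h
    refine ⟨h', ?_⟩
    obtain ⟨t, ht⟩ := h'
    have h1 := hT.shift _ hc t
    have h2 : c + t * n = u := by rw [mul_comm]; omega
    simpa [shift, h2] using h1
  -- The polygon consists of two periods around u and the cusp. It is dissected by the lifts of T
  -- inside it, where arcs with tag τ become chords to the cusp, and the arc at u with the other
  -- tag, if present, is replaced by the two lifts of the loop at u.
  set V : Set ℤ := {x | (u - n ≤ x ∧ x ≤ u + n) ∨ x = B} with hV
  set Sp : ℤ × ℤ → Prop := fun p => (chord p.1 p.2 ∈ T ∨ (p.2 = B ∧ rad p.1 τ ∈ T)) ∨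
    (rad u (!τ) ∈ T ∧ ((p.1 = u ∨ p.1 = u - n) ∧ p.2 = p.1 + n)) with hSp
  set S : Finset (ℤ × ℤ) := ((Finset.Icc (u - n) (u + n)) ×ˢ
    (insert B (Finset.Icc (u - n) (u + n)))).filter Sp with hSdef
  have memS : ∀ x y, (x, y) ∈ S ↔
      ((u - n ≤ x ∧ x ≤ u + n) ∧ (y = B ∨ (u - n ≤ y ∧ y ≤ u + n))) ∧ Sp (x, y) := by
    intro x y
    simp [hSdef]
  have chord_mem : ∀ c d, chord c d ∈ T → u - n ≤ c → d ≤ u + n → (c, d) ∈ S := by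
    intro c d h h1 h2
    have := hT.valid _ h
    unfold Valid at this
    exact (memS c d).2 ⟨by omega, Or.inl (Or.inl h)⟩
  have rad_mem : ∀ j, rad j τ ∈ T → u - n ≤ j → j ≤ u + n → (j, B) ∈ S := by
    intro j h h1 h2
    exact (memS j B).2 ⟨by omega, Or.inl (Or.inr ⟨rfl, h⟩)⟩
  have loop_mem : rad u (!τ) ∈ T → (u, u + n) ∈ S ∧ (u - n, u) ∈ S := fun h =>
    ⟨(memS _ _).2 ⟨by omega, Or.inr ⟨h, by simp⟩⟩, (memS _ _).2 ⟨by omega, Or.inr ⟨h, by simp⟩⟩⟩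
  have main := polygon_determined hL hK V S ?_ ?_ ?_
  · have lift_chord : ∀ c d, Extended n (chord c d) →
        cnt M (fun α => α = chord c d) = cnt N (fun α => α = chord c d) := by
      intro c d hcd
      -- Two periods suffice for every chord of length at most n: one that passes beyond u + n
      -- starts to the right of u, and fits after translation by -n.
      obtain ⟨t, ht, h1, h2⟩ : ∃ t : ℤ, (-3 ≤ t ∧ t ≤ 3) ∧ u - n ≤ c + t * n ∧ d + t * n ≤ u + n := by
        obtain ⟨h1, h2⟩ := hcd
        by_cases h : d ≤ u + n
        · exact ⟨0, by omega, by omega, by omega⟩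
        · exact ⟨-1, by omega, by omega, by omega⟩
      have hlt : c + t * n < d + t * n := by have := hcd.2; omega
      have := main (c + t * n) (Or.inl (by omega)) (d + t * n) (Or.inl (by omega)) hlt
      rw [← mult_bind_chord hM hcd ht, ← mult_bind_chord hN hcd ht]
      exact (crossCount_mult_congr hL hK this).2
    refine ⟨fun c d => ?_, fun c => ?_⟩
    · by_cases hcd : Extended n (chord c d)
      · exact lift_chord c d hcd
      · rw [cnt_eq_zero_iff.2, cnt_eq_zero_iff.2]
        · intro α hα h; exact hcd (h ▸ hN α hα)
        · intro α hα h; exact hcd (h ▸ hM α hα)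
    · by_cases hc : 0 ≤ c ∧ c < n
      · rw [← mult_bind_rad hM hc, ← mult_bind_rad hN hc]
        refine (crossCount_mult_congr hL hK ?_).2
        exact main c (Or.inl (by omega)) B (Or.inr rfl) (by omega)
      · rw [cnt_eq_zero_iff.2, cnt_eq_zero_iff.2]
        · rintro α hα ⟨ρ, rfl⟩; exact hc (hN _ hα)
        · rintro α hα ⟨ρ, rfl⟩; exact hc (hM _ hα)
  · rintro ⟨x, y⟩ hp
    obtain ⟨⟨h1, h2⟩, h3⟩ := (memS x y).1 hp
    refine ⟨Or.inl h1, ?_, ?_⟩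
    · rcases h2 with h2 | h2
      · exact Or.inr h2
      · exact Or.inl h2
    · rcases h3 with (h3 | h3) | h3
      · have := hT.valid _ h3
        unfold Valid at this
        simp only at *; omega
      · have := h3.1; simp only at *; omega
      · have := h3.2; simp only at *; omega
  · rintro ⟨x, y⟩ hp ⟨x', y'⟩ hq
    obtain ⟨⟨h1, h2⟩, h3⟩ := (memS x y).1 hp
    obtain ⟨⟨h1', h2'⟩, h3'⟩ := (memS x' y').1 hq
    have notcov : ∀ c d, chord c d ∈ T → u - n ≤ c → c ≤ u + n → d ≠ B := by
      intro c d h g1 g2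
      have := hT.valid _ h
      unfold Valid at this
      omega
    -- A τ-tagged arc compatible with the oppositely tagged arc at u starts at a translate of u,
    -- hence never strictly inside a lift of the loop.
    have no_loop : ∀ j w, rad j τ ∈ T → rad u (!τ) ∈ T → (w = u ∨ w = u - n) →
        ¬ (w < j ∧ j < w + n) := by
      intro j w hj hu' hw hjw
      have h := hT.compat _ hj _ hu'
      rcases h with h | h
      · exact absurd h.symm (Bool.not_ne_self τ)
      · obtain ⟨t, ht⟩ := h
        rcases lt_trichotomy t 0 with h' | h' | h'
        · have := mul_add_le_mul hn0 (show t < 0 from h'); rw [mul_comm] at ht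
          by_cases h'' : t = -1
          · subst h''; omega
          · have := mul_add_le_mul hn0 (show t < -1 by omega); omega
        · subst h'; omega
        · have := mul_add_le_mul hn0 (show 0 < t from h'); rw [mul_comm] at ht
          omega
    simp only [Interleave]
    rcases h3 with (h3 | h3) | ⟨h3, g3⟩ <;> rcases h3' with (h3' | h3') | ⟨h3', g3'⟩ <;>
      simp only at *
    · exact not_cross _ _ h3 _ _ h3'
    · have := notcov _ _ h3 h1.1 h1.2
      have := not_cover _ _ h3 _ _ h3'.2
      omega
    · have e1 := not_cover _ _ h3 _ _ (hTw x' (by omega))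
      have e2 := not_cover _ _ h3 _ _ (hTw y' (by omega))
      omega
    · have := notcov _ _ h3' h1'.1 h1'.2
      have := not_cover _ _ h3' _ _ h3.2
      omega
    · omega
    · have := no_loop _ x' h3.2 h3' g3'.1
      omega
    · have e1 := not_cover _ _ h3' _ _ (hTw x (by omega))
      have e2 := not_cover _ _ h3' _ _ (hTw y (by omega))
      omega
    · have := no_loop _ x h3'.2 h3 g3.1
      omega
    · omega
  -- By maximality of T, a chord of the polygon not crossed by the dissection is a side, a lift of
  -- an arc of T, a chord from a vertex of T to the cusp, or a loop at u. Chords longer than n have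
  -- u strictly inside and cross {u, cusp}.
  · intro i hi k hk hik huncrossed
    have hlift : ∀ c d, chord c d ∈ T → ∀ t : ℤ, chord (c + t * n) (d + t * n) ∈ T :=
      fun c d h t => hT.shift _ h t
    have hliftr : ∀ c ρ, rad c ρ ∈ T → ∀ t : ℤ, rad (c + t * n) ρ ∈ T :=
      fun c ρ h t => hT.shift _ h t
    rcases hk with hk | hk
    · have hi' : u - n ≤ i ∧ i ≤ u + n := by
        rcases hi with hi | hi
        · exact hi
        · omega
      rcases lt_trichotomy (k - i) n with hlen | hlen | hlen
      · by_cases h1 : k = i + 1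
        · rw [h1, inter_side_eq_zero hM hn0, inter_side_eq_zero hN hn0]
        · refine hchord i k (hT.maximal _ ⟨by omega, hlen⟩ ?_) (by omega) (by omega)
          rintro (⟨c, d⟩ | ⟨c, ρ⟩) hβ
          · intro t hcr
            have h2 := hlift c d hβ t
            have h3 := not_cover _ _ h2 _ _ (hTw (u - n) (by omega))
            have h4 := not_cover _ _ h2 _ _ (hTw (u + n) (by omega))
            have h5 := hT.valid _ h2
            unfold Valid at h5
            refine huncrossed _ (chord_mem _ _ h2 ?_ ?_) hcr <;>
            · unfold Interleave at hcr; omega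
          · intro t hcr
            have h2 := hliftr c ρ hβ t
            by_cases h3 : ρ = τ
            · subst h3
              refine huncrossed _ (rad_mem _ h2 (by omega) (by omega)) (Or.inl ?_)
              simp only; omega
            · have h4 : ρ = !τ := Bool.eq_not_of_ne h3
              subst h4
              obtain ⟨⟨s, hs⟩, -⟩ := only_u _ h2
              rw [mul_comm n s] at hs
              have h5 : s = 0 := by
                rcases lt_trichotomy s 0 with h' | h' | h'
                · have := mul_add_le_mul hn0 h'; omega
                · exact h'
                · have := mul_add_le_mul hn0 h'; omega
              subst h5
              refine huncrossed _ (rad_mem u hTu (by omega) (by omega)) (Or.inl ?_)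
              simp only; omega
      · have h1 := huncrossed _ (rad_mem u hTu (by omega) (by omega))
        simp only [Interleave] at h1
        have h2 : i = u ∨ i = u - n := by omega
        have h3 : k = i + n := by omega
        subst h3
        -- An uncrossed loop means that all τ-tagged arcs of T start at translates of u, so that the
        -- oppositely tagged arc at u is compatible with T.
        refine hloop (hT.maximal _ trivial ?_) i h2
        rintro (⟨c, d⟩ | ⟨c, ρ⟩) hβ
        · exact fun t ht => by
            have h4 := hliftr u τ hTu t
            exact not_cover _ _ hβ _ _ h4 ht
        · by_cases h3 : ρ = τ
          · right
            subst h3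
            have h5 := Int.emod_add_mul_ediv (c - i) n
            have h6 := Int.emod_nonneg (c - i) hn0.ne'
            have h7 := Int.emod_lt_of_pos (c - i) hn0
            have h8 := hliftr c ρ hβ (-((c - i) / n))
            have h9 : c + -((c - i) / n) * n = i + (c - i) % n := by
              have : -((c - i) / n) * n = -(n * ((c - i) / n)) := by ring
              omega
            rw [h9] at h8
            have h10 := huncrossed _ (rad_mem _ h8 (by omega) (by omega))
            simp only [Interleave] at h10
            have h11 : (c - i) % n = 0 := by omega
            have h12 : n ∣ c - i := Int.dvd_of_emod_eq_zero h11
            rcases h2 with rfl | rfl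
            · exact (dvd_sub_comm).1 h12
            · have : u - c = -(c - (u - n)) + n := by ring
              rw [this]
              exact dvd_add (dvd_neg.2 h12) dvd_rfl
          · exact Or.inl (Bool.eq_not_of_ne h3).symm
      · have h1 := huncrossed _ (rad_mem u hTu (by omega) (by omega))
        simp only [Interleave] at h1
        omega
    · subst hk
      have hi' : u - n ≤ i ∧ i ≤ u + n := by
        rcases hi with hi | hi
        · exact hi
        · omega
      refine hrad i (hT.maximal _ trivial ?_) (by omega) (by omega)
      rintro (⟨c, d⟩ | ⟨c, ρ⟩) hβ
      · intro t hcr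
        have h2 := hlift c d hβ (-t)
        have h3 := not_cover _ _ h2 _ _ (hTw (u - n) (by omega))
        have h4 := not_cover _ _ h2 _ _ (hTw (u + n) (by omega))
        have h6 : -t * n = -(t * n) := by ring
        simp only [h6] at h2 h3 h4 ⊢
        refine huncrossed _ (chord_mem _ _ h2 ?_ ?_) (Or.inr ?_)
        · omega
        · omega
        · simp only; omega
      · by_cases h3 : ρ = τ
        · exact Or.inl h3.symm
        · right
          have h4 : ρ = !τ := Bool.eq_not_of_ne h3
          subst h4
          -- An arc of T with the other tag puts the loops at u into the dissection, and not
          -- crossing them forces i to be a translate of u.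
          obtain ⟨h5, h6⟩ := only_u _ hβ
          obtain ⟨h7, h8⟩ := loop_mem h6
          have h9 := huncrossed _ h7
          have h10 := huncrossed _ h8
          simp only [Interleave] at h9 h10
          have h11 : i = u ∨ i = u - n ∨ i = u + n := by omega
          rcases h11 with rfl | rfl | rfl
          · exact h5
          · have : u - n - c = (u - c) - n := by ring
            rw [this]; exact dvd_sub h5 dvd_rfl
          · have : u + n - c = (u - c) + n := by ring
            rw [this]; exact dvd_add h5 dvd_rfl

end CombArc

/-! ### Crossings of lifted arcs with loops and with arcs to the puncture -/

namespace ChordSystem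

theorem cnt_le_add {α : Type*} {L : Multiset α} {P Q R : α → Prop} (h : ∀ p ∈ L, P p → Q p ∨ R p) :
    cnt L P ≤ cnt L Q + cnt L R := by
  rw [cnt_split Q]
  exact add_le_add (cnt_mono fun p _ => And.right)
    (cnt_mono fun p hp hP => by have := h p hp hP.1; tauto)

theorem cnt_add_le {α : Type*} {L : Multiset α} {P Q R : α → Prop} (h : ∀ p ∈ L, Q p ∨ R p → P p)
    (h' : ∀ p ∈ L, ¬ (Q p ∧ R p)) : cnt L Q + cnt L R ≤ cnt L P := by
  rw [← cnt_eq_add (P := fun p => Q p ∨ R p) (fun _ _ => Iff.rfl) h']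
  exact cnt_mono h

theorem cnt_map {α β : Type*} (s : Multiset α) (f : α → β) (P : β → Prop) :
    cnt (s.map f) P = cnt s fun a => P (f a) := by
  unfold cnt; rw [Multiset.map_map]; rfl

theorem inter_bind {β : Type*} (s : Multiset β) (f : β → Multiset (ℤ × ℤ)) (i k : ℤ) :
    inter (s.bind f) i k = (s.map fun b => inter (f b) i k).sum := by
  unfold inter crossCount mult
  rw [cnt_bind, cnt_bind, ← Multiset.sum_map_sub]

theorem crossCount_bind {β : Type*} (s : Multiset β) (f : β → Multiset (ℤ × ℤ)) (i k : ℤ) :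
    crossCount (s.bind f) i k = (s.map fun b => crossCount (f b) i k).sum := cnt_bind s f

end ChordSystem

namespace CombArc

open ChordSystem

variable {n : ℤ}

theorem sum_window (f : ℤ → ℤ) : ∑ t ∈ Finset.Icc (-3 : ℤ) 3, f t =
    f (-3) + f (-2) + f (-1) + f 0 + f 1 + f 2 + f 3 := by
  have : Finset.Icc (-3 : ℤ) 3 = {-3, -2, -1, 0, 1, 2, 3} := by decide
  rw [this]
  simp
  ring

theorem crossCount_rad_cusp (c j : ℤ) (τ : Bool) :
    crossCount (lifts n (rad c τ)) j (cusp n) = 0 := by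
  refine cnt_eq_zero_iff.2 fun p hp => ?_
  obtain ⟨t, -, rfl⟩ := mem_lifts_rad.1 hp
  unfold Interleave
  simp only
  omega

theorem mult_chord_cusp (hn : 0 < n) {c d j : ℤ} (h : Extended n (chord c d)) :
    mult (lifts n (chord c d)) j (cusp n) = 0 := by
  refine cnt_eq_zero_iff.2 fun p hp => ?_
  have h1 := lifts_bounds hn h hp
  obtain ⟨t, ht, rfl⟩ := mem_lifts_chord.1 hp
  have := window_bounds hn ht
  have h2 : cusp n = 10 * n := rfl
  obtain ⟨h3, h4⟩ := h
  simp only at *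
  omega

theorem mul_lt_cancel {t s : ℤ} (hn : 0 < n) (h : t * n < s * n) : t < s :=
  lt_of_mul_lt_mul_right h hn.le

/-- Euclidean division of the position of a vertex relative to another one. -/
theorem exists_quotient (hn : 0 < n) (c j : ℤ) :
    ∃ q r : ℤ, j = c + q * n + r ∧ 0 ≤ r ∧ r < n ∧ (n ∣ j - c ↔ r = 0) := by
  refine ⟨(j - c) / n, (j - c) % n, ?_, Int.emod_nonneg _ hn.ne', Int.emod_lt_of_pos _ hn,
    Int.dvd_iff_emod_eq_zero⟩
  have h5 := Int.emod_add_mul_ediv (j - c) n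
  have : (j - c) / n * n = n * ((j - c) / n) := mul_comm _ _
  omega

theorem mult_rad_cusp {c j : ℤ} (hc : 0 ≤ c ∧ c < n) (hj : -n ≤ j ∧ j ≤ 2 * n) (τ : Bool) :
    mult (lifts n (rad c τ)) j (cusp n) = indic (n ∣ j - c) := by
  have hn : 0 < n := by omega
  obtain ⟨q, r, h1, h2, h3, h4⟩ := exists_quotient hn c j
  unfold mult
  rw [cnt_lifts_rad]
  by_cases hr : r = 0
  · rw [indic_pos (h4.2 hr), sum_window_eq_single (t := q)]
    · exact indic_pos ⟨by simp only; omega, rfl⟩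
    · constructor
      · by_contra h; have := mul_add_le_mul hn (show q < -3 by omega); omega
      · by_contra h; have := mul_add_le_mul hn (show 3 < q by omega); omega
    · intro s _ hs
      refine indic_neg fun h => hs ?_
      have h5 := h.1
      simp only at h5
      exact mul_right_cancel₀ hn.ne' (by omega : s * n = q * n)
  · rw [indic_neg (fun h => hr (h4.1 h))]
    refine Finset.sum_eq_zero fun t _ => indic_neg fun h => hr ?_
    have h5 := h.1
    simp only at h5
    refine h4.1 ⟨t, ?_⟩
    rw [mul_comm]; omega

/-- The lifts of the loop tile the line, so j lies strictly inside exactly one of them, unless it is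
a translate of c. -/
theorem crossCount_loop_cusp {c j : ℤ} (hc : 0 ≤ c ∧ c < n) (hj : -n ≤ j ∧ j ≤ 2 * n) :
    crossCount (lifts n (chord c (c + n))) j (cusp n) = 1 - indic (n ∣ j - c) := by
  have hn : 0 < n := by omega
  have hcusp : cusp n = 10 * n := rfl
  obtain ⟨q, r, h1, h2, h3, h4⟩ := exists_quotient hn c j
  unfold crossCount
  rw [cnt_lifts_chord]
  have key : ∀ t : ℤ, -3 ≤ t ∧ t ≤ 3 →
      (Interleave j (cusp n) (c + t * n) (c + n + t * n) ↔ t = q ∧ r ≠ 0) := by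
    intro t ht
    have := window_bounds hn ht
    unfold Interleave
    rcases lt_trichotomy t q with h | h | h
    · have := mul_add_le_mul hn h; omega
    · subst h; omega
    · have := mul_add_le_mul hn h; omega
  by_cases hr : r = 0
  · rw [indic_pos (h4.2 hr)]
    refine Finset.sum_eq_zero fun t ht => indic_neg fun h => ?_
    exact ((key t (Finset.mem_Icc.1 ht)).1 h).2 hr
  · have hq : -3 ≤ q ∧ q ≤ 3 := by
      constructor
      · by_contra h; have := mul_add_le_mul hn (show q < -3 by omega); omega
      · by_contra h; have := mul_add_le_mul hn (show 3 < q by omega); omega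
    rw [indic_neg (fun h => hr (h4.1 h)), sum_window_eq_single hq]
    · rw [indic_pos ((key q hq).2 ⟨rfl, hr⟩)]; rfl
    · exact fun s hs hsq => indic_neg fun h => hsq ((key s hs).1 h).1

/-- An open interval of length n contains exactly one translate of c, unless its ends are translates
of c. -/
theorem crossCount_rad_loop {c w : ℤ} (hc : 0 ≤ c ∧ c < n) (hw : -n ≤ w ∧ w ≤ n) (τ : Bool) :
    crossCount (lifts n (rad c τ)) w (w + n) = 1 - indic (n ∣ w - c) := by
  have hn : 0 < n := by omega
  have hcusp : cusp n = 10 * n := rfl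
  obtain ⟨q, r, h1, h2, h3, h4⟩ := exists_quotient hn c w
  unfold crossCount
  rw [cnt_lifts_rad]
  have hqn : (q + 1) * n = q * n + n := by ring
  have key : ∀ t : ℤ, -3 ≤ t ∧ t ≤ 3 →
      (Interleave w (w + n) (c + t * n) (cusp n) ↔ t = q + 1 ∧ r ≠ 0) := by
    intro t ht
    have := window_bounds hn ht
    unfold Interleave
    rcases lt_trichotomy t (q + 1) with h | h | h
    · have := mul_add_le_mul hn h; omega
    · subst h; omega
    · have := mul_add_le_mul hn h; omega
  by_cases hr : r = 0
  · rw [indic_pos (h4.2 hr)]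
    refine Finset.sum_eq_zero fun t ht => indic_neg fun h => ?_
    exact ((key t (Finset.mem_Icc.1 ht)).1 h).2 hr
  · have hq : -3 ≤ q + 1 ∧ q + 1 ≤ 3 := by
      constructor
      · by_contra h; have := mul_add_le_mul hn (show q + 1 < -3 by omega); omega
      · by_contra h; have := mul_add_le_mul hn (show 3 < q + 1 by omega); omega
    rw [indic_neg (fun h => hr (h4.1 h)), sum_window_eq_single hq]
    · rw [indic_pos ((key _ hq).2 ⟨rfl, hr⟩)]; rfl
    · exact fun s hs hsq => indic_neg fun h => hsq ((key s hs).1 h).1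

/-- A loop around the puncture meets a chord as often as the two tagged arcs together that it
encloses. -/
theorem inter_loop {c i k : ℤ} (hc : 0 ≤ c ∧ c < n) (hi : -n ≤ i) (hk : k ≤ 2 * n)
    (hik : 2 ≤ k - i ∧ k - i < n) :
    inter (lifts n (chord c (c + n))) i k =
      inter (lifts n (rad c true)) i k + inter (lifts n (rad c false)) i k := by
  have hn : 0 < n := by omega
  have hcusp : cusp n = 10 * n := rfl
  have m1 : ∀ τ, mult (lifts n (rad c τ)) i k = 0 := fun τ => by
    refine cnt_eq_zero_iff.2 fun p hp h => ?_
    obtain ⟨t, ht, rfl⟩ := mem_lifts_rad.1 hp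
    simp only at h
    omega
  have m2 : mult (lifts n (chord c (c + n))) i k = 0 := by
    refine cnt_eq_zero_iff.2 fun p hp h => ?_
    obtain ⟨t, ht, rfl⟩ := mem_lifts_chord.1 hp
    simp only at h
    omega
  unfold inter
  rw [m1, m1, m2]
  unfold crossCount
  rw [cnt_lifts_rad, cnt_lifts_rad, cnt_lifts_chord]
  -- Since k - i < n, at most one end of a lift of the loop lies strictly between i and k, and the
  -- lift crosses {i, k} exactly when one does. Each such point is an end of two neighbouring lifts,
  -- which gives the factor two; the terms at the ends of the window vanish.
  set f : ℤ → ℤ := fun t => indic (i < c + t * n ∧ c + t * n < k) with hf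
  have e1 : ∀ t ∈ Finset.Icc (-3 : ℤ) 3, indic (Interleave i k (c + t * n) (cusp n)) = f t := by
    intro t _
    refine indic_congr ?_
    unfold Interleave; omega
  have e2 : ∀ t ∈ Finset.Icc (-3 : ℤ) 3,
      indic (Interleave i k (c + t * n) (c + n + t * n)) = f t + f (t + 1) := by
    intro t _
    have : (t + 1) * n = t * n + n := by ring
    simp only [hf, this]
    unfold indic Interleave
    split_ifs <;> omega
  rw [Finset.sum_congr rfl e1, Finset.sum_congr rfl e2]
  simp only [sum_window]
  norm_num
  have e3 : f (-3) = 0 := indic_neg (by omega)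
  have e4 : f 4 = 0 := indic_neg (by omega)
  rw [e3, e4]
  ring

/-- Moving the vertex by a period only renumbers the lifts; the one lift that leaves the window and
the one that enters it contribute nothing. -/
theorem crossCount_chord_cusp_add {c d j : ℤ} (h : Extended n (chord c d)) (hj : -n ≤ j ∧ j ≤ n) :
    crossCount (lifts n (chord c d)) (j + n) (cusp n) =
      crossCount (lifts n (chord c d)) j (cusp n) := by
  obtain ⟨h1, h2⟩ := h
  have hn : 0 < n := by omega
  have hcusp : cusp n = 10 * n := rfl
  unfold crossCount
  rw [cnt_lifts_chord, cnt_lifts_chord]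
  set f : ℤ → ℤ := fun t => indic (c + t * n < j ∧ j < d + t * n) with hf
  have e1 : ∀ t ∈ Finset.Icc (-3 : ℤ) 3,
      indic (Interleave j (cusp n) (c + t * n) (d + t * n)) = f t := by
    intro t ht
    have := window_bounds hn (Finset.mem_Icc.1 ht)
    refine indic_congr ?_
    unfold Interleave; omega
  have e2 : ∀ t ∈ Finset.Icc (-3 : ℤ) 3,
      indic (Interleave (j + n) (cusp n) (c + t * n) (d + t * n)) = f (t - 1) := by
    intro t ht
    have := window_bounds hn (Finset.mem_Icc.1 ht)
    have : (t - 1) * n = t * n - n := by ring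
    simp only [hf, this]
    refine indic_congr ?_
    unfold Interleave; omega
  rw [Finset.sum_congr rfl e1, Finset.sum_congr rfl e2]
  simp only [sum_window]
  norm_num
  have e3 : f (-4) = 0 := indic_neg (by omega)
  have e4 : f 3 = 0 := indic_neg (by omega)
  rw [e3, e4]
  ring

/-- Crossing lifts differ from the representatives by two translations, whose difference violates
compatibility. Two arcs to the puncture share the cusp, so their lifts never interleave, whatever
their tags. -/
theorem isNonCrossing_bind {M : Multiset CombArc} (hn : 0 < n) (hM : ∀ α ∈ M, Extended n α)
    (hc : ∀ α ∈ M, ∀ β ∈ M, Compat n α β) : IsNonCrossing (M.bind (lifts n)) := by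
  have hcusp : cusp n = 10 * n := rfl
  refine ⟨fun p hp => ?_, fun p hp q hq h => ?_⟩
  · obtain ⟨α, hα, hp'⟩ := Multiset.mem_bind.1 hp
    have := lifts_bounds hn (hM α hα) hp'
    omega
  · obtain ⟨α, hα, hp'⟩ := Multiset.mem_bind.1 hp
    obtain ⟨β, hβ, hq'⟩ := Multiset.mem_bind.1 hq
    have h1 := lifts_bounds hn (hM α hα) hp'
    have h2 := lifts_bounds hn (hM β hβ) hq'
    have h3 := hc α hα β hβ
    have e1 : ∀ s t : ℤ, (s - t) * n = s * n - t * n := fun s t => by ring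
    cases α with
    | chord i k =>
      obtain ⟨t, ht, rfl⟩ := mem_lifts_chord.1 hp'
      cases β with
      | chord c d =>
        obtain ⟨s, hs, rfl⟩ := mem_lifts_chord.1 hq'
        refine h3 (s - t) ?_
        rw [e1]
        unfold Interleave at *
        simp only at h
        omega
      | rad j τ =>
        obtain ⟨s, hs, rfl⟩ := mem_lifts_rad.1 hq'
        refine h3 (s - t) ?_
        rw [e1]
        have := window_bounds hn ht
        have := (hM _ hα).1
        have := (hM _ hα).2
        unfold Interleave at h
        simp only at h
        omega
    | rad j τ =>
      obtain ⟨t, ht, rfl⟩ := mem_lifts_rad.1 hp'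
      cases β with
      | chord c d =>
        obtain ⟨s, hs, rfl⟩ := mem_lifts_chord.1 hq'
        refine h3 (t - s) ?_
        rw [e1]
        have := window_bounds hn hs
        have := (hM _ hβ).1
        have := (hM _ hβ).2
        unfold Interleave at h
        simp only at h
        omega
      | rad c ρ =>
        obtain ⟨s, hs, rfl⟩ := mem_lifts_rad.1 hq'
        unfold Interleave at h
        simp only at h
        omega

/-- If no arc ended at the puncture, the left end of a longest chord would be covered by no chord,
since a covering chord would cross the longest one or be longer. An arc from that vertex to the
puncture could then be added to T. -/
theorem IsTriangulation.exists_rad (hn : 4 ≤ n) {T : Set CombArc} (hT : IsTriangulation n T) :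
    ∃ u τ, (0 ≤ u ∧ u < n) ∧ rad u τ ∈ T := by
  have hn0 : 0 < n := by omega
  suffices h : ∃ u τ, rad u τ ∈ T by
    obtain ⟨u, τ, h⟩ := h
    obtain ⟨q, r, h1, h2, h3, -⟩ := exists_quotient hn0 0 u
    refine ⟨r, τ, ⟨h2, h3⟩, ?_⟩
    have h4 := hT.shift _ h (-q)
    have : u + -q * n = r := by rw [h1]; ring
    simpa only [CombArc.shift, this] using h4
  by_contra hno
  push Not at hno
  suffices h : ∃ u, ∀ c d, chord c d ∈ T → ¬ (c < u ∧ u < d) by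
    obtain ⟨u, h⟩ := h
    refine hno u true (hT.maximal _ trivial ?_)
    rintro (⟨c, d⟩ | ⟨c, ρ⟩) hβ
    · intro t ht
      have := h _ _ (hT.shift _ hβ (-t))
      have : -t * n = -(t * n) := by ring
      omega
    · exact absurd hβ (hno c ρ)
  by_cases hex : ∃ i k, chord i k ∈ T
  · obtain ⟨m, ⟨i, k, hik, rfl⟩, hmax⟩ := Int.exists_greatest_of_bdd
      (P := fun m => ∃ i k, chord i k ∈ T ∧ m = k - i)
      ⟨n, by rintro _ ⟨i, k, h, rfl⟩; exact (hT.valid _ h).2.le⟩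
      (by obtain ⟨i, k, h⟩ := hex; exact ⟨_, i, k, h, rfl⟩)
    refine ⟨i, fun c d hcd h => ?_⟩
    have h1 := hmax _ ⟨c, d, hcd, rfl⟩
    have h2 := hT.compat _ hik _ hcd 0
    have h3 := hT.valid _ hik
    unfold Interleave at h2
    unfold Valid at h3
    simp only [zero_mul, add_zero] at h2
    omega
  · push Not at hex
    exact ⟨0, fun c d h => absurd h (hex c d)⟩

/-- The intersection number of `rad j τ` with an arc. -/
def radInter (n j : ℤ) (τ : Bool) : CombArc → ℤ
  | chord c d => crossCount (lifts n (chord c d)) j (cusp n)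
  | rad c ρ => indic (ρ ≠ τ) - indic (n ∣ j - c)

/-- The arc ends at the puncture with a tag different from `τ`. -/
def OtherTag (τ : Bool) (α : CombArc) : Prop := ∃ c ρ, α = rad c ρ ∧ ρ ≠ τ

/-- The arc joins the vertex `j` to the puncture. -/
def AtVertex (n j : ℤ) (α : CombArc) : Prop := ∃ c ρ, α = rad c ρ ∧ n ∣ j - c

theorem radInter_eq (j : ℤ) (τ : Bool) (α : CombArc) : radInter n j τ α =
    crossCount (lifts n α) j (cusp n) + indic (OtherTag τ α) - indic (AtVertex n j α) := by
  cases α with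
  | chord c d =>
    rw [indic_neg (P := OtherTag _ _), indic_neg (P := AtVertex _ _ _)]
    · simp [radInter]
    · rintro ⟨_, _, h, -⟩; cases h
    · rintro ⟨_, _, h, -⟩; cases h
  | rad c ρ =>
    rw [crossCount_rad_cusp, radInter, zero_add]
    congr 1 <;> refine indic_congr ⟨fun h => ⟨c, ρ, rfl, h⟩, ?_⟩
    · rintro ⟨_, _, h, h'⟩; cases h; exact h'
    · rintro ⟨_, _, h, h'⟩; cases h; exact h'

theorem sum_radInter (M : Multiset CombArc) (j : ℤ) (τ : Bool) :
    (M.map (radInter n j τ)).sum = crossCount (M.bind (lifts n)) j (cusp n)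
      + cnt M (OtherTag τ) - cnt M (AtVertex n j) := by
  rw [crossCount_bind]
  unfold cnt
  rw [← Multiset.sum_map_add, ← Multiset.sum_map_sub]
  exact congrArg _ (Multiset.map_congr rfl fun α _ => radInter_eq j τ α)

/-- A multiset of pairwise compatible arcs, given by representatives. -/
structure IsSystem (n : ℤ) (M : Multiset CombArc) : Prop where
  valid : ∀ α ∈ M, Valid n α
  normalized : ∀ α ∈ M, Normalized n α
  compat : ∀ α ∈ M, ∀ β ∈ M, Compat n α β

theorem IsSystem.extended {M : Multiset CombArc} (hM : IsSystem n M) : ∀ α ∈ M, Extended n α := by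
  intro α hα
  have h1 := hM.valid α hα
  have h2 := hM.normalized α hα
  cases α with
  | chord i k => exact ⟨h2, h1.1, h1.2.le⟩
  | rad j τ => exact h2

/-- Unless `rad u τ` is itself a member, the only negative contribution, that of an arc at the same
vertex, is compensated by its different tag. All terms are then nonnegative and must vanish, which
says that nothing crosses and that every differently tagged arc starts at u modulo n. -/
theorem IsSystem.compat_of_sum_le (hn : 4 ≤ n) {M : Multiset CombArc} (hM : IsSystem n M) {u : ℤ}
    {τ : Bool} (hu : 0 ≤ u ∧ u < n) (h : (M.map (radInter n u τ)).sum ≤ 0) :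
    ∀ α ∈ M, Compat n (rad u τ) α := by
  by_cases hmem : rad u τ ∈ M
  · exact fun α hα => hM.compat _ hmem α hα
  have hn0 : 0 < n := by omega
  have hcusp : cusp n = 10 * n := rfl
  rw [sum_radInter] at h
  have h1 : 0 ≤ crossCount (M.bind (lifts n)) u (cusp n) := cnt_nonneg
  have h2 : cnt M (AtVertex n u) ≤ cnt M (fun α => OtherTag τ α ∧ AtVertex n u α) := by
    refine cnt_mono fun α hα hat => ⟨?_, hat⟩
    obtain ⟨c, ρ, rfl, hc⟩ := hat
    refine ⟨c, ρ, rfl, fun hρ => hmem ?_⟩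
    obtain ⟨t, ht⟩ := hc
    have h3 : c = u := (eq_of_add_mul (t := t) (t' := 0) (hM.normalized _ hα) hu
      (by rw [mul_comm] at ht; omega)).1
    rw [← h3, ← hρ]
    exact hα
  have h3 : cnt M (OtherTag τ) = _ := cnt_split (AtVertex n u)
  have h4 : 0 ≤ cnt M (fun α => OtherTag τ α ∧ ¬ AtVertex n u α) := cnt_nonneg
  have h5 : crossCount (M.bind (lifts n)) u (cusp n) = 0 := by omega
  have h6 : cnt M (fun α => OtherTag τ α ∧ ¬ AtVertex n u α) = 0 := by omega
  rintro (⟨c, d⟩ | ⟨c, ρ⟩) hα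
  · intro t ht
    have hv := hM.valid _ hα
    have hno := hM.normalized _ hα
    unfold Valid at hv
    unfold Normalized at hno
    have ht' : -3 ≤ -t ∧ -t ≤ 3 := by
      constructor
      · by_contra h; have := mul_add_le_mul hn0 (show 3 < t by omega); omega
      · by_contra h; have := mul_add_le_mul hn0 (show t < -3 by omega); omega
    refine cnt_eq_zero_iff.1 h5 (c + -t * n, d + -t * n)
      (Multiset.mem_bind.2 ⟨_, hα, mem_lifts_chord.2 ⟨_, ht', rfl⟩⟩) (Or.inr ?_)
    have := window_bounds hn0 ht'
    have e1 : -t * n = -(t * n) := by ring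
    simp only
    omega
  · by_cases hρ : τ = ρ
    · exact Or.inl hρ
    · have := cnt_eq_zero_iff.1 h6 _ hα
      simp only [not_and, not_not] at this
      obtain ⟨c', ρ', h7, h8⟩ := this ⟨c, ρ, rfl, Ne.symm hρ⟩
      cases h7
      exact Or.inr h8

/-- Nothing crosses a member, and every arc with a different tag must start at the same vertex
modulo n, where its contribution is zero. In the contrapositive, positive numbers exclude members at
the vertex. -/
theorem IsSystem.sum_nonpos_of_mem {M : Multiset CombArc} (hM : IsSystem n M) {c j : ℤ} {τ : Bool}
    (hmem : rad c τ ∈ M) (hj : n ∣ j - c) : (M.map (radInter n j τ)).sum ≤ 0 := by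
  have hc := hM.normalized _ hmem
  unfold Normalized at hc
  have hn0 : 0 < n := by omega
  have hcusp : cusp n = 10 * n := rfl
  rw [sum_radInter]
  have h1 : crossCount (M.bind (lifts n)) j (cusp n) = 0 := by
    refine cnt_eq_zero_iff.2 fun p hp => ?_
    obtain ⟨α, hα, hp'⟩ := Multiset.mem_bind.1 hp
    have h2 := lifts_bounds hn0 (hM.extended α hα) hp'
    have h3 := hM.compat _ hmem _ hα
    cases α with
    | chord i k =>
      obtain ⟨t, ht, rfl⟩ := mem_lifts_chord.1 hp'
      obtain ⟨s, hs⟩ := hj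
      have h4 := h3 (s - t)
      have e1 : (s - t) * n = n * s - t * n := by ring
      unfold Interleave
      simp only
      omega
    | rad i ρ =>
      obtain ⟨t, ht, rfl⟩ := mem_lifts_rad.1 hp'
      unfold Interleave
      simp only
      omega
  have h2 : cnt M (OtherTag τ) ≤ cnt M (AtVertex n j) := by
    refine cnt_mono ?_
    rintro _ hα ⟨c', ρ, rfl, hρ⟩
    refine ⟨c', ρ, rfl, ?_⟩
    rcases hM.compat _ hmem _ hα with h | h
    · exact absurd h.symm hρ
    · have : j - c' = (j - c) + (c - c') := by ring
      rw [this]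
      exact dvd_add hj h
  omega

end CombArc

namespace CombArc

open ChordSystem

variable {n : ℤ}

/-! #### Systems that are compatible with an arc to the puncture -/

/-- Replace the arc from `u` to the puncture with the tag opposite to `τ` by the loop around it. -/
def loopAt (n u : ℤ) (τ : Bool) : CombArc → CombArc
  | chord i k => chord i k
  | rad c ρ => if c = u ∧ ρ = !τ then chord u (u + n) else rad c ρ

/-- The arcs compatible with `rad u τ`. -/
inductive CompatRad (n u : ℤ) (τ : Bool) : CombArc → Prop
  | chord (c d : ℤ) : (0 ≤ c ∧ c < n) → 2 ≤ d - c → d - c < n →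
      (∀ t : ℤ, ¬ (c < u + t * n ∧ u + t * n < d)) → CompatRad n u τ (chord c d)
  | rad (c : ℤ) : (0 ≤ c ∧ c < n) → CompatRad n u τ (rad c τ)
  | opposite : CompatRad n u τ (CombArc.rad u !τ)

theorem IsSystem.compatRad (hn : 4 ≤ n) {M : Multiset CombArc} (hM : IsSystem n M) {u : ℤ}
    {τ : Bool} (hu : 0 ≤ u ∧ u < n) (h : (M.map (radInter n u τ)).sum ≤ 0) :
    ∀ α ∈ M, CompatRad n u τ α := by
  intro α hα
  have h1 := hM.compat_of_sum_le hn hu h α hα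
  have h2 := hM.valid α hα
  have h3 := hM.normalized α hα
  cases α with
  | chord c d => exact .chord c d h3 h2.1 h2.2 h1
  | rad c ρ =>
    rcases h1 with h1 | h1
    · subst h1; exact .rad c h3
    · obtain ⟨t, ht⟩ := h1
      have h4 : c = u := (eq_of_add_mul (t := t) (t' := 0) h3 hu
        (by rw [mul_comm] at ht; omega)).1
      subst h4
      by_cases hρ : ρ = τ
      · subst hρ; exact .rad c h3
      · rw [Bool.eq_not_of_ne hρ]; exact .opposite

section loopAt

variable {u : ℤ} {τ : Bool}

theorem loopAt_chord (c d : ℤ) : loopAt n u τ (chord c d) = chord c d := rfl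

theorem loopAt_rad (c : ℤ) : loopAt n u τ (rad c τ) = rad c τ := by
  simp [loopAt]

theorem loopAt_opposite : loopAt n u τ (rad u !τ) = chord u (u + n) := by
  simp [loopAt]

theorem extended_loopAt (hu : 0 ≤ u ∧ u < n) (hn : 4 ≤ n) {α : CombArc} (h : CompatRad n u τ α) :
    Extended n (loopAt n u τ α) := by
  cases h with
  | chord c d h1 h2 h3 h4 => exact ⟨h1, h2, h3.le⟩
  | rad c h => rw [loopAt_rad]; exact h
  | opposite => rw [loopAt_opposite]; exact ⟨hu, by omega, by omega⟩

/-- A chord compatible with `rad u τ` covers no translate of u, hence does not cross the loop; a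
τ-tagged arc compatible with the oppositely tagged arc at u starts at u. -/
theorem compat_loopAt (hu : 0 ≤ u ∧ u < n) (hn : 4 ≤ n) {α β : CombArc} (hα : CompatRad n u τ α)
    (hβ : CompatRad n u τ β) (h : Compat n α β) :
    Compat n (loopAt n u τ α) (loopAt n u τ β) := by
  have hn0 : 0 < n := by omega
  cases hα with
  | chord c d h1 h2 h3 h4 =>
    cases hβ with
    | chord c' d' h1' h2' h3' h4' => exact h
    | rad c' h' => rw [loopAt_rad]; exact h
    | opposite =>
      rw [loopAt_opposite, loopAt_chord]
      intro t ht
      have g1 := h4 t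
      have g2 := h4 (t + 1)
      have : (t + 1) * n = t * n + n := by ring
      unfold Interleave at ht
      omega
  | rad c h1 =>
    rw [loopAt_rad]
    cases hβ with
    | chord c' d' h1' h2' h3' h4' => exact h
    | rad c' h' => rw [loopAt_rad]; exact h
    | opposite =>
      rw [loopAt_opposite]
      rcases h with h | h
      · exact absurd h.symm (Bool.not_ne_self τ)
      · obtain ⟨s, hs⟩ := h
        have h4 : c = u := (eq_of_add_mul (t := 0) (t' := s) h1 hu
          (by rw [mul_comm] at hs; omega)).1
        subst h4
        intro t ht
        have g1 : 0 < t := mul_lt_cancel hn0 (by omega)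
        have := mul_add_le_mul hn0 g1
        omega
  | opposite =>
    rw [loopAt_opposite]
    cases hβ with
    | chord c d h1 h2 h3 h4 =>
      intro t ht
      have g1 := h4 (-t)
      have g2 := h4 (-t + 1)
      have : (-t + 1) * n = -(t * n) + n := by ring
      have : -t * n = -(t * n) := by ring
      unfold Interleave at ht
      omega
    | rad c h1 =>
      rw [loopAt_rad]
      rcases h with h | h
      · exact absurd h (Bool.not_ne_self τ)
      · obtain ⟨s, hs⟩ := h
        have h4 : c = u := (eq_of_add_mul (t := s) (t' := 0) h1 hu
          (by rw [mul_comm] at hs; omega)).1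
        subst h4
        intro t ht
        have g1 : 0 < t := mul_lt_cancel hn0 (by omega)
        have := mul_add_le_mul hn0 g1
        omega
    | opposite =>
      rw [loopAt_opposite]
      intro t ht
      unfold Interleave at ht
      rcases ht with ht | ht
      · have g1 : 0 < t := mul_lt_cancel hn0 (by omega)
        have := mul_add_le_mul hn0 g1
        omega
      · have g1 : t < 0 := mul_lt_cancel hn0 (by omega)
        have := mul_add_le_mul hn0 g1
        omega

/-- A chord that covers no translate of u meets neither the loop at u nor the arc that it replaces.
-/
theorem inter_loopAt_chord (hn : 4 ≤ n) {i k : ℤ} (hik : 2 ≤ k - i ∧ k - i < n)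
    (hk : k ≤ 2 * n) (huik : ∀ t : ℤ, ¬ (i < u + t * n ∧ u + t * n < k)) {α : CombArc}
    (h : CompatRad n u τ α) :
    inter (lifts n (loopAt n u τ α)) i k = inter (lifts n α) i k := by
  have hcusp : cusp n = 10 * n := rfl
  cases h with
  | chord c d h1 h2 h3 h4 => rfl
  | rad c h => rw [loopAt_rad]
  | opposite =>
    rw [loopAt_opposite]
    unfold inter
    have e1 : crossCount (lifts n (chord u (u + n))) i k = 0 := by
      refine cnt_eq_zero_iff.2 fun p hp h => ?_
      obtain ⟨t, ht, rfl⟩ := mem_lifts_chord.1 hp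
      have g1 := huik t
      have g2 := huik (t + 1)
      have : (t + 1) * n = t * n + n := by ring
      unfold Interleave at h
      simp only at h
      omega
    have e2 : mult (lifts n (chord u (u + n))) i k = 0 := by
      refine cnt_eq_zero_iff.2 fun p hp h => ?_
      obtain ⟨t, ht, rfl⟩ := mem_lifts_chord.1 hp
      simp only at h
      omega
    have e3 : crossCount (lifts n (rad u !τ)) i k = 0 := by
      refine cnt_eq_zero_iff.2 fun p hp h => ?_
      obtain ⟨t, ht, rfl⟩ := mem_lifts_rad.1 hp
      have g1 := huik t
      unfold Interleave at h
      simp only at h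
      omega
    have e4 : mult (lifts n (rad u !τ)) i k = 0 := by
      refine cnt_eq_zero_iff.2 fun p hp h => ?_
      obtain ⟨t, ht, rfl⟩ := mem_lifts_rad.1 hp
      simp only at h
      omega
    rw [e1, e2, e3, e4]

/-- The arc replaced contributes one for its tag, minus one if j is a translate of u; this is the
number of crossings of the loop with {j, cusp}. -/
theorem inter_loopAt_rad (hu : 0 ≤ u ∧ u < n) (hn : 4 ≤ n) {j : ℤ} (hj : -n ≤ j ∧ j ≤ 2 * n) {α : CombArc}
    (h : CompatRad n u τ α) :
    inter (lifts n (loopAt n u τ α)) j (cusp n) = radInter n j τ α := by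
  have hn0 : 0 < n := by omega
  unfold inter
  cases h with
  | chord c d h1 h2 h3 h4 =>
    rw [loopAt_chord, mult_chord_cusp hn0 ⟨h1, h2, h3.le⟩, sub_zero]; rfl
  | rad c h =>
    rw [loopAt_rad, mult_rad_cusp h hj, crossCount_rad_cusp, radInter, indic_neg (P := τ ≠ τ) (by simp)]
  | opposite =>
    rw [loopAt_opposite, mult_chord_cusp hn0 ⟨hu, by omega, by omega⟩,
      crossCount_loop_cusp hu hj, radInter, indic_pos (Bool.not_ne_self τ)]
    ring

/-- On the side of the triangulation, too, the loop stands for the arc at u with the other tag: a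
τ-tagged arc crosses it once unless it starts at u, and coincidence of the loops corresponds to
coincidence of the arcs. Chords covering no translate of u contribute zero to both. -/
theorem inter_loopAt_loop (hu : 0 ≤ u ∧ u < n) (hn : 4 ≤ n) {w : ℤ} (hw : w = u ∨ w = u - n) {α : CombArc}
    (h : CompatRad n u τ α) :
    inter (lifts n (loopAt n u τ α)) w (w + n) = radInter n u (!τ) α := by
  have hn0 : 0 < n := by omega
  have hcusp : cusp n = 10 * n := rfl
  have hwu : ∃ s : ℤ, (-3 ≤ s ∧ s ≤ 3) ∧ w = u + s * n := by
    rcases hw with rfl | rfl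
    · exact ⟨0, by omega, by ring⟩
    · exact ⟨-1, by omega, by ring⟩
  obtain ⟨s, hs, hws⟩ := hwu
  have hs1 : (s + 1) * n = s * n + n := by ring
  unfold inter
  cases h with
  | chord c d h1 h2 h3 h4 =>
    rw [loopAt_chord]
    have e1 : crossCount (lifts n (chord c d)) w (w + n) = 0 := by
      refine cnt_eq_zero_iff.2 fun p hp h => ?_
      obtain ⟨t, ht, rfl⟩ := mem_lifts_chord.1 hp
      have g1 := h4 (s - t)
      have g2 := h4 (s - t + 1)
      have : (s - t) * n = s * n - t * n := by ring
      have : (s - t + 1) * n = s * n - t * n + n := by ring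
      unfold Interleave at h
      simp only at h
      omega
    have e2 : mult (lifts n (chord c d)) w (w + n) = 0 := by
      refine cnt_eq_zero_iff.2 fun p hp h => ?_
      obtain ⟨t, ht, rfl⟩ := mem_lifts_chord.1 hp
      simp only at h
      omega
    have e3 : radInter n u (!τ) (chord c d) = 0 := by
      unfold radInter crossCount
      refine cnt_eq_zero_iff.2 fun p hp h => ?_
      obtain ⟨t, ht, rfl⟩ := mem_lifts_chord.1 hp
      have := window_bounds hn0 ht
      have g1 := h4 (-t)
      have : -t * n = -(t * n) := by ring
      unfold Interleave at h
      simp only at h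
      omega
    rw [e1, e2, e3]; rfl
  | rad c h =>
    rw [loopAt_rad]
    have e2 : mult (lifts n (rad c τ)) w (w + n) = 0 := by
      refine cnt_eq_zero_iff.2 fun p hp h => ?_
      obtain ⟨t, ht, rfl⟩ := mem_lifts_rad.1 hp
      simp only at h
      omega
    rw [e2, crossCount_rad_loop h (by omega), radInter,
      indic_pos (P := τ ≠ !τ) (Bool.not_ne_self τ).symm, sub_zero]
    congr 1
    refine indic_congr ?_
    rcases hw with rfl | rfl
    · rfl
    · rw [show u - n - c = (u - c) - n by ring]
      exact dvd_sub_self_right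
  | opposite =>
    rw [loopAt_opposite]
    have e1 : crossCount (lifts n (chord u (u + n))) w (w + n) = 0 := by
      refine cnt_eq_zero_iff.2 fun p hp h => ?_
      obtain ⟨t, ht, rfl⟩ := mem_lifts_chord.1 hp
      unfold Interleave at h
      simp only at h
      rcases h with ht | ht
      · have g1 : s < t := mul_lt_cancel hn0 (by omega)
        have := mul_add_le_mul hn0 g1
        omega
      · have g1 : t < s := mul_lt_cancel hn0 (by omega)
        have := mul_add_le_mul hn0 g1
        omega
    have e2 := mult_bind_chord (M := {chord u (u + n)}) (n := n) (c := u) (d := u + n) (t := s)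
      (by simp; exact ⟨hu, by omega, by omega⟩) ⟨hu, by omega, by omega⟩ hs
    rw [Multiset.singleton_bind, ← hws] at e2
    have e3 : u + n + s * n = w + n := by rw [hws]; ring
    rw [e3] at e2
    rw [e1, e2, radInter, indic_neg (P := (!τ) ≠ !τ) (by simp), sub_self, indic_pos (dvd_zero n)]
    simp [cnt, indic_pos]

/-- On arcs compatible with `rad u τ` the replacement loses nothing: the only chord of length n
comes from the oppositely tagged arc, and all remaining arcs to the puncture have tag τ. -/
theorem cnt_map_loopAt {M : Multiset CombArc} (hM : ∀ α ∈ M, CompatRad n u τ α) :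
    (∀ c d, d - c < n → cnt (M.map (loopAt n u τ)) (fun α => α = chord c d) =
      cnt M (fun α => α = chord c d)) ∧
    (cnt (M.map (loopAt n u τ)) (fun α => α = chord u (u + n)) =
      cnt M (fun α => α = rad u !τ)) ∧
    (∀ c, cnt (M.map (loopAt n u τ)) (fun α => ∃ ρ, α = rad c ρ) =
      cnt M (fun α => α = rad c τ)) := by
  refine ⟨fun c d hcd => ?_, ?_, fun c => ?_⟩ <;> rw [cnt_map] <;>
    refine cnt_congr fun α hα => ?_ <;> cases hM α hα with
    | chord c' d' h1 h2 h3 h4 => ?_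
    | rad c' h => ?_
    | opposite => ?_
  · rfl
  · rw [loopAt_rad]
  · rw [loopAt_opposite]
    simp only [chord.injEq, reduceCtorEq, iff_false]
    omega
  · rw [loopAt_chord]
    simp only [chord.injEq, reduceCtorEq, iff_false]
    omega
  · rw [loopAt_rad]; simp
  · rw [loopAt_opposite]; simp
  · rw [loopAt_chord]; simp
  · rw [loopAt_rad]; simp
  · rw [loopAt_opposite]; simp

end loopAt

theorem eq_of_cnt_eq {M N : Multiset CombArc} (h : ∀ α, α ∈ M ∨ α ∈ N →
    cnt M (fun β => β = α) = cnt N (fun β => β = α)) : M = N := by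
  classical
  ext α
  by_cases hα : α ∈ M ∨ α ∈ N
  · have := h α hα
    rw [cnt_eq_count, cnt_eq_count] at this
    exact_mod_cast this
  · rw [not_or] at hα
    rw [Multiset.count_eq_zero_of_notMem hα.1, Multiset.count_eq_zero_of_notMem hα.2]

/-- Two systems with the same intersection numbers with a triangulation are equal if one of the
arcs of the triangulation that end at the puncture meets none of them. -/
theorem IsSystem.eq_of_sum_le (hn : 4 ≤ n) {T : Set CombArc} (hT : IsTriangulation n T)
    {M N : Multiset CombArc} (hM : IsSystem n M) (hN : IsSystem n N) {u : ℤ} {τ : Bool}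
    (hu : 0 ≤ u ∧ u < n) (hTu : rad u τ ∈ T) (hle : (M.map (radInter n u τ)).sum ≤ 0)
    (hchord : ∀ i k, chord i k ∈ T → -n ≤ i → k ≤ 2 * n →
      inter (M.bind (lifts n)) i k = inter (N.bind (lifts n)) i k)
    (hrad : ∀ j τ, rad j τ ∈ T → -n ≤ j → j ≤ 2 * n →
      (M.map (radInter n j τ)).sum = (N.map (radInter n j τ)).sum) : M = N := by
  have hle' : (N.map (radInter n u τ)).sum ≤ 0 := by
    rw [← hrad u τ hTu (by omega) (by omega)]; exact hle
  have cM := hM.compatRad hn hu hle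
  have cN := hN.compatRad hn hu hle'
  -- After the replacement all arcs to the puncture carry the tag τ, so tags no longer contribute,
  -- and the intersection numbers with chords, with τ-tagged arcs and with the loop at u are those
  -- of the original system.
  have main : ∀ K : Multiset CombArc, IsSystem n K → (∀ α ∈ K, CompatRad n u τ α) →
      (∀ α ∈ K.map (loopAt n u τ), Extended n α) ∧
      IsNonCrossing ((K.map (loopAt n u τ)).bind (lifts n)) ∧
      (∀ i k, chord i k ∈ T → -n ≤ i → k ≤ 2 * n →
        inter ((K.map (loopAt n u τ)).bind (lifts n)) i k = inter (K.bind (lifts n)) i k) ∧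
      (∀ j, rad j τ ∈ T → -n ≤ j → j ≤ 2 * n →
        inter ((K.map (loopAt n u τ)).bind (lifts n)) j (cusp n) =
          (K.map (radInter n j τ)).sum) ∧
      (∀ w, w = u ∨ w = u - n → inter ((K.map (loopAt n u τ)).bind (lifts n)) w (w + n) =
          (K.map (radInter n u !τ)).sum) := by
    intro K hK cK
    have ext : ∀ α ∈ K.map (loopAt n u τ), Extended n α := by
      intro α hα
      obtain ⟨β, hβ, rfl⟩ := Multiset.mem_map.1 hα
      exact extended_loopAt hu hn (cK β hβ)
    refine ⟨ext, isNonCrossing_bind (by omega) ext ?_, ?_, ?_, ?_⟩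
    · intro α hα α' hα'
      obtain ⟨β, hβ, rfl⟩ := Multiset.mem_map.1 hα
      obtain ⟨β', hβ', rfl⟩ := Multiset.mem_map.1 hα'
      exact compat_loopAt hu hn (cK β hβ) (cK β' hβ') (hK.compat _ hβ _ hβ')
    · intro i k hik hi hk
      rw [inter_bind, inter_bind, Multiset.map_map]
      refine congrArg _ (Multiset.map_congr rfl fun α hα => ?_)
      exact inter_loopAt_chord hn (hT.valid _ hik) hk (hT.compat _ hik _ hTu) (cK α hα)
    · intro j _ hj hj'
      rw [inter_bind, Multiset.map_map]
      refine congrArg _ (Multiset.map_congr rfl fun α hα => ?_)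
      exact inter_loopAt_rad hu hn ⟨hj, hj'⟩ (cK α hα)
    · intro w hw
      rw [inter_bind, Multiset.map_map]
      refine congrArg _ (Multiset.map_congr rfl fun α hα => ?_)
      exact inter_loopAt_loop hu hn hw (cK α hα)
  obtain ⟨m1, m2, m3, m4, m5⟩ := main M hM cM
  obtain ⟨n1, n2, n3, n4, n5⟩ := main N hN cN
  obtain ⟨r1, r2⟩ := extended_determined hn hT hu hTu m1 n1 m2 n2
    (fun i k h hi hk => by rw [m3 i k h hi hk, n3 i k h hi hk, hchord i k h hi hk])
    (fun j h hj hj' => by rw [m4 j h hj hj', n4 j h hj hj', hrad j τ h hj hj'])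
    (fun h w hw => by rw [m5 w hw, n5 w hw, hrad u _ h (by omega) (by omega)])
  obtain ⟨a1, a2, a3⟩ := cnt_map_loopAt cM
  obtain ⟨b1, b2, b3⟩ := cnt_map_loopAt cN
  refine eq_of_cnt_eq fun α hα => ?_
  have hα' : CompatRad n u τ α := hα.elim (cM α) (cN α)
  cases hα' with
  | chord c d h1 h2 h3 h4 => rw [← a1 c d h3, ← b1 c d h3, r1]
  | rad c h => rw [← a3 c, ← b3 c, r2]
  | opposite => rw [← a2, ← b2, r1]

end CombArc

/-! ### The number of arcs at the puncture whose tag differs from that of the triangulation -/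

namespace CombArc

open ChordSystem

variable {n : ℤ}

/-- The arc ends at the puncture. -/
def IsRad (α : CombArc) : Prop := ∃ c ρ, α = rad c ρ

/-- The number of members of `L` that join one of the vertices `a, …, b - 1` to the puncture. -/
def mass (n : ℤ) (L : Multiset (ℤ × ℤ)) (a b : ℤ) : ℤ :=
  cnt L fun p => p.2 = cusp n ∧ a ≤ p.1 ∧ p.1 < b

/-- Multisets of compatible chords and arcs to the puncture all of which have the same tag, where
loops around the puncture are admitted as chords. -/
structure IsExtendedSystem (n : ℤ) (M : Multiset CombArc) : Prop where
  extended : ∀ α ∈ M, Extended n α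
  compat : ∀ α ∈ M, ∀ β ∈ M, Compat n α β
  tag : ∃ ρ, ∀ c ρ', rad c ρ' ∈ M → ρ' = ρ

section mass

variable {L : Multiset (ℤ × ℤ)}

theorem mass_add {a b c : ℤ} (hab : a ≤ b) (hbc : b ≤ c) :
    mass n L a c = mass n L a b + mass n L b c :=
  cnt_eq_add (fun p _ => by omega) (fun p _ => by omega)

theorem mass_nonneg (a b : ℤ) : 0 ≤ mass n L a b := cnt_nonneg

theorem mass_self (a : ℤ) : mass n L a a = 0 := cnt_eq_zero_iff.2 fun p _ => by omega

theorem mass_eq_mult_add {a b : ℤ} (hab : a < b) : mass n L a b = mult L a (cusp n)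
    + cnt L (fun p => p.2 = cusp n ∧ a < p.1 ∧ p.1 < b) :=
  cnt_eq_add (fun p _ => by omega) (fun p _ => by omega)

theorem mult_le_mass {a b : ℤ} (hab : a < b) : mult L a (cusp n) ≤ mass n L a b := by
  rw [mass_eq_mult_add hab]
  have : 0 ≤ cnt L (fun p => p.2 = cusp n ∧ a < p.1 ∧ p.1 < b) := cnt_nonneg
  omega

/-- Every arc to the puncture has exactly one lift that starts in a given half-open period. -/
theorem mass_period {M : Multiset CombArc} (hM : ∀ α ∈ M, Extended n α) (hn : 0 < n) {a : ℤ}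
    (ha : -n ≤ a ∧ a ≤ n) : mass n (M.bind (lifts n)) a (a + n) = cnt M IsRad := by
  have hcusp : cusp n = 10 * n := rfl
  unfold mass
  rw [cnt_bind, cnt]
  refine congrArg _ (Multiset.map_congr rfl fun α hα => ?_)
  have hα' := hM α hα
  cases α with
  | chord c d =>
    rw [indic_neg (by rintro ⟨_, _, h⟩; cases h), cnt_eq_zero_iff]
    intro p hp h
    have h1 := lifts_bounds hn hα' hp
    obtain ⟨t, ht, rfl⟩ := mem_lifts_chord.1 hp
    have := window_bounds hn ht
    obtain ⟨h2, h3⟩ := hα'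
    simp only at *
    omega
  | rad c ρ =>
    rw [indic_pos ⟨c, ρ, rfl⟩, cnt_lifts_rad]
    obtain ⟨q, r, h1, h2, h3, -⟩ := exists_quotient hn a c
    unfold Extended at hα'
    have hq : -3 ≤ -q ∧ -q ≤ 3 := by
      constructor
      · by_contra h; have := mul_add_le_mul hn (show 3 < q by omega); omega
      · by_contra h; have := mul_add_le_mul hn (show q < -3 by omega); omega
    have e1 : -q * n = -(q * n) := by ring
    rw [sum_window_eq_single hq]
    · exact indic_pos ⟨rfl, by simp only; omega, by simp only; omega⟩
    · intro s _ hs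
      refine indic_neg fun h => hs ?_
      simp only at h
      rcases lt_trichotomy s (-q) with h' | h' | h'
      · have := mul_add_le_mul hn h'; omega
      · exact h'
      · have := mul_add_le_mul hn h'; omega

end mass

theorem mult_cusp_eq {M : Multiset CombArc} (hM : ∀ α ∈ M, Extended n α) (hn : 0 < n) {j : ℤ}
    (hj : -n ≤ j ∧ j ≤ 2 * n) :
    mult (M.bind (lifts n)) j (cusp n) = cnt M (AtVertex n j) := by
  rw [mult, cnt_bind, cnt]
  refine congrArg _ (Multiset.map_congr rfl fun α hα => ?_)
  have hα' := hM α hα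
  cases α with
  | chord c d =>
    rw [indic_neg (by rintro ⟨_, _, h, -⟩; cases h)]
    exact mult_chord_cusp hn hα'
  | rad c ρ =>
    refine (mult_rad_cusp hα' hj ρ).trans (indic_congr ⟨fun h => ⟨c, ρ, rfl, h⟩, ?_⟩)
    rintro ⟨_, _, h, h'⟩; cases h; exact h'

theorem sum_radInter_eq {M : Multiset CombArc} (hM : ∀ α ∈ M, Extended n α) (hn : 0 < n) {j : ℤ}
    (hj : -n ≤ j ∧ j ≤ 2 * n) (τ : Bool) :
    (M.map (radInter n j τ)).sum = inter (M.bind (lifts n)) j (cusp n) + cnt M (OtherTag τ) := by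
  rw [sum_radInter, inter, mult_cusp_eq hM hn hj]; ring

/-- A system with a single tag at the puncture consists, there, either of τ-tagged arcs only or of
differently tagged arcs only. -/
theorem IsExtendedSystem.otherTag {M : Multiset CombArc} (hM : IsExtendedSystem n M) (τ : Bool) :
    (cnt M (OtherTag τ) = 0 ∧ cnt M (OtherTag !τ) = cnt M IsRad) ∨
    (cnt M (OtherTag τ) = cnt M IsRad ∧ cnt M (OtherTag !τ) = 0) := by
  obtain ⟨ρ, hρ⟩ := hM.tag
  by_cases h : ρ = τ
  · left
    subst h
    refine ⟨cnt_eq_zero_iff.2 ?_, cnt_congr fun α hα => ⟨?_, ?_⟩⟩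
    · rintro _ hα ⟨c, ρ', rfl, h'⟩; exact h' (hρ _ _ hα)
    · rintro ⟨c, ρ', rfl, -⟩; exact ⟨c, ρ', rfl⟩
    · rintro ⟨c, ρ', rfl⟩
      refine ⟨c, ρ', rfl, ?_⟩
      rw [hρ _ _ hα]; exact (Bool.not_ne_self ρ).symm
  · right
    have h' := Bool.eq_not_of_ne h
    subst h'
    refine ⟨cnt_congr fun α hα => ⟨?_, ?_⟩, cnt_eq_zero_iff.2 ?_⟩
    · rintro ⟨c, ρ', rfl, -⟩; exact ⟨c, ρ', rfl⟩
    · rintro ⟨c, ρ', rfl⟩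
      refine ⟨c, ρ', rfl, ?_⟩
      rw [hρ _ _ hα]; exact h
    · rintro _ hα ⟨c, ρ', rfl, h'⟩; exact h' (hρ _ _ hα)

/-! #### Sectors between consecutive arcs to the puncture -/

section sectors

variable {T : Set CombArc} (hT : IsTriangulation n T) {τ : Bool}
include hT

/-- If e were the only start modulo n, the arc at e with the other tag would be compatible with T
and would belong to it, against the hypothesis on tags. So there are at least two sectors in a
period; the side of a sector opposite to the puncture crosses nothing in T, hence is an arc of T or
a side of the polygon. -/
theorem IsTriangulation.exists_next (hn : 4 ≤ n) (hτ : ∀ c ρ, rad c ρ ∈ T → ρ = τ) {e : ℤ}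
    (he : rad e τ ∈ T) : ∃ f, e < f ∧ f < e + n ∧ rad f τ ∈ T ∧
      (∀ j, e < j → j < f → rad j τ ∉ T) ∧ (f = e + 1 ∨ chord e f ∈ T) := by
  have hn0 : 0 < n := by omega
  have hcov : ∀ c d, chord c d ∈ T → ∀ j, rad j τ ∈ T → ¬ (c < j ∧ j < d) := by
    intro c d h1 j h2
    simpa using hT.compat _ h1 _ h2 0
  have hex : ∃ f, e < f ∧ f < e + n ∧ rad f τ ∈ T := by
    by_contra hno
    push Not at hno
    have h1 : rad e (!τ) ∈ T := by
      refine hT.maximal _ trivial ?_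
      rintro (⟨c, d⟩ | ⟨c, ρ⟩) hβ
      · exact hT.compat _ he _ hβ
      · right
        have h1 := hτ _ _ hβ
        subst h1
        obtain ⟨q, r, h1, h2, h3, h4⟩ := exists_quotient hn0 e c
        have h5 := hT.shift _ hβ (-q)
        have e1 : c + -q * n = e + r := by rw [h1]; ring
        rw [CombArc.shift, e1] at h5
        rw [dvd_sub_comm, h4]
        by_contra hr
        exact hno _ (by omega) (by omega) h5
    exact Bool.not_ne_self τ (hτ _ _ h1)
  obtain ⟨f, ⟨h1, h2, h3⟩, hmin⟩ := Int.exists_least_of_bdd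
    (P := fun f => e < f ∧ f < e + n ∧ rad f τ ∈ T) ⟨e, fun z hz => hz.1.le⟩ hex
  have hno : ∀ j, e < j → j < f → rad j τ ∉ T := fun j hj hjf h => by
    have := hmin j ⟨hj, by omega, h⟩; omega
  refine ⟨f, h1, h2, h3, hno, ?_⟩
  by_cases hf : f = e + 1
  · exact Or.inl hf
  refine Or.inr (hT.maximal _ ⟨by omega, by omega⟩ ?_)
  rintro (⟨c, d⟩ | ⟨c, ρ⟩) hβ
  · intro t ht
    have h4 := hT.shift _ hβ t
    have h5 := hcov _ _ h4 _ he
    have h6 := hcov _ _ h4 _ h3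
    unfold Interleave at ht
    omega
  · intro t ht
    have h4 := hT.shift _ hβ t
    rw [hτ _ _ hβ] at h4
    exact hno _ ht.1 ht.2 h4

theorem IsTriangulation.exists_previous (hn : 0 < n) {u : ℤ} (hu : rad u τ ∈ T) (c : ℤ) :
    ∃ e, e ≤ c ∧ c - n < e ∧ rad e τ ∈ T ∧ ∀ j, e < j → j ≤ c → rad j τ ∉ T := by
  obtain ⟨q, r, h1, h2, h3, -⟩ := exists_quotient hn u c
  have h4 := hT.shift _ hu q
  obtain ⟨e, ⟨h5, h6⟩, hmax⟩ := Int.exists_greatest_of_bdd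
    (P := fun e => e ≤ c ∧ rad e τ ∈ T) ⟨c, fun z hz => hz.1⟩ ⟨u + q * n, by omega, h4⟩
  have h7 := hmax (u + q * n) ⟨by omega, h4⟩
  exact ⟨e, h5, by omega, h6, fun j hj hjc h => by have := hmax j ⟨hjc, h⟩; omega⟩

end sectors

/-- The number of intersections with a side of a triangle at the puncture is at most the number of
intersections with the other sides plus the number of arcs in between that end at the puncture. -/
theorem crossCount_le_sector {L : Multiset (ℤ × ℤ)} {e f : ℤ} (hef : e < f) (hf : f < cusp n)
    (hL : ∀ p ∈ L, p.1 < p.2 ∧ p.2 ≤ cusp n) :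
    crossCount L e f ≤ crossCount L e (cusp n) + crossCount L f (cusp n)
      + cnt L (fun p => p.2 = cusp n ∧ e < p.1 ∧ p.1 < f) := by
  have h1 : crossCount L e f ≤ cnt L (fun p => Interleave e (cusp n) p.1 p.2 ∨
      Interleave f (cusp n) p.1 p.2) + cnt L (fun p => p.2 = cusp n ∧ e < p.1 ∧ p.1 < f) :=
    cnt_le_add fun p hp h => by
      have := hL p hp
      unfold Interleave at *
      omega
  have h2 : cnt L (fun p => Interleave e (cusp n) p.1 p.2 ∨ Interleave f (cusp n) p.1 p.2) ≤
      crossCount L e (cusp n) + crossCount L f (cusp n) := cnt_le_add fun p _ h => h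
  omega

/-- The opposite inequality holds if some vertex in between is not covered. -/
theorem sector_le_crossCount {L : Multiset (ℤ × ℤ)} {e f c : ℤ} (hec : e < c) (hcf : c < f)
    (hf : f < cusp n) (hL : ∀ p ∈ L, p.1 < p.2 ∧ p.2 ≤ cusp n)
    (hc : ∀ p ∈ L, p.2 ≠ cusp n → ¬ (p.1 < c ∧ c < p.2)) :
    crossCount L e (cusp n) + crossCount L f (cusp n)
      + cnt L (fun p => p.2 = cusp n ∧ e < p.1 ∧ p.1 < f) ≤ crossCount L e f := by
  -- A member crossing both sides at the puncture would pass over c, so the two counts are of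
  -- disjoint sets. For the same reason each of these members turns back inside the sector and
  -- crosses {e, f}.
  have h2 : crossCount L e (cusp n) + crossCount L f (cusp n) =
      cnt L (fun p => Interleave e (cusp n) p.1 p.2 ∨ Interleave f (cusp n) p.1 p.2) :=
    (cnt_eq_add (fun p _ => Iff.rfl) fun p hp => by
      have := hL p hp
      have := hc p hp
      unfold Interleave at *
      omega).symm
  rw [h2]
  refine cnt_add_le (fun p hp h => ?_) (fun p hp h => ?_)
  · have := hL p hp
    have := hc p hp
    unfold Interleave at *
    omega
  · unfold Interleave at *
    omega

/-- In a triangulation all of whose arcs at the puncture have the tag `τ`, and all of which meet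
the given systems, the number of arcs with the other tag is determined by the intersection
numbers: one of two inequalities. -/
theorem otherTag_le (hn : 4 ≤ n) {T : Set CombArc} (hT : IsTriangulation n T) {τ : Bool} {u : ℤ}
    (hu : rad u τ ∈ T) (hτ : ∀ c ρ, rad c ρ ∈ T → ρ = τ) {M N : Multiset CombArc}
    (hM : IsExtendedSystem n M) (hN : IsExtendedSystem n N)
    (hchord : ∀ i k, chord i k ∈ T → -n ≤ i → k ≤ 2 * n →
      inter (M.bind (lifts n)) i k = inter (N.bind (lifts n)) i k)
    (hrad : ∀ j, rad j τ ∈ T → -n ≤ j → j ≤ 2 * n →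
      inter (M.bind (lifts n)) j (cusp n) + cnt M (OtherTag τ) =
        inter (N.bind (lifts n)) j (cusp n) + cnt N (OtherTag τ))
    (hpos : ∀ j, rad j τ ∈ T → -n ≤ j → j ≤ 2 * n →
      0 < inter (N.bind (lifts n)) j (cusp n) + cnt N (OtherTag τ)) :
    cnt M (OtherTag τ) ≤ cnt N (OtherTag τ) := by
  have hn0 : 0 < n := by omega
  have hcusp : cusp n = 10 * n := rfl
  -- Let s > s' be the two numbers. At every arc of T to the puncture, the crossings minus the
  -- multiplicity for M are then smaller by s - s' than for N. A sector has two such sides, so in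
  -- suitable sectors the arcs of M at the puncture must exceed those of N by 2(s - s'). There are
  -- too few of them around the puncture for that.
  by_contra hlt
  rw [not_le] at hlt
  have hL := isNonCrossing_bind hn0 hM.extended hM.compat
  have hK := isNonCrossing_bind hn0 hN.extended hN.compat
  have bound : ∀ K : Multiset CombArc, (∀ α ∈ K, Extended n α) → ∀ p ∈ K.bind (lifts n),
      p.1 < p.2 ∧ p.2 ≤ cusp n := by
    intro K hK p hp
    obtain ⟨α, hα, hp'⟩ := Multiset.mem_bind.1 hp
    have := lifts_bounds hn0 (hK α hα) hp'
    omega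
  have bL := bound M hM.extended
  have bK := bound N hN.extended
  have perM := fun a ha => mass_period (a := a) hM.extended hn0 ha
  have perN := fun a ha => mass_period (a := a) hN.extended hn0 ha
  have sM := hM.otherTag τ
  have sN := hN.otherTag τ
  have hsN0 : 0 ≤ cnt N (OtherTag τ) := cnt_nonneg
  set L := M.bind (lifts n) with hLdef
  set K := N.bind (lifts n) with hKdef
  set s := cnt M (OtherTag τ) with hs
  set s' := cnt N (OtherTag τ) with hs'
  have hSM : cnt M IsRad = s := by omega
  -- the basic comparison in a sector with a vertex not covered by `K`
  have sector : ∀ e f c, rad e τ ∈ T → rad f τ ∈ T → -n ≤ e → f ≤ 2 * n → e < c → c < f →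
      (f = e + 1 ∨ chord e f ∈ T) → (∀ p ∈ K, p.2 ≠ cusp n → ¬ (p.1 < c ∧ c < p.2)) →
      (mass n K e f + mult K f (cusp n)) - 2 * s' ≤ (mass n L e f + mult L f (cusp n)) - 2 * s := by
    intro e f c he hf hen hfn hec hcf hside hc
    have h1 := crossCount_le_sector (n := n) (hec.trans hcf) (by omega) bL
    have h2 := sector_le_crossCount (n := n) hec hcf (by omega) bK hc
    have h3 : crossCount L e f = crossCount K e f := by
      rcases hside with h | h
      · omega
      · exact (crossCount_mult_congr hL hK (hchord e f h hen hfn)).1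
    have h4 := hrad e he hen (by omega)
    have h5 := hrad f hf (by omega) hfn
    rw [mass_eq_mult_add (hec.trans hcf), mass_eq_mult_add (hec.trans hcf)]
    unfold inter at h4 h5
    omega
  by_cases hs'0 : s' = 0
  · -- no arc of `N` has the other tag
    have hxu : ∃ p ∈ K, p.1 < p.2 := by
      obtain ⟨q, r, h1, h2, h3, -⟩ := exists_quotient hn0 0 u
      have h4 := hT.shift _ hu (-q)
      have e1 : u + -q * n = r := by rw [h1]; ring
      rw [CombArc.shift, e1] at h4
      have h5 := hpos r h4 (by omega) (by omega)
      have h6 : 0 ≤ mult K r (cusp n) := cnt_nonneg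
      have h7 : 0 < crossCount K r (cusp n) := by unfold inter at h5; omega
      obtain ⟨p, hp, -⟩ := cnt_pos_iff.1 h7
      exact ⟨p, hp, (bK p hp).1⟩
    -- The start of an arc of N to the puncture is covered by no chord; if there is no such arc,
    -- neither is the left end of a longest chord.
    have huncovered : ∃ c, (0 ≤ c ∧ c < n) ∧
        ∀ p ∈ K, p.2 ≠ cusp n → ¬ (p.1 < c ∧ c < p.2) := by
      by_cases hr : ∃ c ρ, rad c ρ ∈ N
      · obtain ⟨c, ρ, h⟩ := hr
        refine ⟨c, hN.extended _ h, fun p hp hne hpc => ?_⟩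
        have h1 := hK.not_cross p hp (c, cusp n) (Multiset.mem_bind.2
          ⟨_, h, mem_lifts_rad.2 ⟨0, by omega, by simp⟩⟩)
        have := bK p hp
        unfold Interleave at h1
        simp only at h1
        omega
      · push Not at hr
        have hchords : ∃ c d, chord c d ∈ N := by
          obtain ⟨p, hp, -⟩ := hxu
          obtain ⟨α, hα, -⟩ := Multiset.mem_bind.1 hp
          cases α with
          | chord c d => exact ⟨c, d, hα⟩
          | rad c ρ => exact absurd hα (hr c ρ)
        obtain ⟨m, ⟨c, d, hcd, rfl⟩, hmax⟩ := Int.exists_greatest_of_bdd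
          (P := fun m => ∃ c d, chord c d ∈ N ∧ m = d - c)
          ⟨n, by rintro _ ⟨c, d, h, rfl⟩; exact (hN.extended _ h).2.2⟩
          (by obtain ⟨c, d, h⟩ := hchords; exact ⟨_, c, d, h, rfl⟩)
        refine ⟨c, (hN.extended _ hcd).1, fun p hp hne hpc => ?_⟩
        have h1 := hK.not_cross p hp (c, d) (Multiset.mem_bind.2
          ⟨_, hcd, mem_lifts_chord.2 ⟨0, by omega, by simp⟩⟩)
        obtain ⟨α, hα, hp'⟩ := Multiset.mem_bind.1 hp
        cases α with
        | chord i k =>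
          have h2 := hmax _ ⟨i, k, hα, rfl⟩
          have h3 := (hN.extended _ hcd).2
          obtain ⟨t, ht, rfl⟩ := mem_lifts_chord.1 hp'
          unfold Interleave at h1
          simp only at h1 hpc
          omega
        | rad i ρ => exact hr i ρ hα
    obtain ⟨c, hc, hcov⟩ := huncovered
    -- Positivity with s' = 0 means that the starts of the arcs of T to the puncture are covered by
    -- chords of N; so c lies strictly inside a sector.
    have hcT : rad c τ ∉ T := fun h => by
      have h5 := hpos c h (by omega) (by omega)
      have h6 : 0 ≤ mult K c (cusp n) := cnt_nonneg
      have h7 : 0 < crossCount K c (cusp n) := by unfold inter at h5; omega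
      obtain ⟨p, hp, hpc⟩ := cnt_pos_iff.1 h7
      have := hcov p hp
      have := bK p hp
      unfold Interleave at hpc
      omega
    obtain ⟨e, h1, h2, h3, h4⟩ := hT.exists_previous hn0 hu c
    obtain ⟨f, g1, g2, g3, g4, g5⟩ := hT.exists_next hn hτ h3
    have hec : e ≠ c := fun h => hcT (h ▸ h3)
    have hcf : c < f := by
      by_contra hcf
      exact h4 f g1 (by omega) g3
    -- This bounds 2s by the number of arcs of M to the puncture that start in [e, f], hence by
    -- their total number s, because f < e + n. But s is positive.
    have h5 := sector e f c h3 g3 (by omega) (by omega) (by omega) hcf g5 hcov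
    have h6 := perM e (by omega)
    rw [mass_add g1.le g2.le] at h6
    have h7 := mult_le_mass (n := n) (L := L) (show f < e + n by omega)
    have h8 := mass_nonneg (n := n) (L := K) e f
    have h9 : 0 ≤ mult K f (cusp n) := cnt_nonneg
    omega
  · -- all arcs of `N` at the puncture have the other tag
    have hSN : cnt N IsRad = s' := by omega
    have dL := fun j => hL.mult_eq_zero_or j (cusp n)
    have dK := fun j => hK.mult_eq_zero_or j (cusp n)
    have mL : ∀ j, 0 ≤ mult L j (cusp n) := fun j => cnt_nonneg
    have mK : ∀ j, 0 ≤ mult K j (cusp n) := fun j => cnt_nonneg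
    have xL : ∀ j, 0 ≤ crossCount L j (cusp n) := fun j => cnt_nonneg
    have xK : ∀ j, 0 ≤ crossCount K j (cusp n) := fun j => cnt_nonneg
    have closed : ∀ e f, rad e τ ∈ T → rad f τ ∈ T → -n ≤ e → f ≤ 2 * n → e < f →
        (f = e + 1 ∨ chord e f ∈ T) →
        0 < cnt K (fun p => p.2 = cusp n ∧ e < p.1 ∧ p.1 < f) →
        mass n K e f + mult K f (cusp n) + 2 * (s - s') ≤ mass n L e f + mult L f (cusp n) := by
      intro e f he hf hen hfn hef hside hV
      obtain ⟨p, hp, hp2, hp3, hp4⟩ := cnt_pos_iff.1 hV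
      have := sector e f p.1 he hf hen hfn hp3 hp4 hside fun q hq hne hqc => by
        have h1 := hK.not_cross q hq p hp
        have := bK q hq
        unfold Interleave at h1
        omega
      omega
    -- If the arcs of N all start at e, no chord crosses there, and the multiplicity of M at e is
    -- larger by at least s - s'. If one starts strictly inside, the closed sector gains 2(s - s'),
    -- and discarding the arcs of M at f costs at most the multiplicity of N there plus s - s'.
    have half : ∀ e f, rad e τ ∈ T → rad f τ ∈ T → -n ≤ e → f ≤ 2 * n → e < f →
        (f = e + 1 ∨ chord e f ∈ T) →
        mass n K e f = 0 ∨ mass n K e f + (s - s') ≤ mass n L e f := by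
      intro e f he hf hen hfn hef hside
      have h1 := mass_eq_mult_add (n := n) (L := K) hef
      have h2 : 0 ≤ cnt K (fun p => p.2 = cusp n ∧ e < p.1 ∧ p.1 < f) := cnt_nonneg
      rcases h2.eq_or_lt with h2 | h2
      · have h3 := hrad e he hen (by omega)
        have h4 := mult_le_mass (n := n) (L := L) hef
        have := dK e
        have := xL e
        unfold inter at h3
        omega
      · have h3 := closed e f he hf hen hfn hef hside h2
        have h4 := hrad f hf (by omega) hfn
        have := dL f
        have := mK f
        have := xK f
        unfold inter at h4
        omega
    obtain ⟨α, hα, c, ρ, rfl⟩ := cnt_pos_iff.1 (show 0 < cnt N IsRad by omega)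
    have hc : 0 ≤ c ∧ c < n := hN.extended _ hα
    have hcK : (c, cusp n) ∈ K := Multiset.mem_bind.2
      ⟨_, hα, mem_lifts_rad.2 ⟨0, by omega, by simp⟩⟩
    obtain ⟨e, h1, h2, h3, h4⟩ := hT.exists_previous hn0 hu c
    obtain ⟨f, g1, g2, g3, g4, g5⟩ := hT.exists_next hn hτ h3
    have hcf : c < f := by
      by_contra hcf
      exact h4 f g1 (by omega) g3
    -- The inequality for single sectors is added up over the sectors from f to e + n, where m only
    -- bounds the induction. A stretch with no arc of N gains nothing, any other stretch gains at
    -- least s - s'.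
    have chain : ∀ m : ℕ, ∀ g, g - f < m → f ≤ g → g ≤ e + n → rad g τ ∈ T →
        mass n K f g = 0 ∨ mass n K f g + (s - s') ≤ mass n L f g := by
      intro m
      induction m with
      | zero => intro g; omega
      | succ m ih =>
        intro g hgm hfg hge hg
        rcases hfg.eq_or_lt with rfl | hfg
        · exact Or.inl (mass_self _)
        obtain ⟨a, a1, a2, a3, a4⟩ := hT.exists_previous hn0 hu (g - 1)
        obtain ⟨b, b1, b2, b3, b4, b5⟩ := hT.exists_next hn hτ a3
        have hfa : f ≤ a := by
          by_contra h
          exact a4 f (by omega) (by omega) g3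
        have hbg : b = g := by
          rcases lt_trichotomy b g with h | h | h
          · exact absurd b3 (a4 b b1 (by omega))
          · exact h
          · exact absurd hg (b4 g (by omega) h)
        subst hbg
        have i1 := ih a (by omega) hfa (by omega) a3
        have i2 := half a b a3 b3 (by omega) (by omega) b1 b5
        rw [mass_add hfa b1.le, mass_add hfa b1.le]
        have := mass_nonneg (n := n) (L := L) f a
        have := mass_nonneg (n := n) (L := L) a b
        omega
    have hen : rad (e + n) τ ∈ T := by simpa [CombArc.shift] using hT.shift _ h3 1
    have c1 := chain (e + n - f + 1).toNat (e + n) (by omega) g2.le le_rfl hen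
    have c2 := half e f h3 g3 (by omega) (by omega) g1 g5
    have c3 : 0 < mass n K e f := cnt_pos_iff.2 ⟨_, hcK, rfl, h1, hcf⟩
    have p1 := perM e (by omega)
    have p2 := perN e (by omega)
    rw [mass_add g1.le g2.le] at p1 p2
    have c4 := mult_le_mass (n := n) (L := L) g2
    have c5 := mass_eq_mult_add (n := n) (L := K) g1
    have c6 : 0 ≤ cnt K (fun p => p.2 = cusp n ∧ e < p.1 ∧ p.1 < f) := cnt_nonneg
    -- If the arcs of N in [e, f) all start at e, positivity at e shows that others exist, so both
    -- stretches gain s - s'. Otherwise either both stretches gain, or all arcs of N lie in the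
    -- first sector, which with its end f gains 2(s - s'). Over a full period this gives s' + 2(s -
    -- s') ≤ s, which is absurd.
    rcases c6.eq_or_lt with c6 | c6
    · have c7 := hpos e h3 (by omega) (by omega)
      have := dK e
      unfold inter at c7
      omega
    · have c7 := closed e f h3 g3 (by omega) (by omega) g1 g5 c6
      have := mK f
      omega

end CombArc

/-! ### Systems met by all arcs of the triangulation at the puncture, and the combinatorial theorem
-/

namespace CombArc

open ChordSystem

variable {n : ℤ}

theorem Compat.symm {α β : CombArc} (h : Compat n α β) : Compat n β α := by
  cases α with
  | chord i k =>
    cases β with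
    | chord c d =>
      intro t ht
      refine h (-t) ?_
      unfold Interleave at *
      simp only [neg_mul]
      omega
    | rad c ρ => exact h
  | rad j τ =>
    cases β with
    | chord c d => exact h
    | rad c ρ => exact h.imp Eq.symm fun h => dvd_sub_comm.1 h

/-- A loop around the puncture is replaced by the two tagged arcs that it encloses. -/
def unfoldLoop (n : ℤ) : CombArc → Multiset CombArc
  | chord i k => if k - i = n then {rad i true, rad i false} else {chord i k}
  | rad j τ => {rad j τ}

theorem unfoldLoop_of_valid {α : CombArc} (h : Valid n α) : unfoldLoop n α = {α} := by
  cases α with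
  | chord i k => exact if_neg h.2.ne
  | rad j τ => rfl

theorem unfoldLoop_loop (c : ℤ) : unfoldLoop n (chord c (c + n)) = {rad c true, rad c false} :=
  if_pos (by ring)

theorem rad_mem_unfoldLoop (c : ℤ) (τ : Bool) : rad c τ ∈ unfoldLoop n (chord c (c + n)) := by
  rw [unfoldLoop_loop]
  cases τ <;> simp

/-- If both tags occur, compatibility forces all arcs to the puncture to start at one vertex.
Removing one pair with opposite tags at a time and recording a loop for each pair leaves a single
tag; the loops cross nothing, because no chord covers that vertex. -/
theorem IsSystem.exists_unfoldLoop (hn : 4 ≤ n) {M : Multiset CombArc} (hM : IsSystem n M) :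
    ∃ K, M = K.bind (unfoldLoop n) ∧ IsExtendedSystem n K := by
  classical
  induction hm : M.card using Nat.strong_induction_on generalizing M with
  | _ m ih =>
    by_cases h : ∃ a b, rad a true ∈ M ∧ rad b false ∈ M
    · obtain ⟨a, b, ha, hb⟩ := h
      have hab : a = b := by
        have h1 := hM.compat _ ha _ hb
        have h2 : 0 ≤ a ∧ a < n := hM.normalized _ ha
        have h3 : 0 ≤ b ∧ b < n := hM.normalized _ hb
        rcases h1 with h1 | ⟨t, h1⟩
        · cases h1
        · exact (eq_of_add_mul (t := 0) (t' := t) h2 h3 (by rw [mul_comm t]; omega)).1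
      subst hab
      have hb' : rad a false ∈ M.erase (rad a true) := (Multiset.mem_erase_of_ne (by simp)).2 hb
      obtain ⟨M', hM'⟩ : ∃ M', M = rad a true ::ₘ rad a false ::ₘ M' :=
        ⟨_, by rw [Multiset.cons_erase hb', Multiset.cons_erase ha]⟩
      have hsub : ∀ α ∈ M', α ∈ M := fun α hα => by rw [hM']; simp [hα]
      have hM'S : IsSystem n M' := ⟨fun α hα => hM.valid α (hsub α hα),
        fun α hα => hM.normalized α (hsub α hα),
        fun α hα β hβ => hM.compat α (hsub α hα) β (hsub β hβ)⟩
      obtain ⟨K, hK, hKS⟩ := ih _ (by rw [← hm, hM']; simp) hM'S rfl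
      have hself : ∀ τ, rad a τ ∈ M := by rintro (_ | _) <;> assumption
      have ha0 : 0 ≤ a ∧ a < n := hM.normalized _ ha
      have new : ∀ β ∈ K, Compat n (chord a (a + n)) β := by
        intro β hβ
        have hmem : ∀ γ ∈ unfoldLoop n β, γ ∈ M := fun γ hγ => hsub γ (by
          rw [hK]; exact Multiset.mem_bind.2 ⟨β, hβ, hγ⟩)
        cases β with
        | chord c d =>
          intro t ht
          unfold Interleave at ht
          by_cases hcd : d - c = n
          · have h1 := hM.compat _ (hself true) _ (hmem (rad c false) (by
              rw [show d = c + n by omega]; exact rad_mem_unfoldLoop c false))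
            rcases h1 with h1 | ⟨s, hs⟩
            · cases h1
            · have hs' : a = c + s * n := by rw [mul_comm s]; omega
              rcases ht with ht | ht
              · have g1 : s < t := mul_lt_cancel (n := n) (by omega) (by omega)
                have := mul_add_le_mul (n := n) (by omega) g1
                omega
              · have g1 : t < s := mul_lt_cancel (n := n) (by omega) (by omega)
                have := mul_add_le_mul (n := n) (by omega) g1
                omega
          · have h1 := hM.compat _ (hself true) _ (hmem (chord c d) (by
              rw [unfoldLoop, if_neg hcd]; simp))
            have h2 := h1 (-t)
            have h3 := h1 (1 - t)
            have e1 : -t * n = -(t * n) := by ring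
            have e2 : (1 - t) * n = n - t * n := by ring
            omega
        | rad c ρ =>
          intro t ht
          have h1 := hM.compat _ (hself !ρ) _ (hmem (rad c ρ) (by simp [unfoldLoop]))
          rcases h1 with h1 | ⟨s, hs⟩
          · exact Bool.not_ne_self ρ h1
          · have hs' : a = c + s * n := by rw [mul_comm s]; omega
            have g1 : s < t := mul_lt_cancel (n := n) (by omega) (by omega)
            have := mul_add_le_mul (n := n) (by omega) g1
            omega
      refine ⟨chord a (a + n) ::ₘ K, ?_, ?_, ?_, ?_⟩
      · rw [Multiset.cons_bind, unfoldLoop_loop, ← hK, hM']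
        simp [Multiset.insert_eq_cons]
      · intro α hα
        rcases Multiset.mem_cons.1 hα with rfl | hα
        · exact ⟨ha0, by omega, by omega⟩
        · exact hKS.extended α hα
      · have hself : Compat n (chord a (a + n)) (chord a (a + n)) := by
          intro t ht
          unfold Interleave at ht
          rcases ht with ht | ht
          · have g1 : 0 < t := mul_lt_cancel (n := n) (by omega) (by omega)
            have := mul_add_le_mul (n := n) (by omega) g1
            omega
          · have g1 : t < 0 := mul_lt_cancel (n := n) (by omega) (by omega)
            have := mul_add_le_mul (n := n) (by omega) g1
            omega
        intro α hα β hβ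
        rcases Multiset.mem_cons.1 hα with rfl | hα <;> rcases Multiset.mem_cons.1 hβ with rfl | hβ
        · exact hself
        · exact new β hβ
        · exact (new α hα).symm
        · exact hKS.compat α hα β hβ
      · obtain ⟨ρ, hρ⟩ := hKS.tag
        refine ⟨ρ, fun c ρ' h => hρ c ρ' ?_⟩
        simpa using h
    · refine ⟨M, ?_, hM.extended, hM.compat, ?_⟩
      · rw [Multiset.bind_congr fun α hα => unfoldLoop_of_valid (hM.valid α hα),
          Multiset.bind_singleton, Multiset.map_id']
      · by_cases h' : ∃ a, rad a true ∈ M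
        · obtain ⟨a, ha⟩ := h'
          refine ⟨true, fun c ρ hρ => ?_⟩
          cases ρ
          · exact absurd ⟨a, c, ha, hρ⟩ h
          · rfl
        · refine ⟨false, fun c ρ hρ => ?_⟩
          cases ρ
          · rfl
          · exact absurd ⟨c, hρ⟩ h'

theorem sum_unfoldLoop {K : Multiset CombArc} {f : CombArc → ℤ} (h : ∀ α ∈ K, Valid n α ∨
      ∃ c, α = chord c (c + n) ∧ f α = f (rad c true) + f (rad c false)) :
    ((K.bind (unfoldLoop n)).map f).sum = (K.map f).sum := by
  rw [Multiset.map_bind, Multiset.sum_bind]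
  refine congrArg _ (Multiset.map_congr rfl fun α hα => ?_)
  rcases h α hα with h | ⟨c, rfl, h⟩
  · rw [unfoldLoop_of_valid h]; simp
  · rw [unfoldLoop_loop, h]; simp

theorem IsExtendedSystem.valid_or {K : Multiset CombArc} (hK : IsExtendedSystem n K)
    {α : CombArc} (hα : α ∈ K) : Valid n α ∨ ∃ c, (0 ≤ c ∧ c < n) ∧ α = chord c (c + n) := by
  have h := hK.extended α hα
  cases α with
  | chord i k =>
    obtain ⟨h1, h2, h3⟩ := h
    by_cases hk : k - i = n
    · exact Or.inr ⟨i, h1, by rw [← hk]; simp⟩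
    · exact Or.inl ⟨h2, by omega⟩
  | rad j τ => exact Or.inl trivial

theorem IsExtendedSystem.inter_unfoldLoop {K : Multiset CombArc} (hK : IsExtendedSystem n K)
    {i k : ℤ} (hi : -n ≤ i) (hk : k ≤ 2 * n) (hik : 2 ≤ k - i ∧ k - i < n) :
    inter ((K.bind (unfoldLoop n)).bind (lifts n)) i k = inter (K.bind (lifts n)) i k := by
  rw [inter_bind, inter_bind]
  refine sum_unfoldLoop (f := fun α => inter (lifts n α) i k) fun α hα => ?_
  rcases hK.valid_or hα with h | ⟨c, hc, rfl⟩
  · exact Or.inl h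
  · exact Or.inr ⟨c, rfl, inter_loop hc hi hk hik⟩

/-- Exactly one of the two arcs in a loop has a tag different from τ, and the loop crosses {j, cusp}
exactly once. At the base point of the loop the two sides would be -1 and 0, which is why that case
is excluded. -/
theorem IsExtendedSystem.sum_radInter_unfoldLoop {K : Multiset CombArc}
    (hK : IsExtendedSystem n K) {j : ℤ} {τ : Bool} (hj : -n ≤ j ∧ j ≤ 2 * n)
    (h : ∀ c, chord c (c + n) ∈ K → ¬ n ∣ j - c) :
    ((K.bind (unfoldLoop n)).map (radInter n j τ)).sum = (K.map (radInter n j τ)).sum := by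
  refine sum_unfoldLoop fun α hα => ?_
  rcases hK.valid_or hα with h' | ⟨c, hc, rfl⟩
  · exact Or.inl h'
  · refine Or.inr ⟨c, rfl, ?_⟩
    have e := crossCount_loop_cusp hc hj
    rw [indic_neg (h c hα)] at e
    simp only [radInter]
    rw [e, indic_neg (h c hα)]
    cases τ
    · rw [indic_pos (by simp), indic_neg (by simp)]; rfl
    · rw [indic_neg (by simp), indic_pos (by simp)]; rfl

/-- A chord of length at most n cannot pass over both w and w + n, so it crosses the loop as often
as the two chords from w and w + n to the cusp, that is, twice as often as one of them. An arc to
the puncture crosses the loop once and differs in tag from exactly one of τ and its opposite. -/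
theorem IsExtendedSystem.inter_loop_eq {K : Multiset CombArc} (hK : IsExtendedSystem n K)
    {w : ℤ} {τ : Bool} (hw : -n ≤ w ∧ w ≤ n) (h1 : ∀ c, chord c (c + n) ∈ K → ¬ n ∣ w - c)
    (h2 : ∀ c ρ, rad c ρ ∈ K → ¬ n ∣ w - c) :
    inter (K.bind (lifts n)) w (w + n) =
      (K.map (radInter n w τ)).sum + (K.map (radInter n w !τ)).sum := by
  rw [inter_bind, ← Multiset.sum_map_add]
  refine congrArg _ (Multiset.map_congr rfl fun α hα => ?_)
  have hα' := hK.extended α hα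
  cases α with
  | chord c d =>
    have hn : 0 < n := by unfold Extended at hα'; omega
    have hcusp : cusp n = 10 * n := rfl
    have e1 : mult (lifts n (chord c d)) w (w + n) = 0 := by
      refine cnt_eq_zero_iff.2 fun p hp h => ?_
      obtain ⟨t, ht, rfl⟩ := mem_lifts_chord.1 hp
      simp only at h
      have hd : d = c + n := by omega
      subst hd
      exact h1 c hα ⟨t, by rw [mul_comm]; omega⟩
    have e2 : crossCount (lifts n (chord c d)) w (w + n) =
        crossCount (lifts n (chord c d)) w (cusp n) +
          crossCount (lifts n (chord c d)) (w + n) (cusp n) := by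
      have hα'' := hα'
      unfold Extended at hα''
      refine cnt_eq_add (fun p hp => ?_) (fun p hp => ?_) <;>
        obtain ⟨t, ht, rfl⟩ := mem_lifts_chord.1 hp <;>
        have := window_bounds hn ht <;>
        unfold Interleave <;> simp only <;> omega
    rw [crossCount_chord_cusp_add hα' hw] at e2
    rw [inter, e1, e2]
    simp [radInter]
  | rad c ρ =>
    have hn : 0 < n := by unfold Extended at hα'; omega
    have hcusp : cusp n = 10 * n := rfl
    have e1 : mult (lifts n (rad c ρ)) w (w + n) = 0 := by
      refine cnt_eq_zero_iff.2 fun p hp h => ?_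
      obtain ⟨t, ht, rfl⟩ := mem_lifts_rad.1 hp
      simp only at h
      omega
    rw [inter, e1, crossCount_rad_loop hα' hw, indic_neg (h2 c ρ hα)]
    simp only [radInter]
    rw [indic_neg (h2 c ρ hα)]
    by_cases h : ρ = τ
    · rw [indic_neg (by simp [h]), indic_pos (by simp [h])]; rfl
    · rw [indic_pos h, indic_neg (by simp [Bool.eq_not_of_ne h])]; rfl

/-- All arcs to the puncture in a system share a tag, and it is recovered from whether the number of
arcs with a tag other than τ vanishes. -/
theorem IsExtendedSystem.eq_of_cnt_eq {M N : Multiset CombArc} (hM : IsExtendedSystem n M)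
    (hN : IsExtendedSystem n N) {τ : Bool}
    (h1 : ∀ c d, cnt M (fun α => α = chord c d) = cnt N (fun α => α = chord c d))
    (h2 : ∀ c, cnt M (fun α => ∃ ρ, α = rad c ρ) = cnt N (fun α => ∃ ρ, α = rad c ρ))
    (h3 : cnt M (OtherTag τ) = cnt N (OtherTag τ)) : M = N := by
  have key : ∀ M N : Multiset CombArc, IsExtendedSystem n M → IsExtendedSystem n N →
      (∀ c, cnt M (fun α => ∃ ρ, α = rad c ρ) = cnt N (fun α => ∃ ρ, α = rad c ρ)) →
      cnt M (OtherTag τ) = cnt N (OtherTag τ) → ∀ c ρ, rad c ρ ∈ M →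
      cnt M (fun α => α = rad c ρ) = cnt N (fun α => α = rad c ρ) := by
    intro M N hM hN h2 h3 c ρ hmem
    obtain ⟨ρM, hρM⟩ := hM.tag
    obtain ⟨ρN, hρN⟩ := hN.tag
    have e1 := hρM _ _ hmem
    subst e1
    have e2 : ρN = ρ := by
      by_cases hρ : ρ = τ
      · have h4 : 0 < cnt N (fun α => ∃ ρ, α = rad c ρ) := by
          rw [← h2 c]; exact cnt_pos_iff.2 ⟨_, hmem, ρ, rfl⟩
        obtain ⟨_, h5, ρ', rfl⟩ := cnt_pos_iff.1 h4
        have h6 : cnt N (OtherTag τ) = 0 := by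
          rw [← h3, cnt_eq_zero_iff]
          rintro _ hα ⟨c', ρ', rfl, h'⟩
          exact h' ((hρM _ _ hα).trans hρ)
        rw [← hρN _ _ h5, hρ]
        by_contra h7
        exact cnt_eq_zero_iff.1 h6 _ h5 ⟨c, ρ', rfl, h7⟩
      · have h4 : 0 < cnt N (OtherTag τ) := by
          rw [← h3]; exact cnt_pos_iff.2 ⟨_, hmem, c, ρ, rfl, hρ⟩
        obtain ⟨_, h5, c', ρ', rfl, h6⟩ := cnt_pos_iff.1 h4
        rw [← hρN _ _ h5, Bool.eq_not_of_ne h6, Bool.eq_not_of_ne hρ]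
    subst e2
    have h4 : cnt M (fun α => α = rad c ρN) = cnt M (fun α => ∃ ρ, α = rad c ρ) :=
      cnt_congr fun α hα => ⟨fun h => ⟨_, h⟩, by rintro ⟨ρ, rfl⟩; rw [hρM _ _ hα]⟩
    have h5 : cnt N (fun α => α = rad c ρN) = cnt N (fun α => ∃ ρ, α = rad c ρ) :=
      cnt_congr fun α hα => ⟨fun h => ⟨_, h⟩, by rintro ⟨ρ, rfl⟩; rw [hρN _ _ hα]⟩
    rw [h4, h5, h2]
  refine CombArc.eq_of_cnt_eq fun α hα => ?_
  cases α with
  | chord c d => exact h1 c d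
  | rad c ρ =>
    rcases hα with hα | hα
    · exact key M N hM hN h2 h3 c ρ hα
    · exact (key N M hN hM (fun c => (h2 c).symm) h3.symm c ρ hα).symm

/-- Two systems with the same intersection numbers with a triangulation are equal if all of the
arcs of the triangulation that end at the puncture meet them. -/
theorem IsSystem.eq_of_sum_pos (hn : 4 ≤ n) {T : Set CombArc} (hT : IsTriangulation n T)
    {M N : Multiset CombArc} (hM : IsSystem n M) (hN : IsSystem n N)
    (hpos : ∀ j τ, rad j τ ∈ T → -n ≤ j → j ≤ 2 * n → 0 < (M.map (radInter n j τ)).sum)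
    (hchord : ∀ i k, chord i k ∈ T → -n ≤ i → k ≤ 2 * n →
      inter (M.bind (lifts n)) i k = inter (N.bind (lifts n)) i k)
    (hrad : ∀ j τ, rad j τ ∈ T → -n ≤ j → j ≤ 2 * n →
      (M.map (radInter n j τ)).sum = (N.map (radInter n j τ)).sum) : M = N := by
  have hn0 : 0 < n := by omega
  obtain ⟨u, τ, hu, hTu⟩ := hT.exists_rad hn
  have main : ∀ M : Multiset CombArc, IsSystem n M →
      (∀ j τ, rad j τ ∈ T → -n ≤ j → j ≤ 2 * n → 0 < (M.map (radInter n j τ)).sum) →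
      ∃ K, M = K.bind (unfoldLoop n) ∧ IsExtendedSystem n K ∧
        (∀ j τ, rad j τ ∈ T → -n ≤ j → j ≤ 2 * n → (M.map (radInter n j τ)).sum =
          inter (K.bind (lifts n)) j (cusp n) + cnt K (OtherTag τ)) ∧
        (rad u (!τ) ∈ T → ∀ w, w = u ∨ w = u - n → inter (K.bind (lifts n)) w (w + n) =
          (M.map (radInter n w τ)).sum + (M.map (radInter n w !τ)).sum) := by
    intro M hM hpos
    obtain ⟨K, hMK, hK⟩ := hM.exists_unfoldLoop hn
    have hmem : ∀ α ∈ K, ∀ β ∈ unfoldLoop n α, β ∈ M := fun α hα β hβ => by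
      rw [hMK]; exact Multiset.mem_bind.2 ⟨α, hα, hβ⟩
    -- The two arcs in a loop belong to M, so an arc of T at the base point of the loop would have a
    -- nonpositive number.
    have hloop : ∀ j τ, rad j τ ∈ T → -n ≤ j → j ≤ 2 * n → ∀ c, chord c (c + n) ∈ K →
        ¬ n ∣ j - c := by
      intro j τ hj h1 h2 c hc hd
      have h3 := hM.sum_nonpos_of_mem (hmem _ hc _ (rad_mem_unfoldLoop c τ)) hd
      have h4 := hpos j τ hj h1 h2
      omega
    have hsum : ∀ j τ, rad j τ ∈ T → -n ≤ j → j ≤ 2 * n →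
        (M.map (radInter n j τ)).sum = (K.map (radInter n j τ)).sum := by
      intro j τ hj h1 h2
      rw [hMK, hK.sum_radInter_unfoldLoop ⟨h1, h2⟩ (hloop j τ hj h1 h2)]
    refine ⟨K, hMK, hK, fun j τ hj h1 h2 => ?_, fun hTu' w hw => ?_⟩
    · rw [hsum j τ hj h1 h2, sum_radInter_eq hK.extended hn0 ⟨h1, h2⟩]
    · have hwT : ∀ ρ, rad u ρ ∈ T → rad w ρ ∈ T := by
        intro ρ h
        rcases hw with rfl | rfl
        · exact h
        · simpa [shift, sub_eq_add_neg] using hT.shift _ h (-1)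
      have h1 : rad w τ ∈ T := hwT τ hTu
      have h2 : rad w (!τ) ∈ T := hwT _ hTu'
      rw [hsum w _ h1 (by omega) (by omega), hsum w _ h2 (by omega) (by omega)]
      refine hK.inter_loop_eq (by omega) (hloop w τ h1 (by omega) (by omega)) ?_
      intro c ρ hc hd
      have h3 := hM.sum_nonpos_of_mem (hmem _ hc (rad c ρ) (by simp [unfoldLoop])) hd
      have h4 : rad w ρ ∈ T := by
        by_cases h : ρ = τ
        · rw [h]; exact h1
        · rw [Bool.eq_not_of_ne h]; exact h2
      have h5 := hpos w ρ h4 (by omega) (by omega)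
      omega
  have hpos' : ∀ j τ, rad j τ ∈ T → -n ≤ j → j ≤ 2 * n → 0 < (N.map (radInter n j τ)).sum :=
    fun j τ h h1 h2 => by rw [← hrad j τ h h1 h2]; exact hpos j τ h h1 h2
  obtain ⟨K, hMK, hK, kr, kl⟩ := main M hM hpos
  obtain ⟨L, hNL, hL, lr, ll⟩ := main N hN hpos'
  have hchord' : ∀ i k, chord i k ∈ T → -n ≤ i → k ≤ 2 * n →
      inter (K.bind (lifts n)) i k = inter (L.bind (lifts n)) i k := by
    intro i k h hi hk
    have := hchord i k h hi hk
    rwa [hMK, hNL, hK.inter_unfoldLoop hi hk (hT.valid _ h),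
      hL.inter_unfoldLoop hi hk (hT.valid _ h)] at this
  have hs : cnt K (OtherTag τ) = cnt L (OtherTag τ) := by
    by_cases hu' : ∃ c, rad c (!τ) ∈ T
    · obtain ⟨c, hc⟩ := hu'
      have hu'' : rad u (!τ) ∈ T := by
        have h1 := hT.compat _ hTu _ hc
        rcases h1 with h1 | ⟨t, h1⟩
        · exact absurd h1.symm (Bool.not_ne_self τ)
        · have h2 := hT.shift _ hc t
          rwa [shift, mul_comm t, show c + n * t = u by omega] at h2
      -- The numbers of the two arcs of T at u differ by the difference of the counts of the two
      -- tags. One of these counts is zero, so the difference determines both.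
      have h1 := hrad u τ hTu (by omega) (by omega)
      have h2 := hrad u _ hu'' (by omega) (by omega)
      rw [kr u τ hTu (by omega) (by omega), lr u τ hTu (by omega) (by omega)] at h1
      rw [kr u _ hu'' (by omega) (by omega), lr u _ hu'' (by omega) (by omega)] at h2
      have h3 := hK.otherTag τ
      have h4 := hL.otherTag τ
      have h5 : 0 ≤ cnt K IsRad := cnt_nonneg
      have h6 : 0 ≤ cnt L IsRad := cnt_nonneg
      omega
    · have hτ : ∀ c ρ, rad c ρ ∈ T → ρ = τ := by
        intro c ρ h
        by_contra h'
        rw [Bool.eq_not_of_ne h'] at h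
        exact hu' ⟨c, h⟩
      refine le_antisymm ?_ ?_
      · refine otherTag_le hn hT hTu hτ hK hL hchord' ?_ ?_ <;> intro j h h1 h2
        · rw [← kr j τ h h1 h2, ← lr j τ h h1 h2, hrad j τ h h1 h2]
        · rw [← lr j τ h h1 h2]; exact hpos' j τ h h1 h2
      · refine otherTag_le hn hT hTu hτ hL hK (fun i k h h1 h2 => (hchord' i k h h1 h2).symm)
          ?_ ?_ <;> intro j h h1 h2
        · rw [← kr j τ h h1 h2, ← lr j τ h h1 h2, hrad j τ h h1 h2]
        · rw [← kr j τ h h1 h2]; exact hpos j τ h h1 h2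
  obtain ⟨r1, r2⟩ := extended_determined hn hT hu hTu hK.extended hL.extended
    (isNonCrossing_bind hn0 hK.extended hK.compat) (isNonCrossing_bind hn0 hL.extended hL.compat)
    hchord' (fun j h h1 h2 => by
      have := hrad j τ h h1 h2
      rw [kr j τ h h1 h2, lr j τ h h1 h2] at this
      omega)
    (fun h w hw => by
      have hwT : ∀ ρ, rad u ρ ∈ T → rad w ρ ∈ T := by
        intro ρ h
        rcases hw with rfl | rfl
        · exact h
        · simpa [shift, sub_eq_add_neg] using hT.shift _ h (-1)
      rw [kl h w hw, ll h w hw, hrad w _ (hwT _ hTu) (by omega) (by omega),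
        hrad w _ (hwT _ h) (by omega) (by omega)])
  rw [hMK, hNL, hK.eq_of_cnt_eq hL r1 r2 hs]

theorem radInter_add {j : ℤ} {τ : Bool} {α : CombArc} (hα : Extended n α) (hj : -n ≤ j ∧ j ≤ n) :
    radInter n (j + n) τ α = radInter n j τ α := by
  cases α with
  | chord c d => exact crossCount_chord_cusp_add hα hj
  | rad c ρ =>
    simp only [radInter]
    congr 1
    refine indic_congr ?_
    rw [show j + n - c = (j - c) + n by ring]
    exact dvd_add_self_right

/-- Systems of compatible arcs in a once-punctured polygon are determined by their intersection
numbers with the arcs of a tagged triangulation. -/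
theorem IsSystem.eq_of_inter_eq (hn : 4 ≤ n) {T : Set CombArc} (hT : IsTriangulation n T)
    {M N : Multiset CombArc} (hM : IsSystem n M) (hN : IsSystem n N)
    (hchord : ∀ i k, chord i k ∈ T → -n ≤ i → k ≤ 2 * n →
      inter (M.bind (lifts n)) i k = inter (N.bind (lifts n)) i k)
    (hrad : ∀ j τ, rad j τ ∈ T → -n ≤ j → j ≤ 2 * n →
      (M.map (radInter n j τ)).sum = (N.map (radInter n j τ)).sum) : M = N := by
  have hn0 : 0 < n := by omega
  -- Either every arc of T to the puncture meets the systems, or one of them is compatible with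
  -- both; the second case is moved to a representative in [0, n).
  by_cases h : ∀ j τ, rad j τ ∈ T → -n ≤ j → j ≤ 2 * n → 0 < (M.map (radInter n j τ)).sum
  · exact hM.eq_of_sum_pos hn hT hN h hchord hrad
  push Not at h
  obtain ⟨j, τ, hj, h1, h2, h3⟩ := h
  have per : ∀ j, -n ≤ j ∧ j ≤ n →
      (M.map (radInter n (j + n) τ)).sum = (M.map (radInter n j τ)).sum := fun j hj =>
    congrArg _ (Multiset.map_congr rfl fun α hα => radInter_add (hM.extended α hα) hj)
  obtain ⟨q, r, e1, e2, e3, -⟩ := exists_quotient hn0 0 j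
  have hr : rad r τ ∈ T := by
    have := hT.shift _ hj (-q)
    rwa [shift, show j + -q * n = r by rw [e1]; ring] at this
  refine hM.eq_of_sum_le hn hT hN ⟨e2, e3⟩ hr ?_ hchord hrad
  have hq : q = -1 ∨ q = 0 ∨ q = 1 ∨ q = 2 := by
    have g1 : -2 < q := by
      by_contra hq
      have := mul_add_le_mul hn0 (show q < -1 by omega)
      omega
    have g2 : q < 3 := by
      by_contra hq
      have := mul_add_le_mul hn0 (show 2 < q by omega)
      omega
    omega
  rcases hq with rfl | rfl | rfl | rfl
  · rw [show r = j + n by omega, per j (by omega)]; exact h3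
  · rw [show r = j by omega]; exact h3
  · rw [show j = r + n by omega, per r (by omega)] at h3; exact h3
  · rw [show j = r + n + n by omega, per (r + n) (by omega), per r (by omega)] at h3; exact h3

end CombArc

/-! ### The polygon without a puncture -/

namespace ChordSystem

/-- The diagonals of the polygon with the vertices `0, …, n - 1`. -/
def IsDiagonal (n : ℤ) (p : ℤ × ℤ) : Prop :=
  0 ≤ p.1 ∧ 2 ≤ p.2 - p.1 ∧ p.2 < n ∧ p.2 - p.1 < n - 1

/-- A multiset of noncrossing diagonals is determined by its intersection numbers with a
triangulation. -/
theorem eq_of_inter_eq {n : ℤ} {T : Set (ℤ × ℤ)} (hT : ∀ p ∈ T, IsDiagonal n p)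
    (hTT : ∀ p ∈ T, ∀ q ∈ T, ¬ Interleave p.1 p.2 q.1 q.2)
    (hmax : ∀ p, IsDiagonal n p → (∀ q ∈ T, ¬ Interleave p.1 p.2 q.1 q.2) → p ∈ T)
    {L K : Multiset (ℤ × ℤ)} (hLd : ∀ p ∈ L, IsDiagonal n p) (hKd : ∀ p ∈ K, IsDiagonal n p)
    (hL : ∀ p ∈ L, ∀ q ∈ L, ¬ Interleave p.1 p.2 q.1 q.2)
    (hK : ∀ p ∈ K, ∀ q ∈ K, ¬ Interleave p.1 p.2 q.1 q.2)
    (h : ∀ p ∈ T, inter L p.1 p.2 = inter K p.1 p.2) : L = K := by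
  classical
  have lt : ∀ p, IsDiagonal n p → p.1 < p.2 := fun p hp => by have := hp.2.1; omega
  have hL' : IsNonCrossing L := ⟨fun p hp => lt p (hLd p hp), hL⟩
  have hK' : IsNonCrossing K := ⟨fun p hp => lt p (hKd p hp), hK⟩
  have hfin : T.Finite := by
    refine ((Set.finite_Icc (0 : ℤ) n).prod (Set.finite_Icc (0 : ℤ) n)).subset fun p hp => ?_
    have := hT p hp
    unfold IsDiagonal at this
    simp only [Set.mem_prod, Set.mem_Icc]
    omega
  -- The chords that are not diagonals are the sides, including {0, n - 1}; no diagonal crosses or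
  -- equals them.
  have side : ∀ M : Multiset (ℤ × ℤ), (∀ p ∈ M, IsDiagonal n p) → ∀ i k, 0 ≤ i → i < k → k < n →
      ¬ IsDiagonal n (i, k) → inter M i k = 0 := by
    intro M hM i k hi hik hk hd
    have e1 : crossCount M i k = 0 := cnt_eq_zero_iff.2 fun p hp h => by
      have := hM p hp
      unfold IsDiagonal at *
      unfold Interleave at h
      simp only at hd
      omega
    have e2 : mult M i k = 0 := cnt_eq_zero_iff.2 fun p hp h => by
      have := hM p hp
      unfold IsDiagonal at *
      simp only at hd
      omega
    rw [inter, e1, e2]; rfl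
  have main := polygon_determined hL' hK' (Set.Ico 0 n) hfin.toFinset
    (fun p hp => by
      have := hT p (hfin.mem_toFinset.1 hp)
      unfold IsDiagonal at this
      simp only [Set.mem_Ico]
      omega)
    (fun p hp q hq => hTT p (hfin.mem_toFinset.1 hp) q (hfin.mem_toFinset.1 hq))
    (fun i hi k hk hik hS => by
      by_cases hd : IsDiagonal n (i, k)
      · exact h (i, k) (hmax (i, k) hd fun q hq => hS q (hfin.mem_toFinset.2 hq))
      · rw [side L hLd i k hi.1 hik hk.2 hd, side K hKd i k hi.1 hik hk.2 hd])
  ext p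
  have conv : ∀ M : Multiset (ℤ × ℤ), mult M p.1 p.2 = M.count p := fun M => by
    rw [← cnt_eq_count]
    exact cnt_congr fun q _ => by rw [Prod.ext_iff]
  by_cases hp : p ∈ L ∨ p ∈ K
  · have hd : IsDiagonal n p := hp.elim (hLd p) (hKd p)
    have h1 := (crossCount_mult_congr hL' hK' (main p.1
      ⟨hd.1, by have := hd.2; omega⟩ p.2 ⟨by have := hd.2; have := hd.1; omega, hd.2.2.1⟩
      (lt p hd))).2
    rw [conv, conv] at h1
    exact_mod_cast h1
  · rw [not_or] at hp
    rw [Multiset.count_eq_zero_of_notMem hp.1, Multiset.count_eq_zero_of_notMem hp.2]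

end ChordSystem

/-! ### Continuous logarithms -/

namespace Complex

/-- Two values differ by an element of 2πiℤ, and a continuous map from a preconnected space to a
discrete set is constant. -/
theorem eq_of_exp_const {Y : Type*} [TopologicalSpace Y] [PreconnectedSpace Y] {D : Y → ℂ}
    (hD : Continuous D) {c : ℂ} (h : ∀ y, exp (D y) = c) (y y' : Y) : D y = D y' := by
  have hdisc : DiscreteTopology (AddSubgroup.zmultiples (2 * Real.pi * Complex.I : ℂ)) :=
    NormedSpace.discreteTopology_zmultiples _
  have key := isPreconnected_univ.constant_of_mapsTo (S := (Set.univ : Set Y))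
    (T := (AddSubgroup.zmultiples (2 * Real.pi * Complex.I : ℂ) : Set ℂ))
    (f := fun z => D z - D y') (x := y) (y := y') ⟨hdisc⟩ (by fun_prop) (fun z _ => ?_)
    (Set.mem_univ _) (Set.mem_univ _)
  · simpa [sub_eq_zero] using key
  · obtain ⟨n, hn⟩ := exp_eq_exp_iff_exists_int.1 ((h z).trans (h y').symm)
    refine AddSubgroup.mem_zmultiples_iff.2 ⟨n, ?_⟩
    simp [hn]

/-- Continuous nowhere vanishing functions on the square have continuous logarithms. -/
theorem exists_log_square (f : C(I × I, ℂ)) (hf : ∀ z, f z ≠ 0) {w : ℂ} (hw : exp w = f (0, 0)) :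
    ∃ H : C(I × I, ℂ), H (0, 0) = w ∧ ∀ z, exp (H z) = f z := by
  -- Clamping the coordinates extends f to the whole plane, where the lifting theorem for the
  -- covering `exp` is applied.
  let g : C(ℝ × ℝ, ℂ) := ⟨fun z => f (Set.projIcc 0 1 zero_le_one z.1,
    Set.projIcc 0 1 zero_le_one z.2), by fun_prop⟩
  obtain ⟨H, ⟨h1, h2⟩, -⟩ := isCoveringMapOn_exp.existsUnique_continuousMap_lifts g
    (a₀ := ((0 : ℝ), (0 : ℝ))) (e₀ := w) (by simpa [g] using hw) (fun a => hf _)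
  refine ⟨⟨fun z => H (z.1, z.2), by fun_prop⟩, by simpa using h1, fun z => ?_⟩
  have := congrFun h2 ((z.1 : ℝ), (z.2 : ℝ))
  simpa [g] using this

/-- The change of a continuous logarithm along a path in a slit plane. -/
theorem log_sub_of_slitPlane {P q : I → ℂ} (hP : Continuous P) (hq : Continuous q)
    (h : ∀ t, exp (P t) = q t) (c : ℂ) (hc : ∀ t, c * q t ∈ slitPlane) :
    P 1 - P 0 = log (c * q 1) - log (c * q 0) := by
  have h1 : Continuous fun t => P t - log (c * q t) :=
    hP.sub ((continuous_const.mul hq).clog hc)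
  have h2 := eq_of_exp_const h1 (c := c⁻¹) (fun t => by
    have h3 := slitPlane_ne_zero (hc t)
    rw [exp_sub, exp_log h3, h t]
    have := right_ne_zero_of_mul h3
    have := left_ne_zero_of_mul h3
    field_simp) 1 0
  linear_combination h2

theorem arg_neg_I_mul_of_pos {r : ℝ} (hr : 0 < r) : arg (-Complex.I * r) = -(Real.pi / 2) := by
  rw [mul_comm, arg_real_mul _ hr, arg_neg_I]

theorem arg_neg_I_mul_of_neg {r : ℝ} (hr : r < 0) : arg (-Complex.I * r) = Real.pi / 2 := by
  rw [show -Complex.I * r = ((-r : ℝ) : ℂ) * Complex.I by push_cast; ring,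
    arg_real_mul _ (neg_pos.2 hr), arg_I]

theorem arg_I_mul_of_pos {r : ℝ} (hr : 0 < r) : arg (Complex.I * r) = Real.pi / 2 := by
  rw [mul_comm, arg_real_mul _ hr, arg_I]

theorem arg_I_mul_of_neg {r : ℝ} (hr : r < 0) : arg (Complex.I * r) = -(Real.pi / 2) := by
  rw [show Complex.I * r = ((-r : ℝ) : ℂ) * -Complex.I by push_cast; ring,
    arg_real_mul _ (neg_pos.2 hr), arg_neg_I]

theorem neg_I_mul_mem_slitPlane {z : ℂ} (hz : 0 ≤ z.im) (h : z ≠ 0) :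
    -Complex.I * z ∈ slitPlane := by
  rw [mem_slitPlane_iff]
  simp only [neg_mul, neg_re, I_mul_re, neg_neg, neg_im, I_mul_im, ne_eq, neg_eq_zero]
  rcases hz.eq_or_lt with h' | h'
  · exact Or.inr fun h'' => h (Complex.ext h'' h'.symm)
  · exact Or.inl h'

theorem I_mul_mem_slitPlane {z : ℂ} (hz : z.im ≤ 0) (h : z ≠ 0) : Complex.I * z ∈ slitPlane := by
  have := neg_I_mul_mem_slitPlane (z := -z) (by simpa using hz) (neg_ne_zero.2 h)
  simpa using this

/-- Here 1 - e^{ix} is the positive number 2 sin(x/2) times e^{i(x/2 - π/2)}. -/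
theorem arg_one_sub_exp {x : ℝ} (h0 : 0 < x) (h1 : x < 2 * Real.pi) :
    arg (1 - exp (Complex.I * x)) = x / 2 - Real.pi / 2 := by
  have h2 : 0 < 2 * Real.sin (x / 2) :=
    mul_pos two_pos (Real.sin_pos_of_pos_of_lt_pi (by linarith) (by linarith))
  have h3 : 1 - exp (Complex.I * x) = ((2 * Real.sin (x / 2) : ℝ) : ℂ) *
      (cos ((x / 2 - Real.pi / 2 : ℝ) : ℂ) + sin ((x / 2 - Real.pi / 2 : ℝ) : ℂ) * Complex.I) := by
    rw [← ofReal_cos, ← ofReal_sin, Real.cos_sub_pi_div_two, Real.sin_sub_pi_div_two,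
      mul_comm Complex.I, exp_mul_I, ← ofReal_cos, ← ofReal_sin]
    have e1 : Real.cos x = 1 - 2 * Real.sin (x / 2) ^ 2 := by
      have h4 := Real.cos_two_mul (x / 2)
      have h5 := Real.cos_sq_add_sin_sq (x / 2)
      rw [show 2 * (x / 2) = x by ring] at h4
      linarith
    have e2 : Real.sin x = 2 * Real.sin (x / 2) * Real.cos (x / 2) := by
      rw [← Real.sin_two_mul]; congr 1; ring
    rw [e1, e2]
    push_cast
    ring
  rw [h3, arg_mul_cos_add_sin_mul_I h2 ⟨by linarith, by linarith⟩]

theorem arg_one_sub_exp_neg {x : ℝ} (h0 : -(2 * Real.pi) < x) (h1 : x < 0) :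
    arg (1 - exp (Complex.I * x)) = x / 2 + Real.pi / 2 := by
  have h := arg_one_sub_exp (x := x + 2 * Real.pi) (by linarith) (by linarith)
  rw [show Complex.I * ((x + 2 * Real.pi : ℝ) : ℂ) = Complex.I * x + 2 * Real.pi * Complex.I by
    push_cast; ring, exp_periodic] at h
  rw [h]; ring

end Complex

/-! ### Paths that have to meet -/

section crossing

open Complex

/-- If `f - g` has no zero, its logarithm on the square. -/
theorem exists_log_sub {f g : C(I, ℂ)} (h : ∀ s t, f s ≠ g t) :
    ∃ H : C(I × I, ℂ), ∀ s t, exp (H (s, t)) = f s - g t := by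
  obtain ⟨H, -, hH⟩ := exists_log_square ⟨fun z => f z.1 - g z.2, by fun_prop⟩
    (fun z => sub_ne_zero.2 (h _ _)) (w := log (f 0 - g 0))
    (exp_log (sub_ne_zero.2 (h _ _)))
  exact ⟨H, fun s t => hH _⟩

/-- Paths in the upper half plane whose endpoints are real and interlaced meet. -/
theorem exists_eq_of_interlaced {f g : C(I, ℂ)} {a₀ a₁ b₀ b₁ : ℝ} (hf : ∀ t, 0 ≤ (f t).im)
    (hg : ∀ t, 0 ≤ (g t).im) (f0 : f 0 = a₀) (f1 : f 1 = a₁) (g0 : g 0 = b₀) (g1 : g 1 = b₁)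
    (h1 : a₀ < b₀) (h2 : b₀ < a₁) (h3 : a₁ < b₁) : ∃ s t, f s = g t := by
  by_contra! hne
  -- The changes of the logarithm of f(s) - g(t) along the four sides of the square have to cancel.
  -- On each side one of the points is real, so the difference stays in a closed half-plane without
  -- the origin, and its change of argument is read off at the ends. Bottom and right each give -π,
  -- top and left give zero.
  obtain ⟨H, hH⟩ := exists_log_sub hne
  have bottom := log_sub_of_slitPlane (P := fun s => H (s, 0)) (q := fun s => f s - g 0)
    (by fun_prop) (by fun_prop) (fun s => hH s 0) (-Complex.I)
    (fun s => neg_I_mul_mem_slitPlane (by simpa [g0] using hf s) (sub_ne_zero.2 (hne _ _)))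
  have top := log_sub_of_slitPlane (P := fun s => H (s, 1)) (q := fun s => f s - g 1)
    (by fun_prop) (by fun_prop) (fun s => hH s 1) (-Complex.I)
    (fun s => neg_I_mul_mem_slitPlane (by simpa [g1] using hf s) (sub_ne_zero.2 (hne _ _)))
  have left := log_sub_of_slitPlane (P := fun t => H (0, t)) (q := fun t => f 0 - g t)
    (by fun_prop) (by fun_prop) (fun t => hH 0 t) Complex.I
    (fun t => I_mul_mem_slitPlane (by simpa [f0] using hg t) (sub_ne_zero.2 (hne _ _)))
  have right := log_sub_of_slitPlane (P := fun t => H (1, t)) (q := fun t => f 1 - g t)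
    (by fun_prop) (by fun_prop) (fun t => hH 1 t) Complex.I
    (fun t => I_mul_mem_slitPlane (by simpa [f1] using hg t) (sub_ne_zero.2 (hne _ _)))
  have bottom := congrArg im bottom
  have top := congrArg im top
  have left := congrArg im left
  have right := congrArg im right
  simp only [f0, f1, g0, g1, ← ofReal_sub, sub_im, log_im] at bottom top left right
  rw [arg_neg_I_mul_of_pos (by linarith), arg_neg_I_mul_of_neg (by linarith)] at bottom
  rw [arg_neg_I_mul_of_neg (by linarith), arg_neg_I_mul_of_neg (by linarith)] at top
  rw [arg_I_mul_of_neg (by linarith), arg_I_mul_of_neg (by linarith)] at left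
  rw [arg_I_mul_of_neg (by linarith), arg_I_mul_of_pos (by linarith)] at right
  have := Real.pi_pos
  linarith

/-- A path in the upper half plane with real endpoints meets the paths that start between the
endpoints and end above the path. -/
theorem exists_eq_of_above {f g : C(I, ℂ)} {a₀ a₁ b₀ : ℝ} (hf : ∀ t, 0 ≤ (f t).im)
    (hg : ∀ t, 0 ≤ (g t).im) (f0 : f 0 = a₀) (f1 : f 1 = a₁) (g0 : g 0 = b₀)
    (g1 : ∀ s, (f s).im < (g 1).im) (h1 : a₀ < b₀) (h2 : b₀ < a₁) : ∃ s t, f s = g t := by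
  by_contra! hne
  obtain ⟨H, hH⟩ := exists_log_sub hne
  have bottom := log_sub_of_slitPlane (P := fun s => H (s, 0)) (q := fun s => f s - g 0)
    (by fun_prop) (by fun_prop) (fun s => hH s 0) (-Complex.I)
    (fun s => neg_I_mul_mem_slitPlane (by simpa [g0] using hf s) (sub_ne_zero.2 (hne _ _)))
  -- Along the top the difference lies in the lower half-plane. The arguments at the two upper
  -- corners are not known, but they cancel against those of the left and right sides.
  have top := log_sub_of_slitPlane (P := fun s => H (s, 1)) (q := fun s => f s - g 1)
    (by fun_prop) (by fun_prop) (fun s => hH s 1) Complex.I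
    (fun s => I_mul_mem_slitPlane (by simpa using (g1 s).le) (sub_ne_zero.2 (hne _ _)))
  have left := log_sub_of_slitPlane (P := fun t => H (0, t)) (q := fun t => f 0 - g t)
    (by fun_prop) (by fun_prop) (fun t => hH 0 t) Complex.I
    (fun t => I_mul_mem_slitPlane (by simpa [f0] using hg t) (sub_ne_zero.2 (hne _ _)))
  have right := log_sub_of_slitPlane (P := fun t => H (1, t)) (q := fun t => f 1 - g t)
    (by fun_prop) (by fun_prop) (fun t => hH 1 t) Complex.I
    (fun t => I_mul_mem_slitPlane (by simpa [f1] using hg t) (sub_ne_zero.2 (hne _ _)))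
  have bottom := congrArg im bottom
  have top := congrArg im top
  have left := congrArg im left
  have right := congrArg im right
  simp only [f0, f1, g0, ← ofReal_sub, sub_im, log_im] at bottom top left right
  rw [arg_neg_I_mul_of_pos (by linarith), arg_neg_I_mul_of_neg (by linarith)] at bottom
  rw [arg_I_mul_of_neg (r := a₀ - b₀) (by linarith)] at left
  rw [arg_I_mul_of_pos (r := a₁ - b₀) (by linarith)] at right
  have := Real.pi_pos
  linarith

theorem one_sub_mem_slitPlane {z : ℂ} (hz : ‖z‖ ≤ 1) (h : z ≠ 1) : 1 - z ∈ slitPlane := by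
  rw [mem_slitPlane_iff]
  left
  have h1 : z.re ≤ 1 := (re_le_norm z).trans hz
  rcases h1.eq_or_lt with h1 | h1
  · exfalso
    have h2 : z.re * z.re + z.im * z.im ≤ 1 := by
      have := normSq_eq_norm_sq z
      rw [normSq_apply] at this
      rw [this]
      nlinarith [norm_nonneg z]
    have h3 : z.im = 0 := by nlinarith
    exact h (Complex.ext h1 h3)
  · simpa using h1

/-- Paths in the unit disc whose endpoints are interlaced on the unit circle meet. -/
theorem exists_eq_of_interlaced_circle {f g : C(I, ℂ)} {a₀ a₁ b₀ b₁ : ℝ} (hf : ∀ t, ‖f t‖ ≤ 1)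
    (hg : ∀ t, ‖g t‖ ≤ 1) (f0 : f 0 = exp (Complex.I * a₀)) (f1 : f 1 = exp (Complex.I * a₁))
    (g0 : g 0 = exp (Complex.I * b₀)) (g1 : g 1 = exp (Complex.I * b₁))
    (h1 : a₀ < b₀) (h2 : b₀ < a₁) (h3 : a₁ < b₁) (h4 : b₁ < a₀ + 2 * Real.pi) :
    ∃ s t, f s = g t := by
  by_contra! hne
  obtain ⟨H, hH⟩ := exists_log_sub hne
  -- The disc lies on one side of its tangent at e^{ix}, so after a rotation the difference from
  -- this point is in the slit plane. The tangents play the role of the real line.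
  have key : ∀ (x : ℝ) (z : ℂ), ‖z‖ ≤ 1 → z ≠ exp (Complex.I * x) →
      1 - z * exp (-(Complex.I * x)) ∈ slitPlane := by
    intro x z hz hzx
    refine one_sub_mem_slitPlane ?_ fun h => hzx ?_
    · rw [norm_mul, show -(Complex.I * x) = ((-x : ℝ) : ℂ) * Complex.I by push_cast; ring,
        norm_exp_ofReal_mul_I, mul_one]
      exact hz
    · rw [exp_neg] at h
      exact (mul_inv_eq_one₀ (exp_ne_zero _)).1 h
  have e : ∀ x : ℝ, exp (-(Complex.I * x)) * exp (Complex.I * x) = 1 := fun x => by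
    rw [← exp_add]; simp
  have hfe : ∀ x : ℝ, ∀ z : ℂ, -exp (-(Complex.I * x)) * (z - exp (Complex.I * x)) =
      1 - z * exp (-(Complex.I * x)) := fun x z => by linear_combination e x
  have hge : ∀ x : ℝ, ∀ z : ℂ, exp (-(Complex.I * x)) * (exp (Complex.I * x) - z) =
      1 - z * exp (-(Complex.I * x)) := fun x z => by linear_combination e x
  have bottom := log_sub_of_slitPlane (P := fun s => H (s, 0)) (q := fun s => f s - g 0)
    (by fun_prop) (by fun_prop) (fun s => hH s 0) (-exp (-(Complex.I * b₀)))
    (fun s => by rw [g0, hfe]; exact key _ _ (hf s) (g0 ▸ hne s 0))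
  have top := log_sub_of_slitPlane (P := fun s => H (s, 1)) (q := fun s => f s - g 1)
    (by fun_prop) (by fun_prop) (fun s => hH s 1) (-exp (-(Complex.I * b₁)))
    (fun s => by rw [g1, hfe]; exact key _ _ (hf s) (g1 ▸ hne s 1))
  have left := log_sub_of_slitPlane (P := fun t => H (0, t)) (q := fun t => f 0 - g t)
    (by fun_prop) (by fun_prop) (fun t => hH 0 t) (exp (-(Complex.I * a₀)))
    (fun t => by rw [f0, hge]; exact key _ _ (hg t) (f0 ▸ (hne 0 t).symm))
  have right := log_sub_of_slitPlane (P := fun t => H (1, t)) (q := fun t => f 1 - g t)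
    (by fun_prop) (by fun_prop) (fun t => hH 1 t) (exp (-(Complex.I * a₁)))
    (fun t => by rw [f1, hge]; exact key _ _ (hg t) (f1 ▸ (hne 1 t).symm))
  have bottom := congrArg im bottom
  have top := congrArg im top
  have left := congrArg im left
  have right := congrArg im right
  have hsub : ∀ x y : ℝ, exp (Complex.I * x) * exp (-(Complex.I * y)) =
      exp (Complex.I * ((x - y : ℝ) : ℂ)) := fun x y => by
    rw [← exp_add]; congr 1; push_cast; ring
  simp only [f0, f1, g0, g1, hfe, hge, hsub, sub_im, log_im] at bottom top left right
  rw [arg_one_sub_exp (by linarith) (by linarith),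
    arg_one_sub_exp_neg (by linarith) (by linarith)] at bottom right
  rw [arg_one_sub_exp_neg (by linarith) (by linarith),
    arg_one_sub_exp_neg (by linarith) (by linarith)] at top
  rw [arg_one_sub_exp (by linarith) (by linarith),
    arg_one_sub_exp (by linarith) (by linarith)] at left
  have := Real.pi_pos
  linarith

end crossing

/-! ### The universal cover of the punctured disc -/

/-- An automorphism of the unit disc that sends `0` to `p`. -/
def mobius (p w : ℂ) : ℂ := (w + p) / (1 + (starRingEnd ℂ) p * w)

section mobius

variable {p w : ℂ}

theorem mobius_denom_ne_zero (hp : ‖p‖ < 1) (hw : ‖w‖ ≤ 1) : 1 + (starRingEnd ℂ) p * w ≠ 0 := by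
  intro h
  have h1 : ‖(starRingEnd ℂ) p * w‖ = 1 := by
    rw [show (starRingEnd ℂ) p * w = -1 by linear_combination h]; simp
  rw [norm_mul, RCLike.norm_conj] at h1
  nlinarith [norm_nonneg p, norm_nonneg w]

/-- The other factors are positive, so both sides have the same sign as 1 - |w|²; this is why
`mobius p` preserves the disc and its boundary circle. -/
theorem one_sub_normSq_mobius (hp : ‖p‖ < 1) (hw : ‖w‖ ≤ 1) : 1 - Complex.normSq (mobius p w) =
    (1 - Complex.normSq p) * (1 - Complex.normSq w) /
      Complex.normSq (1 + (starRingEnd ℂ) p * w) := by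
  have h := mobius_denom_ne_zero hp hw
  have h' : Complex.normSq (1 + (starRingEnd ℂ) p * w) ≠ 0 := by simpa using h
  rw [mobius, Complex.normSq_div, eq_div_iff h', sub_mul, div_mul_cancel₀ _ h']
  simp only [Complex.normSq_apply, Complex.add_re, Complex.add_im, Complex.mul_re, Complex.mul_im,
    Complex.conj_re, Complex.conj_im, Complex.one_re, Complex.one_im]
  ring

theorem normSq_denom_pos (hp : ‖p‖ < 1) (hw : ‖w‖ ≤ 1) :
    0 < Complex.normSq (1 + (starRingEnd ℂ) p * w) :=
  Complex.normSq_pos.2 (mobius_denom_ne_zero hp hw)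

theorem one_sub_normSq_pos (hp : ‖p‖ < 1) : 0 < 1 - Complex.normSq p := by
  rw [Complex.normSq_eq_norm_sq]; nlinarith [norm_nonneg p]

theorem norm_mobius_lt_one_iff (hp : ‖p‖ < 1) (hw : ‖w‖ ≤ 1) : ‖mobius p w‖ < 1 ↔ ‖w‖ < 1 := by
  have h := one_sub_normSq_mobius hp hw
  have h1 := normSq_denom_pos hp hw
  have h2 := one_sub_normSq_pos hp
  have e : ∀ z : ℂ, ‖z‖ < 1 ↔ 0 < 1 - Complex.normSq z := fun z => by
    rw [Complex.normSq_eq_norm_sq, sub_pos, sq_lt_one_iff₀ (norm_nonneg z)]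
  rw [e, e, h, div_pos_iff_of_pos_right h1, mul_pos_iff_of_pos_left h2]

theorem norm_mobius_le_one (hp : ‖p‖ < 1) (hw : ‖w‖ ≤ 1) : ‖mobius p w‖ ≤ 1 := by
  have h := one_sub_normSq_mobius hp hw
  have h1 := normSq_denom_pos hp hw
  have h2 := one_sub_normSq_pos hp
  have e : ∀ z : ℂ, ‖z‖ ≤ 1 ↔ 0 ≤ 1 - Complex.normSq z := fun z => by
    rw [Complex.normSq_eq_norm_sq, sub_nonneg, sq_le_one_iff₀ (norm_nonneg z)]
  rw [e, h]
  exact div_nonneg (mul_nonneg h2.le ((e w).1 hw)) h1.le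

theorem norm_mobius_eq_one_iff (hp : ‖p‖ < 1) (hw : ‖w‖ ≤ 1) : ‖mobius p w‖ = 1 ↔ ‖w‖ = 1 := by
  have h1 := norm_mobius_lt_one_iff hp hw
  have h2 := norm_mobius_le_one hp hw
  constructor <;> intro h <;> by_contra h'
  · exact h.not_lt (h1.2 (lt_of_le_of_ne hw h'))
  · exact h.not_lt (h1.1 (lt_of_le_of_ne h2 h'))

theorem mobius_neg_mobius (hp : ‖p‖ < 1) (hw : ‖w‖ ≤ 1) : mobius (-p) (mobius p w) = w := by
  have h1 := mobius_denom_ne_zero hp hw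
  have h2 := mobius_denom_ne_zero (p := -p) (by simpa using hp) (norm_mobius_le_one hp hw)
  have h3 : mobius p w * (1 + (starRingEnd ℂ) p * w) = w + p := div_mul_cancel₀ _ h1
  rw [mobius, div_eq_iff h2, map_neg]
  refine mul_right_cancel₀ h1 ?_
  linear_combination (1 + (starRingEnd ℂ) p * w) * h3

theorem mobius_mobius_neg (hp : ‖p‖ < 1) (hw : ‖w‖ ≤ 1) : mobius p (mobius (-p) w) = w := by
  simpa using mobius_neg_mobius (p := -p) (by simpa using hp) hw

theorem mobius_zero (p : ℂ) : mobius p 0 = p := by simp [mobius]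

theorem mobius_injective (hp : ‖p‖ < 1) {z : ℂ} (hw : ‖w‖ ≤ 1) (hz : ‖z‖ ≤ 1)
    (h : mobius p w = mobius p z) : w = z := by
  rw [← mobius_neg_mobius hp hw, h, mobius_neg_mobius hp hz]

theorem continuous_mobius {Y : Type*} [TopologicalSpace Y] (hp : ‖p‖ < 1) {f : Y → ℂ}
    (hf : Continuous f) (h : ∀ y, ‖f y‖ ≤ 1) : Continuous fun y => mobius p (f y) :=
  (hf.add continuous_const).div (continuous_const.add (continuous_const.mul hf))
    fun y => mobius_denom_ne_zero hp (h y)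

end mobius

/-- The universal covering of the punctured disc by the upper half plane. -/
def discCover (p w : ℂ) : ℂ := mobius p (Complex.exp (Complex.I * w))

section discCover

variable {p w : ℂ}

theorem norm_exp_I_mul (w : ℂ) : ‖Complex.exp (Complex.I * w)‖ = Real.exp (-w.im) := by
  rw [Complex.norm_exp]; simp

theorem norm_exp_I_mul_le_one (hw : 0 ≤ w.im) : ‖Complex.exp (Complex.I * w)‖ ≤ 1 := by
  rw [norm_exp_I_mul]; simpa using hw

theorem norm_discCover_le_one (hp : ‖p‖ < 1) (hw : 0 ≤ w.im) : ‖discCover p w‖ ≤ 1 :=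
  norm_mobius_le_one hp (norm_exp_I_mul_le_one hw)

theorem norm_discCover_lt_one (hp : ‖p‖ < 1) (hw : 0 < w.im) : ‖discCover p w‖ < 1 := by
  rw [discCover, norm_mobius_lt_one_iff hp (norm_exp_I_mul_le_one hw.le), norm_exp_I_mul]
  simpa using hw

theorem norm_discCover_eq_one_iff (hp : ‖p‖ < 1) (hw : 0 ≤ w.im) : ‖discCover p w‖ = 1 ↔ w.im = 0 := by
  rw [discCover, norm_mobius_eq_one_iff hp (norm_exp_I_mul_le_one hw), norm_exp_I_mul]
  simp

theorem discCover_ne (hp : ‖p‖ < 1) (hw : 0 ≤ w.im) : discCover p w ≠ p := by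
  intro h
  have := mobius_injective hp (norm_exp_I_mul_le_one hw) (by simp) (h.trans (mobius_zero p).symm)
  exact Complex.exp_ne_zero _ this

theorem discCover_eq_iff (hp : ‖p‖ < 1) {z : ℂ} (hw : 0 ≤ w.im) (hz : 0 ≤ z.im) :
    discCover p w = discCover p z ↔ ∃ t : ℤ, w = z + t * (2 * Real.pi) := by
  have key : Complex.exp (Complex.I * w) = Complex.exp (Complex.I * z) ↔
      ∃ t : ℤ, w = z + t * (2 * Real.pi) := by
    rw [Complex.exp_eq_exp_iff_exists_int]
    refine exists_congr fun t => ⟨fun h => ?_, fun h => ?_⟩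
    · refine mul_left_cancel₀ Complex.I_ne_zero ?_
      rw [h]; ring
    · rw [h]; ring
  rw [← key]
  exact ⟨fun h => mobius_injective hp (norm_exp_I_mul_le_one hw) (norm_exp_I_mul_le_one hz) h,
    fun h => by rw [discCover, h]; rfl⟩

theorem discCover_add (t : ℤ) : discCover p (w + t * (2 * Real.pi)) = discCover p w := by
  rw [discCover, discCover]
  congr 1
  rw [Complex.exp_eq_exp_iff_exists_int]
  exact ⟨t, by ring⟩

theorem continuous_discCover {Y : Type*} [TopologicalSpace Y] (hp : ‖p‖ < 1) {f : Y → ℂ}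
    (hf : Continuous f) (h : ∀ y, 0 ≤ (f y).im) : Continuous fun y => discCover p (f y) :=
  continuous_mobius hp (Complex.continuous_exp.comp (continuous_const.mul hf))
    fun y => norm_exp_I_mul_le_one (h y)

/-- After `mobius (-p)` the function has no zeros, and -i times its logarithm is the lift. Values in
the unit disc correspond to a nonnegative imaginary part. -/
theorem exists_lift_square (hp : ‖p‖ < 1) (f : C(I × I, ℂ)) (hf : ∀ z, ‖f z‖ ≤ 1)
    (hfp : ∀ z, f z ≠ p) (hw : 0 ≤ w.im) (h0 : discCover p w = f (0, 0)) :
    ∃ H : C(I × I, ℂ), H (0, 0) = w ∧ (∀ z, 0 ≤ (H z).im) ∧ ∀ z, discCover p (H z) = f z := by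
  have hp' : ‖-p‖ < 1 := by simpa using hp
  have h1 : ∀ z, mobius (-p) (f z) ≠ 0 := fun z h => hfp z (by
    rw [← mobius_mobius_neg hp (hf z), h, mobius_zero])
  obtain ⟨H, h2, h3⟩ := Complex.exists_log_square ⟨fun z => mobius (-p) (f z),
    continuous_mobius hp' f.continuous hf⟩ h1 (w := Complex.I * w) (by
      simp only [ContinuousMap.coe_mk]
      rw [← h0, discCover, mobius_neg_mobius hp (norm_exp_I_mul_le_one hw)])
  have h4 : ∀ z, Complex.I * (-Complex.I * H z) = H z := fun z => by
    rw [← mul_assoc]; simp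
  refine ⟨⟨fun z => -Complex.I * H z, by fun_prop⟩, ?_, fun z => ?_, fun z => ?_⟩
  · simp only [ContinuousMap.coe_mk, h2]
    rw [← mul_assoc]; simp
  · have h5 := congrArg norm (h3 z)
    rw [Complex.norm_exp] at h5
    have h6 := norm_mobius_le_one hp' (hf z)
    simp only [ContinuousMap.coe_mk] at h5 ⊢
    rw [← h5, Real.exp_le_one_iff] at h6
    simpa using h6
  · simp only [ContinuousMap.coe_mk]
    rw [discCover, h4, h3]
    exact mobius_mobius_neg hp (hf z)

theorem exists_lift_path (hp : ‖p‖ < 1) (f : C(I, ℂ)) (hf : ∀ z, ‖f z‖ ≤ 1)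
    (hfp : ∀ z, f z ≠ p) (hw : 0 ≤ w.im) (h0 : discCover p w = f 0) :
    ∃ H : C(I, ℂ), H 0 = w ∧ (∀ z, 0 ≤ (H z).im) ∧ ∀ z, discCover p (H z) = f z := by
  obtain ⟨H, h1, h2, h3⟩ := exists_lift_square hp ⟨fun z => f z.1, by fun_prop⟩ (fun z => hf _)
    (fun z => hfp _) hw h0
  exact ⟨⟨fun t => H (t, 0), by fun_prop⟩, h1, fun t => h2 _, fun t => h3 _⟩

/-- Lifts of a path that start at the same point agree. -/
theorem lift_unique {Y : Type*} [TopologicalSpace Y] [PreconnectedSpace Y] (hp : ‖p‖ < 1)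
    {u v : Y → ℂ} (hu : Continuous u) (hv : Continuous v) (hu' : ∀ y, 0 ≤ (u y).im)
    (hv' : ∀ y, 0 ≤ (v y).im) (h : ∀ y, discCover p (u y) = discCover p (v y)) (y y' : Y) :
    u y - v y = u y' - v y' := by
  have := Complex.eq_of_exp_const (D := fun y => Complex.I * (u y - v y)) (by fun_prop) (c := 1)
    (fun y => by
      obtain ⟨t, ht⟩ := (discCover_eq_iff hp (hu' y) (hv' y)).1 (h y)
      rw [ht, ← Complex.exp_zero, Complex.exp_eq_exp_iff_exists_int]
      exact ⟨t, by ring⟩) y y'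
  exact mul_left_cancel₀ Complex.I_ne_zero this

theorem exists_discCover_eq (hp : ‖p‖ < 1) {z : ℂ} (hz : ‖z‖ ≤ 1) (hzp : z ≠ p) :
    ∃ w : ℂ, 0 ≤ w.im ∧ discCover p w = z := by
  have hp' : ‖-p‖ < 1 := by simpa using hp
  have h1 : mobius (-p) z ≠ 0 := fun h => hzp (by rw [← mobius_mobius_neg hp hz, h, mobius_zero])
  have h4 : Complex.exp (Complex.I * (-Complex.I * Complex.log (mobius (-p) z))) = mobius (-p) z := by
    rw [← mul_assoc]; simp [Complex.exp_log h1]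
  refine ⟨-Complex.I * Complex.log (mobius (-p) z), ?_, ?_⟩
  · have := norm_exp_I_mul (-Complex.I * Complex.log (mobius (-p) z))
    rw [h4] at this
    have h6 := norm_mobius_le_one hp' hz
    rw [this, Real.exp_le_one_iff] at h6
    linarith
  · rw [discCover, h4, mobius_mobius_neg hp hz]

end discCover

/-! ### Angles of the marked points -/

/-- The angles of the points of a finite subset of the circle, in their order. -/
theorem exists_angles {p : ℂ} (hp : ‖p‖ < 1) (S : Finset ℂ) (hS : ∀ z ∈ S, ‖z‖ = 1) {n : ℕ}
    (hn : S.card = n) (hn0 : 0 < n) : ∃ ang : ℤ → ℝ, StrictMono ang ∧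
      (∀ j, ang (j + n) = ang j + 2 * Real.pi) ∧
      ∀ x : ℝ, discCover p x ∈ S ↔ ∃ j, x = ang j := by
  classical
  have hpi := Real.two_pi_pos
  have h1 : ∀ z : ℂ, ‖z‖ = 1 → ∃ x : ℝ, x ∈ Set.Ico 0 (2 * Real.pi) ∧ discCover p x = z := by
    intro z hz
    obtain ⟨w, h1, h2⟩ := exists_discCover_eq hp hz.le (by rintro rfl; exact hp.ne hz)
    have h3 := (norm_discCover_eq_one_iff hp h1).1 (h2 ▸ hz)
    have h4 : w = (w.re : ℂ) := Complex.ext rfl (by simpa using h3)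
    refine ⟨toIcoMod hpi 0 w.re, by simpa using toIcoMod_mem_Ico hpi 0 w.re, ?_⟩
    rw [← h2, toIcoMod, h4]
    have := discCover_add (p := p) (w := (w.re : ℂ)) (-toIcoDiv hpi 0 w.re)
    rw [← this]
    congr 1
    simp only [zsmul_eq_mul, Complex.ofReal_re]
    push_cast
    ring
  choose! θ hθ1 hθ2 using h1
  have hinj : Set.InjOn θ S := fun a ha b hb h => by
    rw [← hθ2 a (hS a ha), h, hθ2 b (hS b hb)]
  have hcard : (S.image θ).card = n := by rw [Finset.card_image_of_injOn hinj, hn]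
  let e := (S.image θ).orderEmbOfFin hcard
  have hmem : ∀ i, e i ∈ S.image θ := fun i => Finset.orderEmbOfFin_mem _ _ _
  have he : ∀ i, e i ∈ Set.Ico 0 (2 * Real.pi) := fun i => by
    obtain ⟨z, hz, h⟩ := Finset.mem_image.1 (hmem i)
    rw [← h]; exact hθ1 z (hS z hz)
  have hnz : (0 : ℤ) < n := by exact_mod_cast hn0
  let r : ℤ → Fin n := fun j => ⟨(j % n).toNat, by
    have := Int.emod_lt_of_pos j hnz
    have := Int.emod_nonneg j hnz.ne'
    omega⟩
  -- The angles in [0, 2π) are continued periodically: the residue of j picks the point and the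
  -- quotient counts full turns.
  let ang : ℤ → ℝ := fun j => e (r j) + (j / n : ℤ) * (2 * Real.pi)
  refine ⟨ang, strictMono_int_of_lt_succ fun j => ?_, fun j => ?_, fun x => ⟨fun h => ?_, ?_⟩⟩
  · have h2 := Int.emod_lt_of_pos j hnz
    have h3 := Int.emod_nonneg j hnz.ne'
    have h4 := Int.mul_ediv_add_emod j n
    by_cases h : j % n + 1 < n
    · have e1 : (j + 1) / n = j / n ∧ (j + 1) % n = j % n + 1 :=
        (Int.ediv_emod_unique hnz).2 ⟨by linarith, by omega, h⟩
      have e2 : r j < r (j + 1) := by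
        rw [Fin.lt_def]
        simp only [r, e1.2]
        omega
      have := e.strictMono e2
      simp only [ang, e1.1]
      linarith
    · have e1 : (j + 1) / n = j / n + 1 ∧ (j + 1) % n = 0 :=
        (Int.ediv_emod_unique hnz).2 ⟨by rw [mul_add]; omega, le_rfl, hnz⟩
      simp only [ang, e1.1]
      have := (he (r j)).2
      have := (he (r (j + 1))).1
      push_cast
      linarith
  · have e1 : r (j + n) = r j := by simp [r]
    simp only [ang, e1, Int.add_ediv_of_dvd_right (dvd_refl (n : ℤ)), Int.ediv_self hnz.ne']
    push_cast
    ring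
  · have h2 : θ (discCover p x) ∈ S.image θ := Finset.mem_image_of_mem _ h
    rw [← Finset.mem_coe, ← Finset.range_orderEmbOfFin _ hcard] at h2
    obtain ⟨i, hi⟩ := h2
    have h3 := hθ2 _ (hS _ h)
    obtain ⟨t, ht⟩ := (discCover_eq_iff hp (by simp) (by simp)).1 h3.symm
    refine ⟨i + n * t, ?_⟩
    have hi' : ((i : ℕ) : ℤ) < n := by exact_mod_cast i.2
    have e1 : ((i : ℕ) + n * t : ℤ) / n = t ∧ ((i : ℕ) + n * t : ℤ) % n = (i : ℕ) :=
      (Int.ediv_emod_unique hnz).2 ⟨by ring, by omega, hi'⟩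
    have e2 : r (i + n * t) = i := by
      apply Fin.ext
      simp only [r, e1.2]
      simp
    simp only [ang, e1.1, e2]
    change e i = _ at hi
    rw [hi]
    exact_mod_cast ht
  · rintro ⟨j, rfl⟩
    obtain ⟨z, hz, h⟩ := Finset.mem_image.1 (hmem (r j))
    have h2 := discCover_add (p := p) (w := (e (r j) : ℂ)) (j / n)
    have h3 : discCover p (ang j) = z := by
      rw [← hθ2 z (hS z hz), h, ← h2]
      simp only [ang]
      push_cast
      rfl
    rw [h3]; exact hz

namespace MarkedDisc

variable {X : MarkedDisc}

/-! ### Homotopies -/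

theorem Homotopic.of_square {f g : C(I, ℂ)} (hf : X.IsPathBetween (f 0) (f 1) f)
    (hg : X.IsPathBetween (g 0) (g 1) g) (H : C(I × I, ℂ)) (h0 : ∀ t, H (0, t) = f t)
    (h1 : ∀ t, H (1, t) = g t) (hl : ∀ s, H (s, 0) = f 0) (hr : ∀ s, H (s, 1) = f 1)
    (hn : ∀ s t, ‖H (s, t)‖ ≤ 1)
    (hv : ∀ s t, 0 < s → s < 1 → 0 < t → t < 1 → H (s, t) ∉ X.vertices) : X.Homotopic f g := by
  refine ⟨⟨⟨H, h0, h1⟩, fun s => ⟨hf.1, hf.2.1, hl s, hr s, hn s, fun t ht ht' => ?_⟩⟩⟩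
  change H (s, t) ∉ X.vertices
  rcases eq_or_ne s 0 with rfl | hs0
  · rw [h0]; exact hf.2.2.2.2.2 t ht ht'
  rcases eq_or_ne s 1 with rfl | hs1
  · rw [h1]; exact hg.2.2.2.2.2 t ht ht'
  exact hv s t (unitInterval.pos_iff_ne_zero.2 hs0) (unitInterval.lt_one_iff_ne_one.2 hs1) ht ht'

theorem Homotopic.exists_square {f g : C(I, ℂ)} (h : X.Homotopic f g) :
    ∃ H : C(I × I, ℂ), (∀ t, H (0, t) = f t) ∧ (∀ t, H (1, t) = g t) ∧
      (∀ s, H (s, 0) = f 0) ∧ (∀ s, H (s, 1) = f 1) ∧ (∀ s t, ‖H (s, t)‖ ≤ 1) ∧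
      ∀ s t, 0 < t → t < 1 → H (s, t) ∉ X.vertices := by
  obtain ⟨F⟩ := h
  refine ⟨F.toContinuousMap, fun t => F.apply_zero t, fun t => F.apply_one t,
    fun s => (F.prop s).2.2.1, fun s => (F.prop s).2.2.2.1, fun s t => (F.prop s).2.2.2.2.1 t,
    fun s t ht ht' => (F.prop s).2.2.2.2.2 t ht ht'⟩

/-- Coordinates on a disc: a point that is the puncture, if there is one, and the angles of the
marked points as seen from it. -/
structure Chart (X : MarkedDisc) where
  /-- the center -/
  p : ℂ
  norm_p : ‖p‖ < 1
  puncture : ∀ z ∈ X.punctures, z = p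
  /-- the angles -/
  ang : ℤ → ℝ
  strictMono : StrictMono ang
  ang_add_card : ∀ j, ang (j + (X.marked.card : ℤ)) = ang j + 2 * Real.pi
  mem_marked : ∀ x : ℝ, discCover p x ∈ X.marked ↔ ∃ j, x = ang j

theorem exists_chart {p : ℂ} (hp : ‖p‖ < 1) (h : ∀ z ∈ X.punctures, z = p) :
    ∃ C : Chart X, C.p = p := by
  obtain ⟨ang, h1, h2, h3⟩ := exists_angles hp X.marked X.norm_marked rfl
    (by have := X.four_le_card_marked; omega)
  exact ⟨⟨p, hp, h, ang, h1, h2, h3⟩, rfl⟩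

namespace Chart

variable (C : Chart X)

/-- The number of marked points. -/
def n (_ : Chart X) : ℤ := X.marked.card

theorem four_le : 4 ≤ C.n := by
  have := X.four_le_card_marked
  unfold n
  omega

theorem n_pos : 0 < C.n := by have := C.four_le; omega

theorem ang_add (j : ℤ) : C.ang (j + C.n) = C.ang j + 2 * Real.pi := C.ang_add_card j

theorem ang_add_mul (j t : ℤ) : C.ang (j + t * C.n) = C.ang j + t * (2 * Real.pi) := by
  induction t using Int.induction_on with
  | zero => simp
  | succ t ih =>
    rw [add_mul, one_mul, ← add_assoc, C.ang_add, ih]; push_cast; ring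
  | pred t ih =>
    have := C.ang_add (j + (-t - 1) * C.n)
    rw [show j + (-t - 1) * C.n + C.n = j + -t * C.n by ring, ih] at this
    push_cast at *
    linarith

theorem ang_lt_iff {j k : ℤ} : C.ang j < C.ang k ↔ j < k := C.strictMono.lt_iff_lt

theorem ang_inj {j k : ℤ} : C.ang j = C.ang k ↔ j = k := C.strictMono.injective.eq_iff

/-- The marked points. -/
def pt (j : ℤ) : ℂ := discCover C.p (C.ang j)

theorem pt_mem (j : ℤ) : C.pt j ∈ X.marked := (C.mem_marked _).2 ⟨j, rfl⟩

theorem pt_mem_vertices (j : ℤ) : C.pt j ∈ X.vertices := Or.inl (C.pt_mem j)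

theorem pt_ne_p (j : ℤ) : C.pt j ≠ C.p := discCover_ne C.norm_p (by simp)

theorem p_not_mem : C.p ∉ X.marked := fun h => C.norm_p.ne (X.norm_marked _ h)

theorem pt_eq_iff {j k : ℤ} : C.pt j = C.pt k ↔ ∃ t : ℤ, j = k + t * C.n := by
  rw [pt, pt, discCover_eq_iff C.norm_p (by simp) (by simp)]
  refine exists_congr fun t => ?_
  rw [← C.ang_inj, C.ang_add_mul]
  exact_mod_cast Iff.rfl

theorem exists_of_real {w : ℂ} (hw : 0 ≤ w.im) (h : discCover C.p w ∈ X.marked) :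
    ∃ j, w = C.ang j := by
  have h1 := (norm_discCover_eq_one_iff C.norm_p hw).1 (X.norm_marked _ h)
  have h2 : w = (w.re : ℂ) := Complex.ext rfl (by simpa using h1)
  rw [h2] at h ⊢
  obtain ⟨j, hj⟩ := (C.mem_marked _).1 h
  exact ⟨j, by rw [hj]⟩

theorem exists_pt {z : ℂ} (hz : z ∈ X.marked) : ∃ j, (0 ≤ j ∧ j < C.n) ∧ C.pt j = z := by
  have h1 := X.norm_marked z hz
  obtain ⟨w, h2, h3⟩ := exists_discCover_eq C.norm_p h1.le
    (by rintro rfl; exact C.norm_p.ne h1)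
  obtain ⟨j, hj⟩ := C.exists_of_real h2 (h3 ▸ hz)
  obtain ⟨q, r, e1, e2, e3, -⟩ := CombArc.exists_quotient C.n_pos 0 j
  refine ⟨r, ⟨e2, e3⟩, ?_⟩
  rw [← h3, hj]
  exact C.pt_eq_iff.2 ⟨-q, by rw [e1]; ring⟩

theorem not_mem_vertices {z : ℂ} (hz : ‖z‖ < 1) (hp : z ≠ C.p) : z ∉ X.vertices := by
  rintro (h | h)
  · exact hz.ne (X.norm_marked z h)
  · exact hp (C.puncture z h)

/-- `w` is a lift of `f` from the vertex `i` to the vertex `k`. -/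
structure IsLift (w f : C(I, ℂ)) (i k : ℤ) : Prop where
  im_nonneg : ∀ t, 0 ≤ (w t).im
  cover_eq : ∀ t, discCover C.p (w t) = f t
  zero : w 0 = C.ang i
  one : w 1 = C.ang k

/-- Some lift of `f` runs from the vertex `i` to the vertex `k`. -/
def HasLift (f : C(I, ℂ)) (i k : ℤ) : Prop := ∃ w, C.IsLift w f i k

variable {C}
variable {f g w : C(I, ℂ)} {i k : ℤ}

theorem IsLift.apply_zero (h : C.IsLift w f i k) : f 0 = C.pt i := by
  rw [← h.cover_eq, h.zero]; rfl

theorem IsLift.apply_one (h : C.IsLift w f i k) : f 1 = C.pt k := by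
  rw [← h.cover_eq, h.one]; rfl

theorem IsLift.shift (h : C.IsLift w f i k) (t : ℤ) :
    C.IsLift ⟨fun s => w s + t * (2 * Real.pi), by fun_prop⟩ f (i + t * C.n) (k + t * C.n) := by
  refine ⟨fun s => ?_, fun s => ?_, ?_, ?_⟩
  · simpa using h.im_nonneg s
  · exact (discCover_add t).trans (h.cover_eq s)
  · simp [h.zero, C.ang_add_mul]
  · simp [h.one, C.ang_add_mul]

theorem HasLift.shift (h : C.HasLift f i k) (t : ℤ) :
    C.HasLift f (i + t * C.n) (k + t * C.n) := by
  obtain ⟨w, hw⟩ := h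
  exact ⟨_, hw.shift t⟩

theorem HasLift.reverse (h : C.HasLift f i k) : C.HasLift (reverseMap f) k i := by
  obtain ⟨w, hw⟩ := h
  exact ⟨reverseMap w, fun t => hw.im_nonneg _, fun t => hw.cover_eq _, by simp [hw.one],
    by simp [hw.zero]⟩

theorem HasLift.apply_zero (h : C.HasLift f i k) : f 0 = C.pt i := h.choose_spec.apply_zero

theorem HasLift.apply_one (h : C.HasLift f i k) : f 1 = C.pt k := h.choose_spec.apply_one

/-- After a deck transformation the lifts start at the same point, and hence agree at the end. -/
theorem HasLift.unique (h : C.HasLift f i k) {i' k' : ℤ} (h' : C.HasLift f i' k') :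
    ∃ t : ℤ, i' = i + t * C.n ∧ k' = k + t * C.n := by
  obtain ⟨t, ht⟩ := C.pt_eq_iff.1 (h'.apply_zero.symm.trans h.apply_zero)
  obtain ⟨w, hw⟩ := h.shift t
  obtain ⟨w', hw'⟩ := h'
  have h1 := lift_unique C.norm_p w.continuous w'.continuous hw.im_nonneg hw'.im_nonneg
    (fun s => (hw.cover_eq s).trans (hw'.cover_eq s).symm) 0 1
  rw [hw.zero, hw'.zero, hw.one, hw'.one, ht, sub_self] at h1
  have h2 : C.ang (k + t * C.n) = C.ang k' := by
    have := sub_eq_zero.1 h1.symm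
    exact_mod_cast this
  exact ⟨t, ht, (C.ang_inj.1 h2).symm⟩

theorem exists_hasLift (hp : C.p ∈ X.punctures) {x y : ℂ} (hx : x ∈ X.marked) (hy : y ∈ X.marked)
    (hf : X.IsPathBetween x y f) : ∃ i k, C.HasLift f i k := by
  obtain ⟨-, -, h0, h1, hn, hv⟩ := hf
  obtain ⟨i, -, hi⟩ := C.exists_pt hx
  have hfp : ∀ t, f t ≠ C.p := by
    intro t ht
    rcases eq_or_ne t 0 with rfl | ht0
    · exact C.pt_ne_p i (by rw [hi, ← h0, ht])
    rcases eq_or_ne t 1 with rfl | ht1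
    · exact C.p_not_mem (by rw [← ht, h1]; exact hy)
    · exact hv t (unitInterval.pos_iff_ne_zero.2 ht0) (unitInterval.lt_one_iff_ne_one.2 ht1)
        (Or.inr (ht ▸ hp))
  obtain ⟨w, w0, w1, w2⟩ := exists_lift_path (w := C.ang i) C.norm_p f hn hfp (by simp)
    (by rw [h0]; exact hi)
  obtain ⟨k, hk⟩ := C.exists_of_real (w1 1) (by rw [w2, h1]; exact hy)
  exact ⟨i, k, w, w1, w2, w0, hk⟩

/-- Interpolation between two paths in the upper half plane, pushed upwards. -/
def interpolate (u v : C(I, ℂ)) : C(I × I, ℂ) :=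
  ⟨fun z => (1 - (z.1 : ℝ)) * u z.2 + (z.1 : ℝ) * v z.2
    + Complex.I * ((z.1 : ℝ) * (1 - (z.1 : ℝ)) * ((z.2 : ℝ) * (1 - (z.2 : ℝ)))), by fun_prop⟩

theorem interpolate_im (u v : C(I, ℂ)) (s t : I) : (interpolate u v (s, t)).im =
    (1 - (s : ℝ)) * (u t).im + (s : ℝ) * (v t).im
      + (s : ℝ) * (1 - (s : ℝ)) * ((t : ℝ) * (1 - (t : ℝ))) := by
  simp [interpolate, ← Complex.ofReal_one, ← Complex.ofReal_sub, ← Complex.ofReal_mul]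

theorem interpolate_im_nonneg {u v : C(I, ℂ)} (hu : ∀ t, 0 ≤ (u t).im) (hv : ∀ t, 0 ≤ (v t).im)
    (s t : I) : 0 ≤ (interpolate u v (s, t)).im := by
  rw [interpolate_im]
  have h1 := unitInterval.one_minus_nonneg s
  have h2 := unitInterval.one_minus_nonneg t
  have h3 := s.2.1
  have h4 := t.2.1
  have := hu t
  have := hv t
  positivity

theorem interpolate_im_pos {u v : C(I, ℂ)} (hu : ∀ t, 0 ≤ (u t).im) (hv : ∀ t, 0 ≤ (v t).im)
    {s t : I} (hs : 0 < s) (hs' : s < 1) (ht : 0 < t) (ht' : t < 1) :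
    0 < (interpolate u v (s, t)).im := by
  rw [interpolate_im]
  have h1 : 0 < 1 - (s : ℝ) := sub_pos.2 hs'
  have h2 : 0 < 1 - (t : ℝ) := sub_pos.2 ht'
  have h3 : 0 < (s : ℝ) := hs
  have h4 : 0 < (t : ℝ) := ht
  have := hu t
  have := hv t
  positivity

/-- The image of the interpolation in the disc. -/
def interpolateCover (C : Chart X) {u v : C(I, ℂ)} (hu : ∀ t, 0 ≤ (u t).im)
    (hv : ∀ t, 0 ≤ (v t).im) : C(I × I, ℂ) :=
  ⟨fun z => discCover C.p (interpolate u v z), continuous_discCover C.norm_p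
    (interpolate u v).continuous fun z => interpolate_im_nonneg hu hv z.1 z.2⟩

/-- The lifts are joined by interpolation in the convex half-plane. The upward push keeps the
intermediate paths off the real line at interior times, so no marked point is met, and the covering
map omits the center. -/
theorem homotopic_of_hasLift (hf : X.IsPathBetween (f 0) (f 1) f)
    (hg : X.IsPathBetween (g 0) (g 1) g) (h : C.HasLift f i k) (h' : C.HasLift g i k) :
    X.Homotopic f g := by
  obtain ⟨u, hu⟩ := h
  obtain ⟨v, hv⟩ := h'
  refine Homotopic.of_square hf hg (C.interpolateCover hu.im_nonneg hv.im_nonneg)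
    (fun t => ?_) (fun t => ?_) (fun s => ?_) (fun s => ?_) (fun s t => ?_)
    fun s t hs hs' ht ht' => ?_
  · rw [← hu.cover_eq]; simp [interpolateCover, interpolate]
  · rw [← hv.cover_eq]; simp [interpolateCover, interpolate]
  · rw [← hu.cover_eq]
    simp only [interpolateCover, interpolate, ContinuousMap.coe_mk, hu.zero, hv.zero]
    congr 1
    simp
    ring
  · rw [← hu.cover_eq]
    simp only [interpolateCover, interpolate, ContinuousMap.coe_mk, hu.one, hv.one]
    congr 1
    simp
    ring
  · exact norm_discCover_le_one C.norm_p (interpolate_im_nonneg hu.im_nonneg hv.im_nonneg s t)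
  · have := interpolate_im_pos hu.im_nonneg hv.im_nonneg hs hs' ht ht'
    exact C.not_mem_vertices (norm_discCover_lt_one C.norm_p this) (discCover_ne C.norm_p this.le)

theorem nullHomotopic_of_hasLift (hf : X.IsPathBetween (f 0) (f 1) f) (h : C.HasLift f i i) :
    X.NullHomotopic f := by
  obtain ⟨u, hu⟩ := h
  have hv : ∀ t, 0 ≤ ((ContinuousMap.const I (C.ang i : ℂ)) t).im := fun t => by simp
  refine ⟨C.interpolateCover hu.im_nonneg hv, fun t => ?_, fun t => ?_, fun s => ⟨?_, ?_⟩,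
    fun s t => ?_, fun s t hs ht ht' => ?_⟩
  · rw [← hu.cover_eq]; simp [interpolateCover, interpolate]
  · rw [← hu.cover_eq]; simp [interpolateCover, interpolate, hu.zero]
  · rw [← hu.cover_eq]
    simp only [interpolateCover, interpolate, ContinuousMap.coe_mk, hu.zero,
      ContinuousMap.const_apply]
    congr 1
    simp
    ring
  · rw [← hu.cover_eq 0]
    simp only [interpolateCover, interpolate, ContinuousMap.coe_mk, hu.one, hu.zero,
      ContinuousMap.const_apply]
    congr 1
    simp
    ring
  · exact norm_discCover_le_one C.norm_p (interpolate_im_nonneg hu.im_nonneg hv s t)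
  · rcases eq_or_ne s 0 with rfl | hs0
    · have := hf.2.2.2.2.2 t ht ht'
      rw [← hu.cover_eq] at this
      simpa [interpolateCover, interpolate] using this
    have := interpolate_im_pos hu.im_nonneg hv (unitInterval.pos_iff_ne_zero.2 hs0) hs ht ht'
    exact C.not_mem_vertices (norm_discCover_lt_one C.norm_p this) (discCover_ne C.norm_p this.le)

/-- The homotopy avoids the puncture and lifts to the half-plane; its endpoints stay fixed, hence so
do their lifts. -/
theorem HasLift.of_homotopic (hp : C.p ∈ X.punctures) (h : C.HasLift f i k)
    (hfg : X.Homotopic f g) : C.HasLift g i k := by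
  obtain ⟨H, H0, H1, Hl, Hr, Hn, Hv⟩ := hfg.exists_square
  obtain ⟨w, hw⟩ := h
  have hne : ∀ z, H z ≠ C.p := by
    rintro ⟨s, t⟩ hz
    rcases eq_or_ne t 0 with rfl | ht0
    · exact C.pt_ne_p i (by rw [← hw.apply_zero, ← Hl s, hz])
    rcases eq_or_ne t 1 with rfl | ht1
    · exact C.pt_ne_p k (by rw [← hw.apply_one, ← Hr s, hz])
    · exact Hv s t (unitInterval.pos_iff_ne_zero.2 ht0) (unitInterval.lt_one_iff_ne_one.2 ht1)
        (Or.inr (hz ▸ hp))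
  obtain ⟨K, k0, k1, k2⟩ := exists_lift_square C.norm_p H (fun z => Hn z.1 z.2) hne
    (w := w 0) (hw.im_nonneg 0) (by rw [hw.cover_eq, H0])
  have e1 := lift_unique (p := C.p) C.norm_p (u := fun t : I => K (0, t)) (v := w)
    (by fun_prop) (by fun_prop) (fun t => k1 _) hw.im_nonneg
    (fun t => by rw [k2, hw.cover_eq, H0]) 1 0
  have e2 := lift_unique (p := C.p) C.norm_p (u := fun s : I => K (s, 0)) (v := fun _ => w 0)
    (by fun_prop) (by fun_prop) (fun s => k1 _) (fun _ => hw.im_nonneg _)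
    (fun t => by rw [k2, hw.cover_eq, Hl]) 1 0
  have e3 := lift_unique (p := C.p) C.norm_p (u := fun s : I => K (s, 1)) (v := fun _ => w 1)
    (by fun_prop) (by fun_prop) (fun s => k1 _) (fun _ => hw.im_nonneg _)
    (fun t => by rw [k2, hw.cover_eq, Hr]) 1 0
  refine ⟨⟨fun t => K (1, t), by fun_prop⟩, fun t => k1 _, fun t => (k2 _).trans (H1 t), ?_, ?_⟩
  · simp only [ContinuousMap.coe_mk]
    rw [← hw.zero]
    linear_combination e2 + k0
  · simp only [ContinuousMap.coe_mk]
    rw [← hw.one]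
    linear_combination e3 + e1 + k0

end Chart

end MarkedDisc

namespace MarkedDisc

variable {X : MarkedDisc}

theorem IsPathBetween.eq_zero_or_one {x y : ℂ} {f : C(I, ℂ)} (hf : X.IsPathBetween x y f) {t : I}
    (ht : f t ∈ X.vertices) : t = 0 ∨ t = 1 := by
  by_contra h
  rw [not_or] at h
  exact hf.2.2.2.2.2 t (unitInterval.pos_iff_ne_zero.2 h.1) (unitInterval.lt_one_iff_ne_one.2 h.2) ht

theorem not_nullHomotopic_of_ne {f : C(I, ℂ)} (h : f 0 ≠ f 1) : ¬ X.NullHomotopic f := by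
  rintro ⟨H, h0, -, h2, -⟩
  exact h (by rw [← h0 1, (h2 0).2])

namespace Chart

variable {C : Chart X} {f g u v w : C(I, ℂ)} {i k a b : ℤ}

/-! ### Boundary segments -/

/-- A path in the upper half plane, pushed to the disc. -/
def push (C : Chart X) (w : C(I, ℂ)) (hw : ∀ t, 0 ≤ (w t).im) : C(I, ℂ) :=
  ⟨fun t => discCover C.p (w t), continuous_discCover C.norm_p w.continuous hw⟩

theorem isLift_push (hw : ∀ t, 0 ≤ (w t).im) (h0 : w 0 = C.ang i) (h1 : w 1 = C.ang k) :
    C.IsLift w (C.push w hw) i k := ⟨hw, fun _ => rfl, h0, h1⟩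

theorem isPath_push (hw : ∀ t, 0 ≤ (w t).im) (h0 : w 0 = C.ang i) (h1 : w 1 = C.ang k)
    (h : ∀ t, 0 < t → t < 1 → ∀ j, w t ≠ C.ang j) :
    X.IsPathBetween (C.push w hw 0) (C.push w hw 1) (C.push w hw) := by
  have hl := C.isLift_push hw h0 h1
  refine ⟨hl.apply_zero ▸ C.pt_mem_vertices i, hl.apply_one ▸ C.pt_mem_vertices k, rfl, rfl,
    fun t => norm_discCover_le_one C.norm_p (hw t), fun t ht ht' => ?_⟩
  rintro (hm | hm)
  · obtain ⟨j, hj⟩ := C.exists_of_real (hw t) hm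
    exact h t ht ht' j hj
  · exact discCover_ne C.norm_p (hw t) (C.puncture _ hm)

/-- The line segment between the angles of two consecutive vertices. -/
def sideLift (C : Chart X) (i : ℤ) : C(I, ℂ) :=
  ⟨fun t => ((C.ang i + (t : ℝ) * (C.ang (i + 1) - C.ang i) : ℝ) : ℂ), by fun_prop⟩

theorem exists_isBoundarySegment (C : Chart X) (i : ℤ) :
    ∃ g, X.IsBoundarySegment g ∧ C.HasLift g i (i + 1) := by
  have hw : ∀ t, 0 ≤ (C.sideLift i t).im := fun t => by simp [sideLift]
  have h0 : C.sideLift i 0 = C.ang i := by simp [sideLift]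
  have h1 : C.sideLift i 1 = C.ang (i + 1) := by simp [sideLift]
  have h2 : C.ang i < C.ang (i + 1) := C.ang_lt_iff.2 (by omega)
  have h3 : C.ang (i + 1) < C.ang i + 2 * Real.pi := by
    rw [← C.ang_add, C.ang_lt_iff]; have := C.four_le; omega
  refine ⟨C.push _ hw, ⟨fun s t hst => ?_, fun t => ?_, C.isPath_push hw h0 h1 ?_⟩,
    _, C.isLift_push hw h0 h1⟩
  · obtain ⟨m, hm⟩ := (discCover_eq_iff C.norm_p (hw s) (hw t)).1 hst
    simp only [sideLift, ContinuousMap.coe_mk] at hm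
    have hm' : C.ang i + (s : ℝ) * (C.ang (i + 1) - C.ang i) =
        C.ang i + (t : ℝ) * (C.ang (i + 1) - C.ang i) + m * (2 * Real.pi) := by exact_mod_cast hm
    have hm0 : m = 0 := by
      by_contra hm0
      have : (1 : ℝ) ≤ |(m : ℝ)| := by exact_mod_cast Int.one_le_abs hm0
      have e1 : ((s : ℝ) - t) * (C.ang (i + 1) - C.ang i) = m * (2 * Real.pi) := by linarith
      have e2 := congrArg abs e1
      rw [abs_mul, abs_mul, abs_of_pos (sub_pos.2 h2), abs_of_pos Real.two_pi_pos] at e2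
      have e3 : |(s : ℝ) - t| ≤ 1 := abs_le.2
        ⟨by linarith [s.2.1, t.2.2], by linarith [s.2.2, t.2.1]⟩
      nlinarith [Real.two_pi_pos]
    rw [hm0] at hm'
    have : ((s : ℝ) - t) * (C.ang (i + 1) - C.ang i) = 0 := by push_cast at hm'; linarith
    rcases mul_eq_zero.1 this with h | h
    · exact Subtype.ext (sub_eq_zero.1 h)
    · linarith
  · exact (norm_discCover_eq_one_iff C.norm_p (hw t)).2 (by simp [sideLift])
  · intro t ht ht' j hj
    simp only [sideLift, ContinuousMap.coe_mk, Complex.ofReal_inj] at hj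
    have ht1 : 0 < (t : ℝ) := ht
    have ht2 : (t : ℝ) < 1 := ht'
    have h4 : C.ang i < C.ang j := by rw [← hj]; nlinarith
    have h5 : C.ang j < C.ang (i + 1) := by rw [← hj]; nlinarith
    rw [C.ang_lt_iff] at h4 h5
    omega

/-- A lift of a path can only reach real vertices at its ends. -/
theorem IsLift.eq_zero_or_one {x y : ℂ} (h : C.IsLift w f i k) (hf : X.IsPathBetween x y f) {t : I}
    {j : ℤ} (ht : w t = C.ang j) : t = 0 ∧ j = i ∨ t = 1 ∧ j = k := by
  have h1 : f t ∈ X.vertices := by rw [← h.cover_eq, ht]; exact C.pt_mem_vertices j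
  rcases hf.eq_zero_or_one h1 with rfl | rfl
  · rw [h.zero, Complex.ofReal_inj, C.ang_inj] at ht; exact Or.inl ⟨rfl, ht.symm⟩
  · rw [h.one, Complex.ofReal_inj, C.ang_inj] at ht; exact Or.inr ⟨rfl, ht.symm⟩

/-- The lift is real, and by the intermediate value theorem it would reach i + 1 or i - 1 at an
interior time before getting farther. -/
theorem exists_hasLift_of_isBoundarySegment (hg : X.IsBoundarySegment g) (h0 : g 0 = C.pt i) :
    ∃ k, C.HasLift g i k ∧ k ≤ i + 1 ∧ i ≤ k + 1 := by
  obtain ⟨-, hn, hp⟩ := hg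
  obtain ⟨w, w0, w1, w2⟩ := exists_lift_path (w := C.ang i) C.norm_p g (fun t => (hn t).le)
    (fun t h => C.norm_p.ne (h ▸ hn t)) (by simp) (by rw [h0]; rfl)
  have hreal : ∀ t, w t = ((w t).re : ℂ) := fun t => Complex.ext rfl (by
    simpa using (norm_discCover_eq_one_iff C.norm_p (w1 t)).1 (by rw [w2, hn]))
  have hm : g 1 ∈ X.marked := by
    rcases hp.2.1 with h | h
    · exact h
    · exact absurd (hn 1) (by rw [C.puncture _ h]; exact C.norm_p.ne)
  obtain ⟨k, hk⟩ := C.exists_of_real (w1 1) (by rw [w2]; exact hm)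
  have hl : C.IsLift w g i k := ⟨w1, w2, w0, hk⟩
  have hcont : Continuous fun t => (w t).re := by fun_prop
  have hr0 : (w 0).re = C.ang i := by rw [w0]; rfl
  have hr1 : (w 1).re = C.ang k := by rw [hk]; rfl
  refine ⟨k, ⟨w, hl⟩, ?_, ?_⟩
  · by_contra hlt
    obtain ⟨t, ht⟩ := mem_range_of_exists_le_of_exists_ge hcont (c := C.ang (i + 1))
      ⟨0, by rw [hr0, C.strictMono.le_iff_le]; omega⟩
      ⟨1, by rw [hr1, C.strictMono.le_iff_le]; omega⟩
    have := hl.eq_zero_or_one hp (t := t) (j := i + 1) (by rw [hreal t]; exact congrArg _ ht)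
    omega
  · by_contra hlt
    obtain ⟨t, ht⟩ := mem_range_of_exists_le_of_exists_ge hcont (c := C.ang (i - 1))
      ⟨1, by rw [hr1, C.strictMono.le_iff_le]; omega⟩
      ⟨0, by rw [hr0, C.strictMono.le_iff_le]; omega⟩
    have := hl.eq_zero_or_one hp (t := t) (j := i - 1) (by rw [hreal t]; exact congrArg _ ht)
    omega

/-! ### Meeting points -/

end Chart

/-- The pairs of interior times at which two paths meet. -/
def meets (f g : C(I, ℂ)) : Set (I × I) :=
  {p | 0 < p.1 ∧ p.1 < 1 ∧ 0 < p.2 ∧ p.2 < 1 ∧ f p.1 = g p.2}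

theorem symm_interior {t : I} (h : 0 < t ∧ t < 1) : 0 < σ t ∧ σ t < 1 :=
  ⟨unitInterval.pos_iff_ne_zero.2 fun h' => h.2.ne (by simpa using congrArg σ h'),
    unitInterval.lt_one_iff_ne_one.2 fun h' => h.1.ne' (by simpa using congrArg σ h')⟩

theorem meets_reverse_left (f g : C(I, ℂ)) :
    (meets (reverseMap f) g).encard ≤ (meets f g).encard := by
  refine Set.encard_le_encard_of_injOn (f := fun p : I × I => (σ p.1, p.2)) ?_ ?_
  · rintro p ⟨h1, h2, h3, h4, h5⟩
    exact ⟨(symm_interior ⟨h1, h2⟩).1, (symm_interior ⟨h1, h2⟩).2, h3, h4, h5⟩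
  · rintro p - q - h
    simp only [Prod.mk.injEq] at h
    exact Prod.ext (unitInterval.symm_bijective.injective h.1) h.2

theorem meets_swap (f g : C(I, ℂ)) : (meets f g).encard ≤ (meets g f).encard := by
  refine Set.encard_le_encard_of_injOn (f := Prod.swap) ?_ (Prod.swap_injective.injOn)
  rintro p ⟨h1, h2, h3, h4, h5⟩
  exact ⟨h3, h4, h1, h2, h5.symm⟩

theorem meets_reverse_right (f g : C(I, ℂ)) :
    (meets f (reverseMap g)).encard ≤ (meets f g).encard :=
  (meets_swap _ _).trans ((meets_reverse_left _ _).trans (meets_swap _ _))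

namespace Chart

variable {C : Chart X} {f g u v w : C(I, ℂ)} {i k a b : ℤ}

theorem exists_meet {x y x' y' : ℂ} (hf : X.IsPathBetween x y f) (hg : X.IsPathBetween x' y' g)
    (hu : C.IsLift u f i k) (hv : C.IsLift v g a b) (h : Interleave i k a b) :
    ∃ s t, (s, t) ∈ meets f g ∧ u s = v t := by
  obtain ⟨s, t, hst⟩ : ∃ s t, u s = v t := by
    rcases h with ⟨h1, h2, h3⟩ | ⟨h1, h2, h3⟩
    · exact exists_eq_of_interlaced hu.im_nonneg hv.im_nonneg hu.zero hu.one hv.zero hv.one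
        (C.ang_lt_iff.2 h1) (C.ang_lt_iff.2 h2) (C.ang_lt_iff.2 h3)
    · obtain ⟨t, s, h⟩ := exists_eq_of_interlaced hv.im_nonneg hu.im_nonneg hv.zero hv.one hu.zero
        hu.one (C.ang_lt_iff.2 h1) (C.ang_lt_iff.2 h2) (C.ang_lt_iff.2 h3)
      exact ⟨s, t, h.symm⟩
  have s0 : s ≠ 0 := by
    rintro rfl
    have := hv.eq_zero_or_one hg (hst.symm.trans hu.zero)
    unfold Interleave at h; omega
  have s1 : s ≠ 1 := by
    rintro rfl
    have := hv.eq_zero_or_one hg (hst.symm.trans hu.one)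
    unfold Interleave at h; omega
  have t0 : t ≠ 0 := by
    rintro rfl
    have := hu.eq_zero_or_one hf (hst.trans hv.zero)
    unfold Interleave at h; omega
  have t1 : t ≠ 1 := by
    rintro rfl
    have := hu.eq_zero_or_one hf (hst.trans hv.one)
    unfold Interleave at h; omega
  refine ⟨s, t, ⟨unitInterval.pos_iff_ne_zero.2 s0, unitInterval.lt_one_iff_ne_one.2 s1,
    unitInterval.pos_iff_ne_zero.2 t0, unitInterval.lt_one_iff_ne_one.2 t1, ?_⟩, hst⟩
  rw [← hu.cover_eq, ← hv.cover_eq, hst]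

/-- The lower bound for the number of intersections of two chords. -/
theorem encard_le_meets {x y x' y' : ℂ} (hf : X.IsPathBetween x y f)
    (hg : X.IsPathBetween x' y' g) (hu : C.HasLift f i k) (hv : C.HasLift g a b) :
    {t : ℤ | Interleave i k (a + t * C.n) (b + t * C.n)}.encard ≤
      (meets f g).encard := by
  obtain ⟨u, hu⟩ := hu
  obtain ⟨v, hv⟩ := hv
  have key : ∀ t : ℤ, Interleave i k (a + t * C.n) (b + t * C.n) →
      ∃ q, q ∈ meets f g ∧ u q.1 = v q.2 + t * (2 * Real.pi) := fun t ht => by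
    obtain ⟨s, t', h1, h2⟩ := exists_meet hf hg hu (hv.shift t) ht
    exact ⟨(s, t'), h1, h2⟩
  choose! F hF1 hF2 using key
  -- The translation t can be recovered from the meeting pair, since the two lifts differ there by
  -- exactly t full turns.
  refine Set.encard_le_encard_of_injOn (f := F) (fun t ht => hF1 t ht) fun t ht t' ht' h => ?_
  have h1 := hF2 t ht
  rw [h, hF2 t' ht'] at h1
  have h2 : ((t' : ℝ) : ℂ) * ((2 * Real.pi : ℝ) : ℂ) = ((t : ℝ) : ℂ) * ((2 * Real.pi : ℝ) : ℂ) := by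
    push_cast; linear_combination h1
  have h3 : (t' : ℝ) * (2 * Real.pi) = t * (2 * Real.pi) := by exact_mod_cast h2
  have h4 := mul_right_cancel₀ Real.two_pi_pos.ne' h3
  exact_mod_cast h4.symm

/-- If k > i + n, the lift and its translate by one turn are interlaced and meet. Simplicity makes
the two times equal, but then a point would equal its own translate. -/
theorem le_add_of_simple {x y : ℂ} (hf : X.IsPathBetween x y f) (hs : Set.InjOn f (Set.Ioo 0 1))
    (h : C.HasLift f i k) : k ≤ i + C.n := by
  by_contra hlt
  obtain ⟨u, hu⟩ := h
  obtain ⟨s, t, ⟨h1, h2, h3, h4, h5⟩, h6⟩ := exists_meet hf hf hu (hu.shift 1)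
    (Or.inl ⟨by have := C.n_pos; omega, by omega, by have := C.n_pos; omega⟩)
  have := hs ⟨h1, h2⟩ ⟨h3, h4⟩ h5
  simp only at this
  rw [this] at h6
  simp [Real.pi_ne_zero] at h6

/-! ### Parabolas -/

/-- The parabola of slope `κ` in the upper half plane that joins two vertices. -/
def parabola (C : Chart X) (κ : ℝ) (i k : ℤ) : C(I, ℂ) :=
  ⟨fun t => ((C.ang i + (t : ℝ) * (C.ang k - C.ang i) : ℝ) : ℂ) +
    ((κ * ((t : ℝ) * (C.ang k - C.ang i)) * ((1 - (t : ℝ)) * (C.ang k - C.ang i)) : ℝ) : ℂ)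
      * Complex.I, by fun_prop⟩

theorem parabola_re (κ : ℝ) (t : I) :
    (C.parabola κ i k t).re = C.ang i + (t : ℝ) * (C.ang k - C.ang i) := by
  simp only [parabola, ContinuousMap.coe_mk, Complex.add_re, Complex.ofReal_re, Complex.re_ofReal_mul,
    Complex.I_re, mul_zero, add_zero]

theorem parabola_im (κ : ℝ) (t : I) : (C.parabola κ i k t).im =
    κ * ((C.parabola κ i k t).re - C.ang i) * (C.ang k - (C.parabola κ i k t).re) := by
  rw [parabola_re]
  simp only [parabola, ContinuousMap.coe_mk, Complex.add_im, Complex.ofReal_im,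
    Complex.im_ofReal_mul, Complex.I_im, mul_one, zero_add]
  ring

theorem parabola_re_mem (hik : i < k) {t : I} (ht : 0 < t) (ht' : t < 1) (κ : ℝ) :
    C.ang i < (C.parabola κ i k t).re ∧ (C.parabola κ i k t).re < C.ang k := by
  have ht1 : 0 < (t : ℝ) := ht
  have ht2 : (t : ℝ) < 1 := ht'
  have h : C.ang i < C.ang k := C.ang_lt_iff.2 hik
  rw [parabola_re]
  constructor <;> nlinarith

theorem parabola_inj (hik : i < k) {κ : ℝ} {s t : I}
    (h : (C.parabola κ i k s).re = (C.parabola κ i k t).re) : s = t := by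
  have h1 : C.ang i < C.ang k := C.ang_lt_iff.2 hik
  rw [parabola_re, parabola_re] at h
  have : ((s : ℝ) - t) * (C.ang k - C.ang i) = 0 := by linarith
  rcases mul_eq_zero.1 this with h2 | h2
  · exact Subtype.ext (sub_eq_zero.1 h2)
  · linarith

theorem parabola_im_nonneg {κ : ℝ} (hκ : 0 < κ) (t : I) : 0 ≤ (C.parabola κ i k t).im := by
  rw [parabola_im, parabola_re]
  have h1 := t.2.1
  have h2 := unitInterval.one_minus_nonneg t
  have e : κ * (C.ang i + (t : ℝ) * (C.ang k - C.ang i) - C.ang i) *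
      (C.ang k - (C.ang i + (t : ℝ) * (C.ang k - C.ang i))) =
      κ * ((t : ℝ) * (1 - t) * (C.ang k - C.ang i) ^ 2) := by ring
  rw [e]
  positivity

theorem parabola_im_pos {κ : ℝ} (hκ : 0 < κ) (hik : i < k) {t : I} (ht : 0 < t) (ht' : t < 1) :
    0 < (C.parabola κ i k t).im := by
  rw [parabola_im]
  obtain ⟨h1, h2⟩ := C.parabola_re_mem hik ht ht' κ
  exact mul_pos (mul_pos hκ (sub_pos.2 h1)) (sub_pos.2 h2)

/-- The path in the disc that is covered by a parabola. -/
def chordMap (C : Chart X) {κ : ℝ} (hκ : 0 < κ) (i k : ℤ) : C(I, ℂ) :=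
  C.push (C.parabola κ i k) (C.parabola_im_nonneg hκ)

variable {κ κ' : ℝ}

theorem isLift_chordMap (hκ : 0 < κ) : C.IsLift (C.parabola κ i k) (C.chordMap hκ i k) i k :=
  C.isLift_push _ (by simp [parabola]) (by simp [parabola])

theorem hasLift_chordMap (hκ : 0 < κ) : C.HasLift (C.chordMap hκ i k) i k := ⟨_, isLift_chordMap hκ⟩

theorem isPath_chordMap (hκ : 0 < κ) (hik : i < k) :
    X.IsPathBetween (C.chordMap hκ i k 0) (C.chordMap hκ i k 1) (C.chordMap hκ i k) := by
  refine C.isPath_push _ (isLift_chordMap hκ).zero (isLift_chordMap hκ).one fun t ht ht' j hj => ?_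
  have := C.parabola_im_pos hκ hik ht ht'
  rw [hj] at this
  simp at this

theorem simple_chordMap (hκ : 0 < κ) (hik : i < k) (hkn : k ≤ i + C.n) :
    Set.InjOn (C.chordMap hκ i k) (Set.Ioo 0 1) := by
  intro s hs t ht hst
  obtain ⟨m, hm⟩ := (discCover_eq_iff C.norm_p (C.parabola_im_nonneg hκ s)
    (C.parabola_im_nonneg hκ t)).1 hst
  have h1 := C.parabola_re_mem hik hs.1 hs.2 κ
  have h2 := C.parabola_re_mem hik ht.1 ht.2 κ
  have h3 : C.ang k ≤ C.ang i + 2 * Real.pi := by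
    rw [← C.ang_add, C.strictMono.le_iff_le]; exact hkn
  have h4 : (C.parabola κ i k s).re = (C.parabola κ i k t).re + m * (2 * Real.pi) := by
    rw [hm]; simp
  have hm0 : m = 0 := by
    by_contra hm0
    have := Real.two_pi_pos
    rcases lt_or_gt_of_ne hm0 with h | h
    · have : (m : ℝ) ≤ -1 := by exact_mod_cast (by omega : m ≤ -1)
      nlinarith
    · have : (1 : ℝ) ≤ m := by exact_mod_cast h
      nlinarith
  exact C.parabola_inj hik (by rw [h4, hm0]; simp)

/-- The upper bound for the number of intersections of two chords. -/
theorem meets_chordMap_le (hκ : 0 < κ) (hik : i < k) (hab : a < b)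
    (hne : ∀ t : ℤ, ¬ (a + t * C.n = i ∧ b + t * C.n = k)) :
    (meets (C.chordMap hκ i k) (C.chordMap hκ a b)).encard ≤
      {t : ℤ | Interleave i k (a + t * C.n) (b + t * C.n)}.encard := by
  have key : ∀ q ∈ meets (C.chordMap hκ i k) (C.chordMap hκ a b), ∃ t : ℤ,
      C.parabola κ i k q.1 = C.parabola κ a b q.2 + t * (2 * Real.pi) := fun q hq =>
    (discCover_eq_iff C.norm_p (C.parabola_im_nonneg hκ q.1) (C.parabola_im_nonneg hκ q.2)).1
      hq.2.2.2.2
  choose! F hF using key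
  -- Parabolas with the same leading coefficient differ by an affine function, so the abscissa of a
  -- meeting point satisfies a linear equation. If the intervals are nested and different, the inner
  -- parabola lies strictly below the outer one; so a meeting forces interleaving, which in turn
  -- makes the linear equation nondegenerate.
  have aux : ∀ q ∈ meets (C.chordMap hκ i k) (C.chordMap hκ a b),
      Interleave i k (a + F q * C.n) (b + F q * C.n) ∧
      (C.parabola κ i k q.1).re * (C.ang i + C.ang k - C.ang (a + F q * C.n)
        - C.ang (b + F q * C.n)) =
        C.ang i * C.ang k - C.ang (a + F q * C.n) * C.ang (b + F q * C.n) ∧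
      (C.parabola κ i k q.1).re = (C.parabola κ a b q.2).re + F q * (2 * Real.pi) := by
    intro q hq
    have h1 := C.parabola_re_mem hik hq.1 hq.2.1 κ
    have h2 := C.parabola_re_mem hab hq.2.2.1 hq.2.2.2.1 κ
    have h3 : (C.parabola κ i k q.1).re = (C.parabola κ a b q.2).re + F q * (2 * Real.pi) := by
      rw [hF q hq]; simp
    have h4 : (C.parabola κ i k q.1).im = (C.parabola κ a b q.2).im := by
      rw [hF q hq]; simp
    have h5 := C.ang_add_mul a (F q)
    have h6 := C.ang_add_mul b (F q)
    rw [parabola_im, parabola_im, mul_assoc, mul_assoc] at h4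
    have h7 := mul_left_cancel₀ hκ.ne' h4
    set x := (C.parabola κ i k q.1).re
    set y := (C.parabola κ a b q.2).re
    have e1 : y - C.ang a = x - C.ang (a + F q * C.n) := by linarith
    have e2 : C.ang b - y = C.ang (b + F q * C.n) - x := by linarith
    rw [e1, e2] at h7
    refine ⟨?_, by linarith, h3⟩
    by_contra hI
    have g1 : C.ang (a + F q * C.n) < x := by linarith
    have g2 : x < C.ang (b + F q * C.n) := by linarith
    have hnot := hne (F q)
    have l1 := C.ang_lt_iff.1 (h1.1.trans g2)
    have l2 := C.ang_lt_iff.1 (g1.trans h1.2)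
    unfold Interleave at hI
    have hcases : (i ≤ a + F q * C.n ∧ b + F q * C.n ≤ k) ∨
        (a + F q * C.n ≤ i ∧ k ≤ b + F q * C.n) := by omega
    rcases hcases with ⟨c1, c2⟩ | ⟨c1, c2⟩
    · have d1 := C.strictMono.monotone c1
      have d2 := C.strictMono.monotone c2
      have : C.ang i = C.ang (a + F q * C.n) := by nlinarith
      have : C.ang k = C.ang (b + F q * C.n) := by nlinarith
      exact hnot ⟨(C.ang_inj.1 (by assumption)).symm, (C.ang_inj.1 (by assumption)).symm⟩
    · have d1 := C.strictMono.monotone c1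
      have d2 := C.strictMono.monotone c2
      have : C.ang i = C.ang (a + F q * C.n) := by nlinarith
      have : C.ang k = C.ang (b + F q * C.n) := by nlinarith
      exact hnot ⟨(C.ang_inj.1 (by assumption)).symm, (C.ang_inj.1 (by assumption)).symm⟩
  refine Set.encard_le_encard_of_injOn (f := F) (fun q hq => (aux q hq).1) fun q hq q' hq' h => ?_
  obtain ⟨m1, m2, m3⟩ := aux q hq
  obtain ⟨m1', m2', m3'⟩ := aux q' hq'
  rw [← h] at m1' m2' m3'
  have hsum : C.ang i + C.ang k - C.ang (a + F q * C.n) - C.ang (b + F q * C.n) ≠ 0 := by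
    rcases m1 with ⟨c1, c2, c3⟩ | ⟨c1, c2, c3⟩
    · have := C.strictMono c1
      have := C.strictMono c3
      linarith
    · have := C.strictMono c1
      have := C.strictMono c3
      exact ne_of_gt (by linarith)
  have e1 : (C.parabola κ i k q.1).re = (C.parabola κ i k q'.1).re :=
    mul_right_cancel₀ hsum (m2.trans m2'.symm)
  refine Prod.ext (C.parabola_inj hik e1) (C.parabola_inj hab (κ := κ) ?_)
  linarith

/-- Parabolas of different slopes with the same vertices do not meet. -/
theorem meets_chordMap_self (hκ : 0 < κ) (hκ' : 0 < κ') (hne : κ ≠ κ') (hik : i < k)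
    (hkn : k ≤ i + C.n) : meets (C.chordMap hκ i k) (C.chordMap hκ' i k) = ∅ := by
  rw [Set.eq_empty_iff_forall_notMem]
  rintro q hq
  obtain ⟨m, hm⟩ := (discCover_eq_iff C.norm_p (C.parabola_im_nonneg hκ q.1)
    (C.parabola_im_nonneg hκ' q.2)).1 hq.2.2.2.2
  have h1 := C.parabola_re_mem hik hq.1 hq.2.1 κ
  have h2 := C.parabola_re_mem hik hq.2.2.1 hq.2.2.2.1 κ'
  have h3 : C.ang k ≤ C.ang i + 2 * Real.pi := by
    rw [← C.ang_add, C.strictMono.le_iff_le]; exact hkn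
  have h4 : (C.parabola κ i k q.1).re = (C.parabola κ' i k q.2).re + m * (2 * Real.pi) := by
    rw [hm]; simp
  have h5 : (C.parabola κ i k q.1).im = (C.parabola κ' i k q.2).im := by
    rw [hm]; simp
  have hm0 : m = 0 := by
    by_contra hm0
    have := Real.two_pi_pos
    rcases lt_or_gt_of_ne hm0 with h | h
    · have : (m : ℝ) ≤ -1 := by exact_mod_cast (by omega : m ≤ -1)
      nlinarith
    · have : (1 : ℝ) ≤ m := by exact_mod_cast h
      nlinarith
  rw [hm0] at h4
  simp only [Int.cast_zero, zero_mul, add_zero] at h4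
  rw [parabola_im, parabola_im, h4, mul_assoc, mul_assoc] at h5
  exact hne (mul_right_cancel₀ (mul_pos (sub_pos.2 h2.1) (sub_pos.2 h2.2)).ne' h5)

end Chart

end MarkedDisc

namespace MarkedDisc

variable {X : MarkedDisc}

namespace Chart

variable {C : Chart X} {f g u v w : C(I, ℂ)} {i k a b j : ℤ}

/-! ### Paths to the puncture -/

theorem norm_one_sub_mul_le {z : ℂ} (hz : ‖z‖ ≤ 1) (t : I) : ‖((1 - (t : ℝ) : ℝ) : ℂ) * z‖ ≤ 1 := by
  rw [norm_mul, Complex.norm_real, Real.norm_of_nonneg (unitInterval.one_minus_nonneg t)]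
  exact mul_le_one₀ (unitInterval.one_minus_le_one t) (norm_nonneg _) hz

theorem norm_one_sub_mul_lt {z : ℂ} (hz : ‖z‖ ≤ 1) {t : I} (ht : 0 < t) :
    ‖((1 - (t : ℝ) : ℝ) : ℂ) * z‖ < 1 := by
  rw [norm_mul, Complex.norm_real, Real.norm_of_nonneg (unitInterval.one_minus_nonneg t)]
  have ht' : 0 < (t : ℝ) := ht
  have := unitInterval.one_minus_nonneg t
  nlinarith [norm_nonneg z]

theorem norm_exp_I_ofReal (x : ℝ) : ‖Complex.exp (Complex.I * x)‖ = 1 := by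
  rw [norm_exp_I_mul]; simp

/-- A path that runs to the center, turning with speed `δ`. -/
def radialMap (C : Chart X) (δ : ℝ) (j : ℤ) : C(I, ℂ) :=
  ⟨fun t => mobius C.p (((1 - (t : ℝ) : ℝ) : ℂ) *
    Complex.exp (Complex.I * ((C.ang j + δ * (t : ℝ) : ℝ) : ℂ))),
    continuous_mobius C.norm_p (by fun_prop)
      fun t => norm_one_sub_mul_le (norm_exp_I_ofReal _).le t⟩

variable {δ : ℝ}

theorem radialMap_zero : C.radialMap δ j 0 = C.pt j := by
  simp [radialMap, pt, discCover]

theorem radialMap_one : C.radialMap δ j 1 = C.p := by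
  simp [radialMap, mobius_zero]

theorem isPath_radialMap (hp : C.p ∈ X.punctures) :
    X.IsPathBetween (C.radialMap δ j 0) (C.radialMap δ j 1) (C.radialMap δ j) := by
  refine ⟨by rw [radialMap_zero]; exact C.pt_mem_vertices j, by rw [radialMap_one]; exact Or.inr hp,
    rfl, rfl, fun t => ?_, fun t ht ht' => ?_⟩
  · exact norm_mobius_le_one C.norm_p (norm_one_sub_mul_le (norm_exp_I_ofReal _).le t)
  · refine C.not_mem_vertices ?_ ?_
    · exact (norm_mobius_lt_one_iff C.norm_p (norm_one_sub_mul_le (norm_exp_I_ofReal _).le t)).2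
        (norm_one_sub_mul_lt (norm_exp_I_ofReal _).le ht)
    · intro h
      have := mobius_injective C.norm_p (norm_one_sub_mul_le (norm_exp_I_ofReal _).le t) (by simp)
        (h.trans (mobius_zero C.p).symm)
      rcases mul_eq_zero.1 this with h1 | h1
      · have ht2 : (t : ℝ) < 1 := ht'
        exact absurd (Complex.ofReal_eq_zero.1 h1) (by linarith)
      · exact Complex.exp_ne_zero _ h1

theorem radialMap_eq {δ δ' : ℝ} {j k : ℤ} {s t : I} (h : C.radialMap δ j s = C.radialMap δ' k t) :
    ((1 - (s : ℝ) : ℝ) : ℂ) * Complex.exp (Complex.I * ((C.ang j + δ * (s : ℝ) : ℝ) : ℂ)) =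
      ((1 - (t : ℝ) : ℝ) : ℂ) * Complex.exp (Complex.I * ((C.ang k + δ' * (t : ℝ) : ℝ) : ℂ)) ∧
      s = t := by
  have h1 := mobius_injective C.norm_p (norm_one_sub_mul_le (norm_exp_I_ofReal _).le s)
    (norm_one_sub_mul_le (norm_exp_I_ofReal _).le t) h
  refine ⟨h1, ?_⟩
  have h2 := congrArg norm h1
  rw [norm_mul, norm_mul, norm_exp_I_ofReal, norm_exp_I_ofReal, Complex.norm_real,
    Complex.norm_real, Real.norm_of_nonneg (unitInterval.one_minus_nonneg s),
    Real.norm_of_nonneg (unitInterval.one_minus_nonneg t)] at h2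
  exact Subtype.ext (by linarith)

theorem simple_radialMap : Set.InjOn (C.radialMap δ j) (Set.Ioo 0 1) :=
  fun _ _ _ _ h => (radialMap_eq h).2

theorem meets_radialMap {δ : ℝ} {j k : ℤ}
    (h : ∀ t : ℝ, 0 < t → t < 1 → ∀ m : ℤ, C.ang j ≠ C.ang k + δ * t + m * (2 * Real.pi)) :
    meets (C.radialMap 0 j) (C.radialMap δ k) = ∅ := by
  rw [Set.eq_empty_iff_forall_notMem]
  rintro ⟨s, t⟩ ⟨-, -, h3, h4, h5⟩
  obtain ⟨h6, hst⟩ := radialMap_eq h5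
  change s = t at hst
  subst hst
  have h7 : ((1 - (s : ℝ) : ℝ) : ℂ) ≠ 0 := by
    have : (s : ℝ) < 1 := h4
    exact Complex.ofReal_ne_zero.2 (by linarith)
  have h8 := mul_left_cancel₀ h7 h6
  rw [Complex.exp_eq_exp_iff_exists_int] at h8
  obtain ⟨m, hm⟩ := h8
  refine h s h3 h4 m ?_
  have h9 : ((C.ang j + 0 * (s : ℝ) : ℝ) : ℂ) =
      ((C.ang k + δ * (s : ℝ) + m * (2 * Real.pi) : ℝ) : ℂ) := by
    refine mul_left_cancel₀ Complex.I_ne_zero ?_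
    rw [hm]; push_cast; ring
  have h10 := Complex.ofReal_inj.1 h9
  linarith

/-- All paths from a given vertex to the puncture are homotopic. -/
theorem homotopic_radialMap (hp : C.p ∈ X.punctures) (hf : X.IsPathBetween (f 0) (f 1) f)
    (h0 : f 0 = C.pt j) (h1 : f 1 = C.p) : X.Homotopic f (C.radialMap 0 j) := by
  have hp' : ‖-C.p‖ < 1 := by simpa using C.norm_p
  have hn := hf.2.2.2.2.1
  let G : C(I, ℂ) := ⟨fun t => mobius (-C.p) (f t), continuous_mobius hp' f.continuous hn⟩
  have hG : ∀ t, ‖G t‖ ≤ 1 := fun t => norm_mobius_le_one hp' (hn t)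
  have hfG : ∀ t, mobius C.p (G t) = f t := fun t => mobius_mobius_neg C.norm_p (hn t)
  have hG0 : G 0 = Complex.exp (Complex.I * (C.ang j : ℂ)) := by
    simp only [G, ContinuousMap.coe_mk, h0, pt, discCover]
    exact mobius_neg_mobius C.norm_p (norm_exp_I_ofReal _).le
  have hG1 : G 1 = 0 := by simp [G, h1, mobius]
  have hne : ∀ t, t < 1 → G t ≠ 0 := by
    intro t ht h
    have h2 : f t = C.p := by rw [← hfG, h, mobius_zero]
    rcases hf.eq_zero_or_one (t := t) (Or.inr (h2 ▸ hp)) with rfl | rfl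
    · exact C.pt_ne_p j (h0 ▸ h2)
    · exact ht.ne rfl
  let mid : C(I, ℂ) := ⟨fun t => mobius C.p (((1 - (t : ℝ) : ℝ) : ℂ) * G t),
    continuous_mobius C.norm_p (by fun_prop) fun t => norm_one_sub_mul_le (hG t) t⟩
  have inside : ∀ (t : I) (z : ℂ), 0 < t → t < 1 → ‖z‖ ≤ 1 → z ≠ 0 →
      mobius C.p (((1 - (t : ℝ) : ℝ) : ℂ) * z) ∉ X.vertices := by
    intro t z ht ht' hz hz'
    refine C.not_mem_vertices ((norm_mobius_lt_one_iff C.norm_p (norm_one_sub_mul_le hz t)).2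
      (norm_one_sub_mul_lt hz ht)) fun h => ?_
    have := mobius_injective C.norm_p (norm_one_sub_mul_le hz t) (by simp)
        (h.trans (mobius_zero C.p).symm)
    rcases mul_eq_zero.1 this with h1 | h1
    · have ht2 : (t : ℝ) < 1 := ht'
      exact absurd (Complex.ofReal_eq_zero.1 h1) (by linarith)
    · exact hz' h1
  have mid0 : mid 0 = C.pt j := by
    simp only [mid, ContinuousMap.coe_mk]
    rw [hG0]
    simp [pt, discCover]
  have mid1 : mid 1 = C.p := by simp [mid, mobius_zero]
  have hmid : X.IsPathBetween (mid 0) (mid 1) mid :=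
    ⟨by rw [mid0]; exact C.pt_mem_vertices j, by rw [mid1]; exact Or.inr hp, rfl, rfl,
      fun t => norm_mobius_le_one C.norm_p (norm_one_sub_mul_le (hG t) t),
      fun t ht ht' => inside t _ ht ht' (hG t) (hne t ht')⟩
  -- The factor 1 - st shrinks the path towards the center, so that at the end of this homotopy the
  -- modulus of G(t) is multiplied by 1 - t.
  have step1 : X.Homotopic f mid := by
    refine Homotopic.of_square hf hmid ⟨fun z => mobius C.p
      (((1 - ((z.1 * z.2 : I) : ℝ) : ℝ) : ℂ) * G z.2), continuous_mobius C.norm_p (by fun_prop)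
        fun z => norm_one_sub_mul_le (hG _) _⟩ (fun t => ?_) (fun t => ?_) (fun s => ?_)
        (fun s => ?_) (fun s t => ?_) fun s t hs hs' ht ht' => ?_
    · simpa using hfG t
    · simp [mid]
    · simpa using hfG 0
    · simp [hG1, mobius_zero, h1]
    · exact norm_mobius_le_one C.norm_p (norm_one_sub_mul_le (hG _) _)
    · exact inside _ _ (mul_pos hs ht)
        ((mul_lt_one_of_nonneg_of_lt_one_left hs.le hs' ht'.le)) (hG t) (hne t ht')
  -- With the factor 1 - t alone bringing the path to the center, G(t) can be replaced by G((1 -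
  -- s)t), ending with the constant G(0). Thus any winding is undone at the puncture.
  have step2 : X.Homotopic mid (C.radialMap 0 j) := by
    refine Homotopic.of_square hmid (C.isPath_radialMap hp) ⟨fun z => mobius C.p
      (((1 - (z.2 : ℝ) : ℝ) : ℂ) * G (σ z.1 * z.2)), continuous_mobius C.norm_p (by fun_prop)
        fun z => norm_one_sub_mul_le (hG _) _⟩ (fun t => ?_) (fun t => ?_) (fun s => ?_)
        (fun s => ?_) (fun s t => ?_) fun s t hs hs' ht ht' => ?_
    · simp [mid]
    · simp [hG0, radialMap]
    · simp [mid]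
    · simp [mid]
    · exact norm_mobius_le_one C.norm_p (norm_one_sub_mul_le (hG _) _)
    · refine inside _ _ ht ht' (hG _) (hne _ ?_)
      exact lt_of_le_of_lt unitInterval.mul_le_right ht'
  exact step1.trans step2

/-- The upper bound for the number of intersections of a chord and a path to the puncture. -/
theorem meets_chordMap_radialMap {κ : ℝ} (hκ : 0 < κ) (hik : i < k) :
    (meets (C.chordMap hκ i k) (C.radialMap 0 j)).encard ≤
      {t : ℤ | i < j + t * C.n ∧ j + t * C.n < k}.encard := by
  have key : ∀ q ∈ meets (C.chordMap hκ i k) (C.radialMap 0 j), ∃ t : ℤ,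
      (C.parabola κ i k q.1).re = C.ang (j + t * C.n) ∧
      Real.exp (-(C.parabola κ i k q.1).im) = 1 - (q.2 : ℝ) := by
    intro q hq
    have h1 : Complex.exp (Complex.I * C.parabola κ i k q.1) = ((1 - (q.2 : ℝ) : ℝ) : ℂ) *
        Complex.exp (Complex.I * ((C.ang j + 0 * (q.2 : ℝ) : ℝ) : ℂ)) :=
      mobius_injective C.norm_p (norm_exp_I_mul_le_one (C.parabola_im_nonneg hκ q.1))
        (norm_one_sub_mul_le (norm_exp_I_ofReal _).le q.2) hq.2.2.2.2
    have h2 := congrArg norm h1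
    rw [norm_exp_I_mul, norm_mul, norm_exp_I_ofReal, Complex.norm_real,
      Real.norm_of_nonneg (unitInterval.one_minus_nonneg _), mul_one] at h2
    rw [← h2, Complex.ofReal_exp, ← Complex.exp_add, Complex.exp_eq_exp_iff_exists_int] at h1
    obtain ⟨t, ht⟩ := h1
    refine ⟨t, ?_, h2⟩
    have h3 := congrArg Complex.im ht
    rw [C.ang_add_mul]
    simp only [Complex.add_im, Complex.ofReal_im, Complex.I_mul_im, Complex.ofReal_re, zero_add] at h3
    rw [h3]
    simp
  choose! F hF1 hF2 using key
  refine Set.encard_le_encard_of_injOn (f := F) (fun q hq => ?_) fun q hq q' hq' h => ?_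
  · obtain ⟨h1, h2⟩ := C.parabola_re_mem hik hq.1 hq.2.1 κ
    rw [hF1 q hq, C.ang_lt_iff] at h1 h2
    exact ⟨h1, h2⟩
  · have h1 : q.1 = q'.1 := C.parabola_inj (κ := κ) hik (by rw [hF1 q hq, hF1 q' hq', h])
    have h2 := hF2 q hq
    rw [h1, hF2 q' hq'] at h2
    exact Prod.ext h1 (Subtype.ext (by linarith))

/-- The lower bound for the number of intersections of a chord and a path to the puncture. -/
theorem encard_le_meets_radial (hp : C.p ∈ X.punctures) {x y x' y' : ℂ}
    (hf : X.IsPathBetween x y f) (hg : X.IsPathBetween x' y' g) (hu : C.HasLift f i k)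
    (h0 : g 0 = C.pt j) (h1 : g 1 = C.p) :
    {t : ℤ | i < j + t * C.n ∧ j + t * C.n < k}.encard ≤ (meets f g).encard := by
  have hp' : ‖-C.p‖ < 1 := by simpa using C.norm_p
  have hgn := hg.2.2.2.2.1
  obtain ⟨u, hu⟩ := hu
  obtain ⟨s₀, -, hs₀⟩ := isCompact_univ.exists_isMaxOn Set.univ_nonempty
    (Complex.continuous_im.comp u.continuous).continuousOn
  -- The path g itself has no lift, since it ends at the puncture. Cut off at a time T close to 1,
  -- it has a lift that ends above the highest point of u.
  obtain ⟨T, hT0, hT1, hT⟩ : ∃ T : I, 0 < T ∧ T < 1 ∧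
      ‖mobius (-C.p) (g T)‖ < Real.exp (-(u s₀).im) := by
    have hc : Continuous fun t => ‖mobius (-C.p) (g t)‖ :=
      (continuous_mobius hp' g.continuous hgn).norm
    obtain ⟨δ, hδ, hd⟩ := Metric.continuousAt_iff.1 (hc.continuousAt (x := 1)) _
      (Real.exp_pos (-(u s₀).im))
    have hm1 : max (1 / 2) (1 - δ / 2) < 1 := max_lt (by norm_num) (by linarith)
    have hm0 : 0 < max (1 / 2) (1 - δ / 2) := lt_max_of_lt_left (by norm_num)
    refine ⟨⟨max (1 / 2) (1 - δ / 2), hm0.le, hm1.le⟩, hm0, hm1, ?_⟩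
    have h2 := @hd ⟨max (1 / 2) (1 - δ / 2), hm0.le, hm1.le⟩ (by
      have := le_max_right (1 / 2) (1 - δ / 2)
      change |max (1 / 2) (1 - δ / 2) - 1| < δ
      rw [abs_sub_comm, abs_of_pos (sub_pos.2 hm1)]
      linarith)
    have h3 : mobius (-C.p) (g 1) = 0 := by rw [h1]; simp [mobius]
    rw [h3, norm_zero, Real.dist_eq, sub_zero, abs_of_nonneg (norm_nonneg _)] at h2
    exact h2
  have hTt : ∀ t : I, T * t < 1 := fun t => lt_of_le_of_lt unitInterval.mul_le_left hT1
  let gT : C(I, ℂ) := ⟨fun t => g (T * t), by fun_prop⟩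
  obtain ⟨v, v0, v1, v2⟩ := exists_lift_path (w := C.ang j) C.norm_p gT (fun t => hgn _)
    (fun t ht => by
      rcases hg.eq_zero_or_one (t := T * t) (Or.inr (by
        change g (T * t) = C.p at ht; rw [ht]; exact hp)) with h | h
      · change g (T * t) = C.p at ht
        rw [h, h0] at ht
        exact C.pt_ne_p j ht
      · exact (hTt t).ne h) (by simp) (by simp [gT, h0, pt])
  have hv1 : ∀ s, (u s).im < (v 1).im := by
    intro s
    have e1 := norm_exp_I_mul (v 1)
    rw [← mobius_neg_mobius C.norm_p (norm_exp_I_mul_le_one (v1 1))] at e1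
    change ‖mobius (-C.p) (discCover C.p (v 1))‖ = _ at e1
    rw [v2 1] at e1
    simp only [gT, ContinuousMap.coe_mk, mul_one] at e1
    rw [e1, Real.exp_lt_exp] at hT
    have := hs₀ (Set.mem_univ s)
    simp only [Set.mem_ofPred_eq, Function.comp_apply] at this
    linarith
  have key : ∀ t : ℤ, i < j + t * C.n ∧ j + t * C.n < k → ∃ q : I × I,
      (q.1, T * q.2) ∈ meets f g ∧ u q.1 = v q.2 + t * (2 * Real.pi) := by
    intro t ht
    obtain ⟨s, r, hsr⟩ := exists_eq_of_above (f := u)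
      (g := ⟨fun r => v r + t * (2 * Real.pi), by fun_prop⟩) (b₀ := C.ang (j + t * C.n))
      hu.im_nonneg (fun r => by simpa using v1 r) hu.zero hu.one (by simp [v0, C.ang_add_mul])
      (fun s => by simpa using hv1 s) (C.ang_lt_iff.2 ht.1) (C.ang_lt_iff.2 ht.2)
    simp only [ContinuousMap.coe_mk] at hsr
    have hfg : f s = g (T * r) := by
      rw [← hu.cover_eq, hsr, discCover_add, v2]; rfl
    have hr0 : r ≠ 0 := by
      rintro rfl
      have := hu.eq_zero_or_one hf (t := s) (j := j + t * C.n) (by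
        rw [hsr, v0, C.ang_add_mul]; push_cast; ring)
      omega
    have hTr : 0 < T * r := mul_pos hT0 (unitInterval.pos_iff_ne_zero.2 hr0)
    have hs : f s ∉ X.vertices := by rw [hfg]; exact hg.2.2.2.2.2 _ hTr (hTt r)
    refine ⟨(s, r), ⟨?_, ?_, hTr, hTt r, hfg⟩, hsr⟩
    · refine unitInterval.pos_iff_ne_zero.2 ?_
      rintro rfl
      exact hs (by rw [hu.apply_zero]; exact C.pt_mem_vertices i)
    · refine unitInterval.lt_one_iff_ne_one.2 ?_
      rintro rfl
      exact hs (by rw [hu.apply_one]; exact C.pt_mem_vertices k)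
  choose! F hF1 hF2 using key
  refine Set.encard_le_encard_of_injOn (f := fun t => ((F t).1, T * (F t).2))
    (fun t ht => hF1 t ht) fun t ht t' ht' h => ?_
  simp only [Prod.mk.injEq] at h
  have h3 : (F t).2 = (F t').2 := by
    have := congrArg Subtype.val h.2
    simp only [Set.Icc.coe_mul] at this
    exact Subtype.ext (mul_left_cancel₀ (ne_of_gt (show 0 < (T : ℝ) from hT0)) this)
  have h4 := hF2 t ht
  rw [h.1, h3, hF2 t' ht'] at h4
  have h2 : ((t' : ℝ) : ℂ) * ((2 * Real.pi : ℝ) : ℂ) = ((t : ℝ) : ℂ) * ((2 * Real.pi : ℝ) : ℂ) := by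
    push_cast; linear_combination h4
  have h3 : (t' : ℝ) * (2 * Real.pi) = t * (2 * Real.pi) := by exact_mod_cast h2
  have h4 := mul_right_cancel₀ Real.two_pi_pos.ne' h3
  exact_mod_cast h4.symm

/-- Loops at the puncture can be contracted. -/
theorem nullHomotopic_of_eq_p (hf : X.IsPathBetween (f 0) (f 1) f) (h0 : f 0 = C.p)
    (h1 : f 1 = C.p) : X.NullHomotopic f := by
  have hn := hf.2.2.2.2.1
  have hp := C.norm_p
  have e : ∀ s t : I, ‖((1 - (s : ℝ) : ℝ) : ℂ) * f t + ((s : ℝ) : ℂ) * C.p‖ ≤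
      (1 - (s : ℝ)) * ‖f t‖ + (s : ℝ) * ‖C.p‖ := fun s t => by
    refine (norm_add_le _ _).trans (le_of_eq ?_)
    rw [norm_mul, norm_mul, Complex.norm_real, Complex.norm_real,
      Real.norm_of_nonneg (unitInterval.one_minus_nonneg s), Real.norm_of_nonneg s.2.1]
  refine ⟨⟨fun z => ((1 - (z.1 : ℝ) : ℝ) : ℂ) * f z.2 + ((z.1 : ℝ) : ℂ) * C.p, by fun_prop⟩,
    fun t => by simp, fun t => by simp [h0], fun s => ⟨?_, ?_⟩, fun s t => ?_,
    fun s t hs ht ht' => ?_⟩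
  · simp [h0]; ring
  · simp [h0, h1]; ring
  · refine (e s t).trans ?_
    have := s.2.1
    have := unitInterval.one_minus_nonneg s
    nlinarith [hn t]
  · rcases eq_or_ne s 0 with rfl | hs0
    · simpa using hf.2.2.2.2.2 t ht ht'
    have hs1 : 0 < (s : ℝ) := unitInterval.pos_iff_ne_zero.2 hs0
    have hs2 : (s : ℝ) < 1 := hs
    rintro (h | h)
    · refine (X.norm_marked _ h).not_lt ((e s t).trans_lt ?_)
      nlinarith [hn t]
    · have h2 := C.puncture _ h
      simp only [ContinuousMap.coe_mk] at h h2
      have h3 : ((1 - (s : ℝ) : ℝ) : ℂ) * (f t - C.p) = 0 := by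
        push_cast at h2 ⊢
        linear_combination h2
      rcases mul_eq_zero.1 h3 with h4 | h4
      · exact absurd (Complex.ofReal_eq_zero.1 h4) (by linarith)
      · refine hf.2.2.2.2.2 t ht ht' (Or.inr ?_)
        rw [sub_eq_zero.1 h4, ← h2]
        exact h

end Chart

/-! ### The disc without punctures -/

section unpunctured

variable {f g : C(I, ℂ)}

/-- The linear interpolation between two paths. -/
def linearSquare (f g : C(I, ℂ)) : C(I × I, ℂ) :=
  ⟨fun z => (1 - (z.1 : ℝ)) • f z.2 + (z.1 : ℝ) • g z.2, by fun_prop⟩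

theorem norm_linearSquare_le (hf : ∀ t, ‖f t‖ ≤ 1) (hg : ∀ t, ‖g t‖ ≤ 1) (s t : I) :
    ‖linearSquare f g (s, t)‖ ≤ 1 :=
  mem_closedBall_zero_iff.1 ((convex_closedBall (0 : ℂ) 1)
    (mem_closedBall_zero_iff.2 (hf t)) (mem_closedBall_zero_iff.2 (hg t))
    (unitInterval.one_minus_nonneg s) s.2.1 (by ring))

/-- By strict convexity of the disc a proper combination of two different points lies in the open
disc; where the points agree, f already avoids the vertices. -/
theorem linearSquare_not_mem (h : X.punctures = ∅) (hf : ∀ t, ‖f t‖ ≤ 1) (hg : ∀ t, ‖g t‖ ≤ 1)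
    {s t : I} (hs : 0 < s) (hs' : s < 1) (ht : f t ∉ X.vertices) :
    linearSquare f g (s, t) ∉ X.vertices := by
  rintro (hm | hm)
  · by_cases hne : f t = g t
    · refine ht (Or.inl ?_)
      have : linearSquare f g (s, t) = f t := by
        simp only [linearSquare, ContinuousMap.coe_mk, ← hne]
        rw [← add_smul]; simp
      rwa [this] at hm
    · exact (norm_combo_lt_of_ne (hf t) (hg t) hne (show 0 < 1 - (s : ℝ) from sub_pos.2 hs') hs
        (by ring)).ne
        (X.norm_marked _ hm)
  · rw [h] at hm; simp at hm

theorem homotopic_of_unpunctured (h : X.punctures = ∅) (hf : X.IsPathBetween (f 0) (f 1) f)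
    (hg : X.IsPathBetween (g 0) (g 1) g) (h0 : f 0 = g 0) (h1 : f 1 = g 1) : X.Homotopic f g := by
  have hfn := hf.2.2.2.2.1
  have hgn := hg.2.2.2.2.1
  refine Homotopic.of_square hf hg (linearSquare f g) (fun t => by simp [linearSquare])
    (fun t => by simp [linearSquare]) (fun s => ?_) (fun s => ?_) (norm_linearSquare_le hfn hgn)
    fun s t hs hs' ht ht' => linearSquare_not_mem h hfn hgn hs hs' (hf.2.2.2.2.2 t ht ht')
  · simp only [linearSquare, ContinuousMap.coe_mk, ← h0]; rw [← add_smul]; simp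
  · simp only [linearSquare, ContinuousMap.coe_mk, ← h1]; rw [← add_smul]; simp

theorem nullHomotopic_of_unpunctured (h : X.punctures = ∅) (hf : X.IsPathBetween (f 0) (f 1) f)
    (h1 : f 0 = f 1) : X.NullHomotopic f := by
  have hfn := hf.2.2.2.2.1
  have hgn : ∀ t, ‖(ContinuousMap.const I (f 0)) t‖ ≤ 1 := fun t => hfn 0
  refine ⟨linearSquare f (ContinuousMap.const I (f 0)), fun t => by simp [linearSquare],
    fun t => by simp [linearSquare], fun s => ⟨?_, ?_⟩, norm_linearSquare_le hfn hgn,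
    fun s t hs ht ht' => ?_⟩
  · simp only [linearSquare, ContinuousMap.coe_mk, ContinuousMap.const_apply]
    rw [← add_smul]; simp
  · simp only [linearSquare, ContinuousMap.coe_mk, ContinuousMap.const_apply, ← h1]
    rw [← add_smul]; simp
  · have h2 := hf.2.2.2.2.2 t ht ht'
    rcases eq_or_ne s 0 with rfl | hs0
    · simpa [linearSquare] using h2
    · exact linearSquare_not_mem h hfn hgn (unitInterval.pos_iff_ne_zero.2 hs0) hs h2

theorem Chart.pt_eq_exp {C : Chart X} (hC : C.p = 0) (j : ℤ) :
    C.pt j = Complex.exp (Complex.I * C.ang j) := by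
  simp [Chart.pt, hC, discCover, mobius]

/-- The curves may pass through the center and need not have lifts, so the crossing is forced by
interlacing on the circle itself. -/
theorem Chart.one_le_meets {C : Chart X} (hC : C.p = 0) {x y x' y' : ℂ}
    (hf : X.IsPathBetween x y f) (hg : X.IsPathBetween x' y' g) {i k a b : ℤ} (f0 : f 0 = C.pt i)
    (f1 : f 1 = C.pt k) (g0 : g 0 = C.pt a) (g1 : g 1 = C.pt b) (hi : 0 ≤ i) (hk : k < C.n)
    (ha : 0 ≤ a) (hb : b < C.n) (h : Interleave i k a b) : 1 ≤ (meets f g).encard := by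
  have hfn := hf.2.2.2.2.1
  have hgn := hg.2.2.2.2.1
  obtain ⟨s, t, hst⟩ : ∃ s t, f s = g t := by
    simp only [Chart.pt_eq_exp hC] at f0 f1 g0 g1
    rcases h with ⟨h1, h2, h3⟩ | ⟨h1, h2, h3⟩
    · refine exists_eq_of_interlaced_circle hfn hgn f0 f1 g0 g1 (C.ang_lt_iff.2 h1)
        (C.ang_lt_iff.2 h2) (C.ang_lt_iff.2 h3) ?_
      rw [← C.ang_add, C.ang_lt_iff]; omega
    · obtain ⟨t, s, h⟩ := exists_eq_of_interlaced_circle hgn hfn g0 g1 f0 f1 (C.ang_lt_iff.2 h1)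
        (C.ang_lt_iff.2 h2) (C.ang_lt_iff.2 h3) (by rw [← C.ang_add, C.ang_lt_iff]; omega)
      exact ⟨s, t, h.symm⟩
  have pts : ∀ c d : ℤ, 0 ≤ c → c < C.n → 0 ≤ d → d < C.n → C.pt c = C.pt d → c = d := by
    intro c d h1 h2 h3 h4 h5
    obtain ⟨t, ht⟩ := C.pt_eq_iff.1 h5
    exact (CombArc.eq_of_add_mul (t := 0) (t' := t) ⟨h1, h2⟩ ⟨h3, h4⟩ (by omega)).1
  unfold Interleave at h
  have hs : f s ∉ X.vertices := by
    intro hv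
    have hv' := hv
    rw [hst] at hv'
    rcases hf.eq_zero_or_one hv with rfl | rfl <;> rcases hg.eq_zero_or_one hv' with rfl | rfl
    · have := pts i a (by omega) (by omega) (by omega) (by omega) (by rw [← f0, hst, g0]); omega
    · have := pts i b (by omega) (by omega) (by omega) (by omega) (by rw [← f0, hst, g1]); omega
    · have := pts k a (by omega) (by omega) (by omega) (by omega) (by rw [← f1, hst, g0]); omega
    · have := pts k b (by omega) (by omega) (by omega) (by omega) (by rw [← f1, hst, g1]); omega
  have ht : g t ∉ X.vertices := hst ▸ hs
  rw [Set.one_le_encard_iff_nonempty]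
  refine ⟨(s, t), unitInterval.pos_iff_ne_zero.2 ?_, unitInterval.lt_one_iff_ne_one.2 ?_,
    unitInterval.pos_iff_ne_zero.2 ?_, unitInterval.lt_one_iff_ne_one.2 ?_, hst⟩
  · rintro rfl; exact hs (f0 ▸ C.pt_mem_vertices i)
  · rintro rfl; exact hs (f1 ▸ C.pt_mem_vertices k)
  · rintro rfl; exact ht (g0 ▸ C.pt_mem_vertices a)
  · rintro rfl; exact ht (g1 ▸ C.pt_mem_vertices b)

end unpunctured

end MarkedDisc

namespace MarkedDisc

variable {X : MarkedDisc}

/-! ### Loops around the puncture -/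

theorem norm_conj_mul_lt {p z : ℂ} (hp : ‖p‖ < 1) (hz : ‖z‖ ≤ 1) : ‖(starRingEnd ℂ) p * z‖ < 1 := by
  rw [norm_mul, RCLike.norm_conj]
  nlinarith [norm_nonneg p, norm_nonneg z]

theorem mobius_sub {p z : ℂ} (hp : ‖p‖ < 1) (hz : ‖z‖ ≤ 1) : (mobius p z - p) *
    (1 + (starRingEnd ℂ) p * z) = z * (1 - (starRingEnd ℂ) p * p) := by
  have h := mobius_denom_ne_zero hp hz
  have h3 : mobius p z * (1 + (starRingEnd ℂ) p * z) = z + p := div_mul_cancel₀ _ h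
  linear_combination h3

/-- A path cannot wind around a point of an unbounded component of its complement. -/
theorem isBounded_of_winding {p : ℂ} (hp : ‖p‖ < 1) {f w : C(I, ℂ)} (hw : ∀ t, 0 ≤ (w t).im)
    (hf : ∀ t, discCover p (w t) = f t) (h1 : w 1 = w 0 + 2 * Real.pi) :
    Bornology.IsBounded (connectedComponentIn (Set.range f)ᶜ p) := by
  by_contra hb
  have hf01 : f 1 = f 0 := by
    rw [← hf, ← hf, h1]; simpa using discCover_add (p := p) (w := w 0) 1
  have hfn : ∀ t, ‖f t‖ ≤ 1 := fun t => hf t ▸ norm_discCover_le_one hp (hw t)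
  have hpU : p ∈ (Set.range f)ᶜ := by
    rintro ⟨t, ht⟩
    exact discCover_ne hp (hw t) ((hf t).trans ht)
  have hopen : IsOpen (connectedComponentIn (Set.range f)ᶜ p) :=
    (isCompact_range f.continuous).isClosed.isOpen_compl.connectedComponentIn
  have hconn : IsPathConnected (connectedComponentIn (Set.range f)ᶜ p) :=
    hopen.isConnected_iff_isPathConnected.1 (isConnected_connectedComponentIn_iff.2 hpU)
  obtain ⟨q, hq, hq1⟩ : ∃ q ∈ connectedComponentIn (Set.range f)ᶜ p, 1 < ‖q‖ := by
    by_contra! h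
    exact hb ((Metric.isBounded_closedBall (x := (0 : ℂ)) (r := 1)).subset
      fun q hq => by simpa using h q hq)
  obtain ⟨η, hη⟩ := hconn.joinedIn p (mem_connectedComponentIn hpU) q hq
  -- If p could be joined to a point q outside the disc without meeting f, the logarithm of f minus
  -- the moving point would change by the same amount along f at both ends. At q this is zero, as f
  -- - q stays in a slit plane.
  obtain ⟨H, hH⟩ := exists_log_sub (f := f) (g := η.toContinuousMap) fun s t h =>
    connectedComponentIn_subset _ _ (hη t) ⟨s, h⟩
  have hq0 : q ≠ 0 := by rintro rfl; simp at hq1; linarith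
  have hH1 : ∀ s, Complex.exp (H (s, 1)) = f s - q := fun s => by
    rw [hH]; congr 1; exact η.target
  have hH0 : ∀ s, Complex.exp (H (s, 0)) = f s - p := fun s => by
    rw [hH]; congr 1; exact η.source
  have top := Complex.log_sub_of_slitPlane (P := fun s => H (s, 1)) (q := fun s => f s - q)
    (by fun_prop) (by fun_prop) hH1 (-q⁻¹) fun s => by
      have e : -q⁻¹ * (f s - q) = 1 - q⁻¹ * f s := by field_simp; ring
      rw [e]
      have hlt : ‖q⁻¹ * f s‖ < 1 := by
        rw [norm_mul, norm_inv]
        have h2 := hfn s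
        rw [inv_mul_lt_iff₀ (by linarith)]
        linarith
      refine one_sub_mem_slitPlane hlt.le fun h => ?_
      rw [h] at hlt
      simp at hlt
  simp only [hf01, sub_self] at top
  have side := Complex.eq_of_exp_const (D := fun t => H (1, t) - H (0, t)) (by fun_prop) (c := 1)
    (fun t => by
      rw [Complex.exp_sub, hH, hH, hf01]
      refine div_self (sub_ne_zero.2 fun h => ?_)
      exact connectedComponentIn_subset _ _ (hη t) ⟨0, h⟩) 0 1
  have he := fun s => norm_exp_I_mul_le_one (hw s)
  have hslit : ∀ s, 1 + (starRingEnd ℂ) p * Complex.exp (Complex.I * w s) ∈ Complex.slitPlane := by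
    intro s
    have hlt := norm_conj_mul_lt hp (he s)
    have := one_sub_mem_slitPlane (z := -((starRingEnd ℂ) p * Complex.exp (Complex.I * w s)))
      (by rw [norm_neg]; exact hlt.le) fun h => by
        rw [← norm_neg, h] at hlt
        simp at hlt
    rwa [sub_neg_eq_add] at this
  -- With z = e^{iw}, f - p is the product of z and 1 - |p|², divided by 1 + p̄z. The denominator
  -- stays in the slit plane, so around p the logarithm changes by 2πi.
  have bottom := Complex.eq_of_exp_const (D := fun s => H (s, 0) - Complex.I * w s +
      Complex.log (1 + (starRingEnd ℂ) p * Complex.exp (Complex.I * w s)))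
    (c := 1 - (starRingEnd ℂ) p * p)
    (Continuous.add (by fun_prop) (Continuous.clog (by fun_prop) hslit)) (fun s => by
      rw [Complex.exp_add, Complex.exp_sub, Complex.exp_log (Complex.slitPlane_ne_zero (hslit s)),
        hH0, ← hf, discCover, div_mul_eq_mul_div, mobius_sub hp (he s)]
      exact mul_div_cancel_left₀ _ (Complex.exp_ne_zero _)) 1 0
  have e1 : Complex.exp (Complex.I * w 1) = Complex.exp (Complex.I * w 0) := by
    rw [h1, Complex.exp_eq_exp_iff_exists_int]
    exact ⟨1, by push_cast; ring⟩
  simp only [e1] at bottom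
  have h2 : Complex.I * (2 * Real.pi) = 0 := by
    rw [h1] at bottom
    linear_combination -bottom + side + top
  simp [Real.pi_ne_zero] at h2

/-- Homotopies fix the endpoints, so no representative of the class is a loop. -/
theorem not_cutsOutPuncturedMonogon {c : X.Curve} (h : c.toMap 0 ≠ c.toMap 1) :
    ¬ CutsOutPuncturedMonogon (⟦c⟧ : X.CurveClass) := by
  rintro ⟨d, hd, -, hl, -⟩
  rcases Quotient.exact hd with h1 | h1
  · have e := h1.endpoints
    exact h (by rw [e.1, e.2]; exact hl)
  · have e := h1.endpoints
    simp only [reverseMap_apply, unitInterval.symm_zero, unitInterval.symm_one] at e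
    exact h (by rw [e.1, e.2]; exact hl.symm)

theorem Chart.cutsOutPuncturedMonogon {C : Chart X} (hp : C.p ∈ X.punctures) {c : X.Curve}
    {i k : ℤ} (hs : c.IsArc) (h : C.HasLift c.toMap i k) (hik : k = i + C.n ∨ i = k + C.n) :
    CutsOutPuncturedMonogon (⟦c⟧ : X.CurveClass) := by
  obtain ⟨d, hd, hds⟩ := hs
  obtain ⟨w, hw⟩ := h.of_homotopic hp hd
  refine ⟨d, Quotient.sound (Or.inl hd.symm), hds, ?_, C.p, ⟨hp, ?_, ?_⟩, fun q hq =>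
    C.puncture q hq.1⟩
  · rw [Curve.IsLoop, hw.apply_zero, hw.apply_one, C.pt_eq_iff]
    rcases hik with rfl | rfl
    · exact ⟨-1, by ring⟩
    · exact ⟨1, by ring⟩
  · rintro ⟨t, ht⟩
    exact discCover_ne C.norm_p (hw.im_nonneg t) ((hw.cover_eq t).trans ht)
  · rcases hik with rfl | rfl
    · refine isBounded_of_winding C.norm_p hw.im_nonneg hw.cover_eq ?_
      rw [hw.one, hw.zero, C.ang_add]; push_cast; ring
    · have hr : Set.range d.toMap = Set.range (reverseMap d.toMap) := by
        ext z
        constructor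
        · rintro ⟨t, rfl⟩; exact ⟨σ t, by simp⟩
        · rintro ⟨t, rfl⟩; exact ⟨σ t, rfl⟩
      rw [hr]
      refine isBounded_of_winding (w := reverseMap w) C.norm_p (fun t => hw.im_nonneg _)
        (fun t => hw.cover_eq _) ?_
      simp only [reverseMap_apply, unitInterval.symm_zero, unitInterval.symm_one]
      rw [hw.one, hw.zero, C.ang_add]; push_cast; ring

/-! ### Intersection numbers -/

/-- A bound valid for all representatives and attained by one pair is the minimum; it has to be
finite because only finite numbers of intersections enter the infimum. -/
theorem crossingNumber_eq {α β : X.CurveClass} {S : ℕ∞} (hS : S ≠ ⊤)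
    (hup : ∃ c d : X.Curve, ⟦c⟧ = α ∧ ⟦d⟧ = β ∧ (meets c.toMap d.toMap).encard ≤ S)
    (hlow : ∀ c d : X.Curve, ⟦c⟧ = α → ⟦d⟧ = β → S ≤ (meets c.toMap d.toMap).encard) :
    (crossingNumber α β : ℕ∞) = S := by
  lift S to ℕ using hS
  obtain ⟨c, d, hc, hd, h⟩ := hup
  have hm : S ∈ {n : ℕ | ∃ c d : X.Curve, ⟦c⟧ = α ∧ ⟦d⟧ = β ∧ (c.crossings d).encard = n} :=
    ⟨c, d, hc, hd, le_antisymm h (hlow c d hc hd)⟩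
  refine congrArg _ (le_antisymm (Nat.sInf_le hm) (le_csInf ⟨S, hm⟩ ?_))
  rintro m ⟨c, d, hc, hd, h⟩
  have := hlow c d hc hd
  change (meets c.toMap d.toMap).encard = m at h
  rw [h] at this
  exact_mod_cast this

theorem crossingNumber_comm (α β : X.CurveClass) : crossingNumber α β = crossingNumber β α := by
  unfold crossingNumber
  congr 1
  ext m
  constructor <;> rintro ⟨c, d, hc, hd, h⟩ <;> refine ⟨d, c, hd, hc, ?_⟩ <;> rw [← h]
  · exact le_antisymm (meets_swap _ _) (meets_swap _ _)
  · exact le_antisymm (meets_swap _ _) (meets_swap _ _)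

namespace Chart

variable {C : Chart X} {i k a b j : ℤ} {κ κ' : ℝ}

variable (C) in
/-- The chord from `i` to `k` is a curve. -/
structure IsProper (i k : ℤ) : Prop where
  lt : i < k
  lt_add : k < i + C.n
  not_boundary : ∀ (κ : ℝ) (hκ : 0 < κ) (g : C(I, ℂ)), X.IsBoundarySegment g →
    ¬ X.Homotopic (C.chordMap hκ i k) g

theorem IsProper.pt_ne (h : C.IsProper i k) : C.pt i ≠ C.pt k := by
  intro he
  obtain ⟨t, ht⟩ := C.pt_eq_iff.1 he
  have h1 := h.lt
  have h2 := h.lt_add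
  have h3 : (-1 : ℤ) < t := CombArc.mul_lt_cancel C.n_pos (by omega)
  have h4 : t < 0 := CombArc.mul_lt_cancel C.n_pos (by omega)
  omega

theorem chordMap_zero (hκ : 0 < κ) : C.chordMap hκ i k 0 = C.pt i :=
  (hasLift_chordMap hκ).apply_zero

theorem chordMap_one (hκ : 0 < κ) : C.chordMap hκ i k 1 = C.pt k :=
  (hasLift_chordMap hκ).apply_one

/-- The curve that is covered by a parabola. -/
def chordCurve (C : Chart X) (hκ : 0 < κ) (h : C.IsProper i k) : X.Curve where
  toMap := C.chordMap hκ i k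
  isPath := isPath_chordMap hκ h.lt
  not_nullHomotopic := not_nullHomotopic_of_ne (by
    rw [chordMap_zero, chordMap_one]; exact h.pt_ne)
  not_boundary := h.not_boundary κ hκ

@[simp] theorem chordCurve_toMap (hκ : 0 < κ) (h : C.IsProper i k) :
    (C.chordCurve hκ h).toMap = C.chordMap hκ i k := rfl

theorem chordCurve_isSimple (hκ : 0 < κ) (h : C.IsProper i k) : (C.chordCurve hκ h).IsSimple :=
  simple_chordMap hκ h.lt h.lt_add.le

theorem chordCurve_eq (hκ : 0 < κ) (hκ' : 0 < κ') (h : C.IsProper i k) :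
    (⟦C.chordCurve hκ h⟧ : X.CurveClass) = ⟦C.chordCurve hκ' h⟧ :=
  Quotient.sound (Or.inl (homotopic_of_hasLift (isPath_chordMap hκ h.lt) (isPath_chordMap hκ' h.lt)
    (hasLift_chordMap hκ) (hasLift_chordMap hκ')))

theorem finite_interleave (i k a b : ℤ) :
    {t : ℤ | Interleave i k (a + t * C.n) (b + t * C.n)}.Finite := by
  refine (Set.finite_Icc (-(|i| + |k| + |a| + |b|)) (|i| + |k| + |a| + |b|)).subset fun t ht => ?_
  have hn := C.n_pos
  have h1 : -(|i| + |k| + |a| + |b|) ≤ t * C.n ∧ t * C.n ≤ |i| + |k| + |a| + |b| := by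
    have := neg_abs_le i
    have := neg_abs_le k
    have := neg_abs_le a
    have := neg_abs_le b
    have := le_abs_self i
    have := le_abs_self k
    have := le_abs_self a
    have := le_abs_self b
    change Interleave _ _ _ _ at ht
    unfold Interleave at ht
    omega
  rw [Set.mem_Icc, ← abs_le] at *
  rw [abs_mul, abs_of_pos hn] at h1
  nlinarith [abs_nonneg t]

/-- Chords with the same ends in the universal cover, up to orientation, define the same curve. -/
theorem eq_chordCurve (hκ : 0 < κ) (h : C.IsProper i k) {c : X.Curve}
    (hc : C.HasLift c.toMap i k ∨ C.HasLift c.toMap k i) :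
    (⟦c⟧ : X.CurveClass) = ⟦C.chordCurve hκ h⟧ := by
  refine Quotient.sound ?_
  rcases hc with hc | hc
  · exact Or.inl (homotopic_of_hasLift c.isPath (isPath_chordMap hκ h.lt) hc (hasLift_chordMap hκ))
  · refine Or.inr (homotopic_of_hasLift c.isPath ?_ hc (hasLift_chordMap hκ).reverse)
    have := (isPath_chordMap (C := C) hκ h.lt).reverse
    simpa using this

/-! ### Curves in the once-punctured disc -/

section punctured

variable (hp : C.p ∈ X.punctures)
include hp

theorem isProper (h : 2 ≤ k - i ∧ k - i < C.n) : C.IsProper i k := by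
  refine ⟨by omega, by omega, fun κ hκ g hg hh => ?_⟩
  have h1 := (hasLift_chordMap (C := C) hκ).of_homotopic hp hh
  obtain ⟨k', h2, h3, h4⟩ := exists_hasLift_of_isBoundarySegment hg h1.apply_zero
  obtain ⟨t, ht, ht'⟩ := h1.unique h2
  omega

theorem hasLift_of_eq (hκ : 0 < κ) (h : C.IsProper i k) {c : X.Curve}
    (hc : (⟦c⟧ : X.CurveClass) = ⟦C.chordCurve hκ h⟧) :
    C.HasLift c.toMap i k ∨ C.HasLift (reverseMap c.toMap) i k := by
  rcases Quotient.exact hc with h1 | h1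
  · exact Or.inl ((hasLift_chordMap hκ).of_homotopic hp h1.symm)
  · refine Or.inr ((hasLift_chordMap (C := C) (i := i) (k := k) hκ).of_homotopic hp ?_)
    simpa using h1.reverse.symm

theorem chordCurve_eq_iff (hκ : 0 < κ) (h : C.IsProper i k) (h' : C.IsProper a b) :
    (⟦C.chordCurve hκ h⟧ : X.CurveClass) = ⟦C.chordCurve hκ h'⟧ ↔
      ∃ t : ℤ, a = i + t * C.n ∧ b = k + t * C.n := by
  constructor
  · intro he
    rcases hasLift_of_eq hp hκ h he.symm with h1 | h1
    · exact h1.unique (hasLift_chordMap hκ)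
    · have h2 : C.HasLift (C.chordMap hκ a b) k i := by simpa using h1.reverse
      obtain ⟨t, ht, ht'⟩ := h2.unique (hasLift_chordMap hκ)
      have := h.lt
      have := h'.lt
      omega
  · rintro ⟨t, rfl, rfl⟩
    exact eq_chordCurve hκ h' (Or.inl ((hasLift_chordMap hκ).shift t))

theorem crossingNumber_chordCurve (hκ : 0 < κ) (h : C.IsProper i k) (h' : C.IsProper a b) :
    (crossingNumber (⟦C.chordCurve hκ h⟧ : X.CurveClass) ⟦C.chordCurve hκ h'⟧ : ℕ∞) =
      {t : ℤ | Interleave i k (a + t * C.n) (b + t * C.n)}.encard := by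
  refine crossingNumber_eq (finite_interleave i k a b).encard_lt_top.ne ?_ fun c d hc hd => ?_
  · by_cases hne : ∃ t : ℤ, a + t * C.n = i ∧ b + t * C.n = k
    · obtain ⟨t, rfl, rfl⟩ := hne
      -- Representatives of one and the same class are separated by using parabolas with different
      -- leading coefficients.
      refine ⟨C.chordCurve hκ h, C.chordCurve (κ := κ + 1) (add_pos hκ one_pos) h, rfl, ?_, ?_⟩
      · rw [chordCurve_eq _ hκ h, chordCurve_eq_iff hp]
        exact ⟨-t, by ring, by ring⟩
      · change (meets (C.chordMap hκ _ _) (C.chordMap (add_pos hκ one_pos) _ _)).encard ≤ _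
        rw [meets_chordMap_self hκ (add_pos hκ one_pos) (by linarith) h.lt h.lt_add.le]
        simp
    · push Not at hne
      exact ⟨C.chordCurve hκ h, C.chordCurve hκ h', rfl, rfl,
        meets_chordMap_le hκ h.lt h'.lt fun t ht => hne t ht.1 ht.2⟩
  · rcases hasLift_of_eq hp hκ h hc with h1 | h1 <;> rcases hasLift_of_eq hp hκ h' hd with h2 | h2
    · exact encard_le_meets c.isPath d.isPath h1 h2
    · exact (encard_le_meets c.isPath d.isPath.reverse h1 h2).trans (meets_reverse_right _ _)
    · exact (encard_le_meets c.isPath.reverse d.isPath h1 h2).trans (meets_reverse_left _ _)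
    · exact (encard_le_meets c.isPath.reverse d.isPath.reverse h1 h2).trans
        ((meets_reverse_left _ _).trans (meets_reverse_right _ _))

/-- The curve that runs to the puncture. -/
def radialCurve (δ : ℝ) (j : ℤ) : X.Curve where
  toMap := C.radialMap δ j
  isPath := isPath_radialMap hp
  not_nullHomotopic := not_nullHomotopic_of_ne (by
    rw [radialMap_zero, radialMap_one]; exact C.pt_ne_p j)
  not_boundary := fun g hg hh => by
    have h1 := hg.2.1 1
    rw [hh.endpoints.2, radialMap_one] at h1
    exact C.norm_p.ne h1

@[simp] theorem radialCurve_toMap (δ : ℝ) (j : ℤ) :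
    (radialCurve hp δ j).toMap = C.radialMap δ j := rfl

theorem radialCurve_isSimple (δ : ℝ) (j : ℤ) : (radialCurve hp δ j).IsSimple := simple_radialMap

theorem eq_radialCurve {c : X.Curve} (h : c.toMap 0 = C.pt j ∧ c.toMap 1 = C.p ∨
    c.toMap 0 = C.p ∧ c.toMap 1 = C.pt j) :
    (⟦c⟧ : X.CurveClass) = ⟦radialCurve hp 0 j⟧ := by
  refine Quotient.sound ?_
  rcases h with ⟨h0, h1⟩ | ⟨h0, h1⟩
  · exact Or.inl (homotopic_radialMap hp c.isPath h0 h1)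
  · refine Or.inr ?_
    have := c.isPath.reverse
    have := (homotopic_radialMap hp (f := reverseMap c.toMap) (by simpa using this)
      (by simpa using h1) (by simpa using h0)).reverse
    simpa using this

theorem endpoints_of_eq_radialCurve {δ : ℝ} {c : X.Curve}
    (h : (⟦c⟧ : X.CurveClass) = ⟦radialCurve hp δ j⟧) :
    c.toMap 0 = C.pt j ∧ c.toMap 1 = C.p ∨ c.toMap 0 = C.p ∧ c.toMap 1 = C.pt j := by
  rcases Quotient.exact h with h1 | h1
  · have e := h1.endpoints
    exact Or.inl ⟨by rw [← e.1]; exact radialMap_zero, by rw [← e.2]; exact radialMap_one⟩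
  · have e := h1.endpoints
    simp only [reverseMap_apply, unitInterval.symm_zero, unitInterval.symm_one] at e
    exact Or.inr ⟨by rw [← e.1]; exact radialMap_one, by rw [← e.2]; exact radialMap_zero⟩

theorem radialCurve_eq_iff : (⟦radialCurve hp 0 j⟧ : X.CurveClass) = ⟦radialCurve hp 0 i⟧ ↔
    ∃ t : ℤ, j = i + t * C.n := by
  rw [← C.pt_eq_iff]
  constructor
  · intro h
    have h0 : (radialCurve hp 0 j).toMap 0 = C.pt j := radialMap_zero
    rcases endpoints_of_eq_radialCurve hp h with h1 | h1
    · exact h0.symm.trans h1.1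
    · exact absurd (h0.symm.trans h1.1) (C.pt_ne_p j)
  · intro h
    exact eq_radialCurve hp (Or.inl ⟨radialMap_zero.trans h, radialMap_one⟩)

theorem chordCurve_ne_radialCurve (hκ : 0 < κ) (h : C.IsProper i k) {δ : ℝ} :
    (⟦C.chordCurve hκ h⟧ : X.CurveClass) ≠ ⟦radialCurve hp δ j⟧ := by
  intro he
  rcases endpoints_of_eq_radialCurve hp he with h1 | h1
  · exact C.pt_ne_p k ((chordMap_one hκ).symm.trans h1.2)
  · exact C.pt_ne_p i ((chordMap_zero hκ).symm.trans h1.1)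

/-- Radial paths from different vertices are disjoint; for one vertex, the second path is made to
turn by an angle less than 2π. -/
theorem crossingNumber_radialCurve :
    crossingNumber (⟦radialCurve hp 0 i⟧ : X.CurveClass) ⟦radialCurve hp 0 j⟧ = 0 := by
  have key : (crossingNumber (⟦radialCurve hp 0 i⟧ : X.CurveClass) ⟦radialCurve hp 0 j⟧ : ℕ∞) = 0 := by
    refine crossingNumber_eq (by simp) ?_ fun c d _ _ => by simp
    by_cases h : ∃ t : ℤ, i = j + t * C.n
    · refine ⟨radialCurve hp 0 i, radialCurve hp 1 i, rfl, ?_, ?_⟩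
      · rw [eq_radialCurve hp (c := radialCurve hp 1 i) (Or.inl ⟨radialMap_zero, radialMap_one⟩),
          radialCurve_eq_iff]
        exact h
      · change (meets (C.radialMap 0 i) (C.radialMap 1 i)).encard ≤ 0
        rw [meets_radialMap, Set.encard_empty]
        intro t ht ht' m hm
        have h1 : (m : ℝ) * (2 * Real.pi) = -t := by linarith
        have hpi := Real.pi_gt_three
        rcases lt_trichotomy m 0 with h | rfl | h
        · have : (m : ℝ) ≤ -1 := by exact_mod_cast (by omega : m ≤ -1)
          nlinarith
        · simp at h1; linarith
        · have : (1 : ℝ) ≤ m := by exact_mod_cast h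
          nlinarith
    · refine ⟨radialCurve hp 0 i, radialCurve hp 0 j, rfl, rfl, ?_⟩
      change (meets (C.radialMap 0 i) (C.radialMap 0 j)).encard ≤ 0
      rw [meets_radialMap, Set.encard_empty]
      intro t _ _ m hm
      refine h ⟨m, ?_⟩
      rw [← C.ang_inj, C.ang_add_mul, hm]
      ring
  exact_mod_cast key

theorem crossingNumber_chordCurve_radialCurve (hκ : 0 < κ) (h : C.IsProper i k) :
    (crossingNumber (⟦C.chordCurve hκ h⟧ : X.CurveClass) ⟦radialCurve hp 0 j⟧ : ℕ∞) =
      {t : ℤ | i < j + t * C.n ∧ j + t * C.n < k}.encard := by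
  refine crossingNumber_eq (Set.Finite.encard_lt_top ?_).ne ?_ fun c d hc hd => ?_
  · refine (finite_interleave (C := C) i k j (j + C.n)).subset fun t ht => ?_
    change i < j + t * C.n ∧ j + t * C.n < k at ht
    change Interleave _ _ _ _
    have := h.lt_add
    unfold Interleave
    omega
  · exact ⟨_, _, rfl, rfl, meets_chordMap_radialMap hκ h.lt⟩
  · have hd' := endpoints_of_eq_radialCurve hp hd
    rcases hasLift_of_eq hp hκ h hc with h1 | h1 <;> rcases hd' with ⟨e0, e1⟩ | ⟨e0, e1⟩
    · exact encard_le_meets_radial hp c.isPath d.isPath h1 e0 e1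
    · exact (encard_le_meets_radial hp c.isPath d.isPath.reverse h1 (by simpa using e1)
        (by simpa using e0)).trans (meets_reverse_right _ _)
    · exact (encard_le_meets_radial hp c.isPath.reverse d.isPath h1 e0 e1).trans
        (meets_reverse_left _ _)
    · exact (encard_le_meets_radial hp c.isPath.reverse d.isPath.reverse h1 (by simpa using e1)
        (by simpa using e0)).trans ((meets_reverse_left _ _).trans (meets_reverse_right _ _))

/-- The classification of the arcs that do not cut out a once-punctured monogon. -/
theorem classification {c : X.Curve} (hs : c.IsArc)
    (hadm : ¬ CutsOutPuncturedMonogon (⟦c⟧ : X.CurveClass)) :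
    (∃ i k, (2 ≤ k - i ∧ k - i < C.n) ∧ (C.HasLift c.toMap i k ∨ C.HasLift c.toMap k i)) ∨
    ∃ j, c.toMap 0 = C.pt j ∧ c.toMap 1 = C.p ∨ c.toMap 0 = C.p ∧ c.toMap 1 = C.pt j := by
  have vert : ∀ z, z ∈ X.vertices → z ∈ X.marked ∨ z = C.p := fun z hz => hz.imp id (C.puncture z)
  rcases vert _ c.isPath.1 with h0 | h0 <;> rcases vert _ c.isPath.2.1 with h1 | h1
  · left
    obtain ⟨i, k, hl⟩ := exists_hasLift (C := C) hp h0 h1 c.isPath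
    -- Equal ends of the lift would make the curve contractible, and adjacent ends would make it
    -- homotopic to a boundary segment. Simplicity bounds the distance of the ends by n, and
    -- distance n is the excluded monogon.
    have hb : ∀ i k, C.HasLift c.toMap i k → k ≠ i ∧ k ≠ i + 1 ∧ i ≠ k + 1 := by
      intro i k h
      refine ⟨?_, ?_, ?_⟩
      · rintro rfl
        exact c.not_nullHomotopic (nullHomotopic_of_hasLift c.isPath h)
      · rintro rfl
        obtain ⟨g, hg, hgl⟩ := C.exists_isBoundarySegment i
        exact c.not_boundary g hg (homotopic_of_hasLift c.isPath hg.2.2 h hgl)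
      · rintro rfl
        obtain ⟨g, hg, hgl⟩ := C.exists_isBoundarySegment k
        have hg2 : X.IsPathBetween (reverseMap g 0) (reverseMap g 1) (reverseMap g) := by
          simpa using hg.2.2.reverse
        refine c.not_boundary (reverseMap g) ⟨?_, fun t => hg.2.1 _, hg2⟩
          (homotopic_of_hasLift c.isPath hg2 h hgl.reverse)
        exact hg.1.comp unitInterval.symm_bijective.injective
    obtain ⟨d, hd, hds⟩ := hs
    have hbound : ∀ i k, C.HasLift c.toMap i k → k ≤ i + C.n := fun i k h =>
      le_add_of_simple d.isPath hds (h.of_homotopic hp hd)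
    have hbound' : i ≤ k + C.n := by
      refine le_add_of_simple (f := reverseMap d.toMap) d.isPath.reverse ?_
        (hl.of_homotopic hp hd).reverse
      intro s hs t ht hst
      have := hds (symm_interior hs) (symm_interior ht) hst
      exact unitInterval.symm_bijective.injective this
    have h2 := hb i k hl
    have h3 := hbound i k hl
    have hne : ¬ (k = i + C.n ∨ i = k + C.n) := fun h =>
      hadm (cutsOutPuncturedMonogon hp ⟨d, hd, hds⟩ hl h)
    rcases lt_or_gt_of_ne h2.1 with h4 | h4
    · exact ⟨k, i, ⟨by omega, by omega⟩, Or.inr hl⟩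
    · exact ⟨i, k, ⟨by omega, by omega⟩, Or.inl hl⟩
  · right
    obtain ⟨j, -, hj⟩ := C.exists_pt h0
    exact ⟨j, Or.inl ⟨hj.symm, h1⟩⟩
  · right
    obtain ⟨j, -, hj⟩ := C.exists_pt h1
    exact ⟨j, Or.inr ⟨h0, hj.symm⟩⟩
  · exact absurd (nullHomotopic_of_eq_p c.isPath h0 h1) c.not_nullHomotopic

end punctured

end Chart

end MarkedDisc

/-! ### Translation of tagged arcs, compatibility and intersection numbers into combinatorial arcs
-/

namespace CombArc

open ChordSystem

variable {n : ℤ}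

theorem sum_indic_eq {P : ℤ → Prop} (h : ∀ t, P t → -3 ≤ t ∧ t ≤ 3) {m : ℕ}
    (hm : (m : ℕ∞) = {t | P t}.encard) : ∑ t ∈ Finset.Icc (-3 : ℤ) 3, indic (P t) = m := by
  classical
  have e : {t | P t} = ((Finset.Icc (-3 : ℤ) 3).filter P : Finset ℤ) := by
    ext t
    simp only [Finset.coe_filter, Finset.mem_Icc]
    exact ⟨fun ht => ⟨h t ht, ht⟩, fun ht => ht.2⟩
  rw [e, Set.encard_coe_eq_coe_finsetCard] at hm
  have hm' : m = ((Finset.Icc (-3 : ℤ) 3).filter P).card := by exact_mod_cast hm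
  rw [hm', Finset.card_filter]
  push_cast
  refine Finset.sum_congr rfl fun t _ => ?_
  unfold indic
  split_ifs <;> rfl

theorem Compat.refl {α : CombArc} (h : Valid n α) (hn : 0 < n) : Compat n α α := by
  cases α with
  | chord i k =>
    intro t ht
    have h2 : 2 ≤ k - i ∧ k - i < n := h
    unfold Interleave at ht
    rcases ht with ht | ht
    · have h1 : 0 < t := mul_lt_cancel hn (by omega)
      have := mul_add_le_mul hn h1
      omega
    · have h1 : t < 0 := mul_lt_cancel hn (by omega)
      have := mul_add_le_mul hn h1
      omega
  | rad j τ => exact Or.inl rfl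

theorem valid_rad (j : ℤ) (τ : Bool) : Valid n (rad j τ) := trivial

theorem Valid.shift {α : CombArc} (h : Valid n α) (t : ℤ) : Valid n (shift n t α) := by
  cases α with
  | chord i k =>
    have h2 : 2 ≤ k - i ∧ k - i < n := h
    exact ⟨by omega, by omega⟩
  | rad j τ => exact trivial

end CombArc

theorem Multiset.exists_map_eq {α β : Type*} {f : α → β} {Q : α → Prop} (M : Multiset β)
    (h : ∀ b ∈ M, ∃ a, Q a ∧ f a = b) : ∃ L : Multiset α, L.map f = M ∧ ∀ a ∈ L, Q a := by
  induction M using Multiset.induction with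
  | empty => exact ⟨0, by simp, by simp⟩
  | cons b M ih =>
    obtain ⟨L, hL, hQ⟩ := ih fun b hb => h b (Multiset.mem_cons_of_mem hb)
    obtain ⟨a, ha, hab⟩ := h b (Multiset.mem_cons_self _ _)
    refine ⟨a ::ₘ L, by rw [Multiset.map_cons, hab, hL], fun x hx => ?_⟩
    rcases Multiset.mem_cons.1 hx with rfl | hx
    · exact ha
    · exact hQ x hx

theorem Multiset.countP_pair {α : Type*} (Q : α → Prop) [DecidablePred Q] {a b : α} (h : ¬ Q a) :
    ((({a, b} : Multiset α).countP Q : ℕ) : ℤ) = if Q b then 1 else 0 := by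
  rw [Multiset.insert_eq_cons, Multiset.countP_cons_of_neg _ h, ← Multiset.cons_zero,
    Multiset.countP_cons]
  simp

namespace MarkedDisc

variable {X : MarkedDisc}

theorem not_isLoop_of_eq {c d : X.Curve} (h : (⟦d⟧ : X.CurveClass) = ⟦c⟧)
    (hc : c.toMap 0 ≠ c.toMap 1) : ¬ d.IsLoop := by
  intro hl
  rcases Quotient.exact h with h1 | h1
  · have e := h1.endpoints
    exact hc (by rw [e.1, e.2]; exact hl)
  · have e := h1.endpoints
    simp only [reverseMap_apply, unitInterval.symm_zero, unitInterval.symm_one] at e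
    exact hc (by rw [e.1, e.2]; exact hl.symm)

namespace TaggedArc

theorem plain_of_mem_ends (α : X.TaggedArc) {e : ℂ × ArcTag} (he : e ∈ α.ends)
    (hm : e.1 ∈ X.marked) : e.2 = ArcTag.plain := by
  induction α using Quotient.inductionOn with
  | h a =>
    change e ∈ ({(a.curve.toMap 0, a.tagStart), (a.curve.toMap 1, a.tagEnd)} :
      Multiset (ℂ × ArcTag)) at he
    rcases Multiset.mem_cons.1 he with rfl | he
    · exact a.plain_start hm
    · rw [Multiset.mem_singleton] at he
      subst he
      exact a.plain_end hm

theorem intB_eq_zero {α β : X.TaggedArc} {c : X.Curve} (h : α.underlying = ⟦c⟧)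
    (hc : c.toMap 0 ≠ c.toMap 1) : intB α β = 0 := by
  refine if_neg ?_
  rintro ⟨d, hd, hl⟩
  exact not_isLoop_of_eq (hd.trans h) hc hl

/-- An arc with ends at marked points only does not contribute to `D`. -/
theorem intD_eq_zero {α β : X.TaggedArc} (h : ∀ e ∈ α.ends, e.1 ∈ X.marked) : intD α β = 0 := by
  classical
  unfold intD
  rw [Nat.cast_eq_zero, Multiset.countP_eq_zero]
  rintro e he ⟨e', he', h1, h2⟩
  have hm := h e' he'
  refine h2 ?_
  rw [plain_of_mem_ends α he' hm, plain_of_mem_ends β he (h1 ▸ hm)]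

theorem Compatible.symm {A B : X.TaggedArc} (h : A.Compatible B) : B.Compatible A := by
  obtain ⟨h1, h2, h3⟩ := h
  refine ⟨by rw [crossingNumber_comm]; exact h1, fun hne e he e' he' hee =>
    (h2 (Ne.symm hne) e' he' e he hee.symm).symm, fun he => ?_⟩
  obtain ⟨a, b, ha, hb, hh, ht⟩ := h3 he.symm
  exact ⟨b, a, hb, ha, hh.symm, ht.imp Eq.symm Eq.symm⟩

end TaggedArc

namespace Chart

open CombArc ChordSystem

/-- The tags, as truth values. -/
def tag : Bool → ArcTag
  | true => ArcTag.plain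
  | false => ArcTag.notched

theorem tag_inj {τ ρ : Bool} : tag τ = tag ρ ↔ τ = ρ := by
  cases τ <;> cases ρ <;> simp [tag]

theorem exists_tag (x : ArcTag) : ∃ τ, tag τ = x := by
  cases x
  · exact ⟨true, rfl⟩
  · exact ⟨false, rfl⟩

variable {C : Chart X} (hp : C.p ∈ X.punctures)

/-- The curve under a combinatorial arc. -/
def arcCurve : (α : CombArc) → Valid C.n α → X.Curve
  | chord _ _, h => C.chordCurve one_pos (isProper hp h)
  | rad j _, _ => radialCurve hp 0 j

/-- The tag at the end of a combinatorial arc. -/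
def endTag : CombArc → ArcTag
  | chord _ _ => ArcTag.plain
  | rad _ τ => tag τ

theorem arcCurve_ne (α : CombArc) (h : Valid C.n α) :
    (arcCurve hp α h).toMap 0 ≠ (arcCurve hp α h).toMap 1 := by
  cases α with
  | chord i k =>
    change C.chordMap one_pos i k 0 ≠ C.chordMap one_pos i k 1
    rw [chordMap_zero, chordMap_one]
    exact (isProper hp h).pt_ne
  | rad j τ =>
    change C.radialMap 0 j 0 ≠ C.radialMap 0 j 1
    rw [radialMap_zero, radialMap_one]
    exact C.pt_ne_p j

theorem arcCurve_isArc (α : CombArc) (h : Valid C.n α) : (arcCurve hp α h).IsArc := by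
  refine ⟨_, (arcCurve hp α h).homotopic_refl, ?_⟩
  cases α with
  | chord i k => exact chordCurve_isSimple one_pos (isProper hp h)
  | rad j τ => exact radialCurve_isSimple hp 0 j

/-- The tagged curve given by a combinatorial arc. -/
def taggedCurve (α : CombArc) (h : Valid C.n α) : X.TaggedCurve where
  curve := arcCurve hp α h
  isArc := arcCurve_isArc hp α h
  tagStart := ArcTag.plain
  tagEnd := endTag α
  plain_start _ := rfl
  plain_end he := by
    cases α with
    | chord i k => rfl
    | rad j τ =>
      change C.radialMap 0 j 1 ∈ X.marked at he
      rw [radialMap_one] at he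
      exact absurd he C.p_not_mem
  loop he := absurd he (arcCurve_ne hp α h)

open Classical in
/-- The tagged arc given by a combinatorial arc. -/
def toArc (α : CombArc) : X.TaggedArc :=
  -- The second value is a default for invalid arcs, chosen only to make the function total.
  if h : Valid C.n α then ⟦taggedCurve hp α h⟧ else ⟦taggedCurve hp (rad 0 true) (valid_rad _ _)⟧

variable {α β : CombArc}

theorem toArc_of_valid (h : Valid C.n α) : toArc hp α = ⟦taggedCurve hp α h⟧ := dif_pos h

theorem underlying_toArc (h : Valid C.n α) : (toArc hp α).underlying = ⟦arcCurve hp α h⟧ := by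
  rw [toArc_of_valid hp h]; rfl

theorem ends_toArc_chord {i k : ℤ} (h : Valid C.n (chord i k)) : (toArc hp (chord i k)).ends =
    {(C.pt i, ArcTag.plain), (C.pt k, ArcTag.plain)} := by
  rw [toArc_of_valid hp h, ← chordMap_zero (C := C) (k := k) one_pos, ← chordMap_one (C := C) (i := i) one_pos]
  rfl

theorem ends_toArc_rad (j : ℤ) (τ : Bool) : (toArc hp (rad j τ)).ends =
    {(C.pt j, ArcTag.plain), (C.p, tag τ)} := by
  rw [toArc_of_valid hp (valid_rad j τ), ← radialMap_zero (C := C) (δ := 0),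
    ← radialMap_one (C := C) (δ := 0) (j := j)]
  rfl

theorem ends_marked {i k : ℤ} (h : Valid C.n (chord i k)) :
    ∀ e ∈ (toArc hp (chord i k)).ends, e.1 ∈ X.marked := by
  rw [ends_toArc_chord hp h]
  intro e he
  rcases Multiset.mem_cons.1 he with rfl | he
  · exact C.pt_mem i
  · rw [Multiset.mem_singleton] at he
    subst he
    exact C.pt_mem k

theorem toArc_shift (h : Valid C.n α) (t : ℤ) : toArc hp (shift C.n t α) = toArc hp α := by
  rw [toArc_of_valid hp h, toArc_of_valid hp (h.shift t)]
  refine Quotient.sound (Or.inl ⟨?_, rfl, ?_⟩)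
  · cases α with
    | chord i k =>
      exact homotopic_of_hasLift (arcCurve hp _ (h.shift t)).isPath (arcCurve hp _ h).isPath
        (hasLift_chordMap one_pos) ((hasLift_chordMap one_pos).shift t)
    | rad j τ =>
      exact homotopic_radialMap hp (arcCurve hp _ (h.shift t)).isPath
        (radialMap_zero.trans (C.pt_eq_iff.2 ⟨t, rfl⟩)) radialMap_one
  · cases α <;> rfl

theorem isAdmissible_toArc (h : Valid C.n α) : (toArc hp α).IsAdmissible := by
  rw [TaggedArc.IsAdmissible, underlying_toArc hp h]
  exact not_cutsOutPuncturedMonogon (arcCurve_ne hp α h)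

theorem exists_toArc_valid {A : X.TaggedArc} (hA : A.IsAdmissible) :
    ∃ α, Valid C.n α ∧ toArc hp α = A := by
  induction A using Quotient.inductionOn with
  | h a =>
    have plain : ∀ z ∈ X.vertices, z ≠ C.p → z ∈ X.marked := fun z hz hne =>
      hz.resolve_right fun h => hne (C.puncture z h)
    rcases classification hp a.isArc hA with ⟨i, k, hik, hl⟩ | ⟨j, hj⟩
    · have hv : Valid C.n (chord i k) := hik
      have ha : a.tagStart = ArcTag.plain ∧ a.tagEnd = ArcTag.plain := by
        rcases hl with hl | hl
        · exact ⟨a.plain_start (hl.apply_zero ▸ C.pt_mem i),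
            a.plain_end (hl.apply_one ▸ C.pt_mem k)⟩
        · exact ⟨a.plain_start (hl.apply_zero ▸ C.pt_mem k),
            a.plain_end (hl.apply_one ▸ C.pt_mem i)⟩
      refine ⟨chord i k, hv, ?_⟩
      rw [toArc_of_valid hp hv]
      refine (Quotient.sound ?_).symm
      rcases Quotient.exact (eq_chordCurve one_pos (isProper hp hik) hl) with h | h
      · exact Or.inl ⟨h, ha.1, ha.2⟩
      · exact Or.inr ⟨h, ha.1, ha.2⟩
    · rcases hj with ⟨h0, h1⟩ | ⟨h0, h1⟩
      · obtain ⟨τ, hτ⟩ := exists_tag a.tagEnd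
        refine ⟨rad j τ, valid_rad j τ, ?_⟩
        rw [toArc_of_valid hp (valid_rad j τ)]
        refine (Quotient.sound (Or.inl ⟨homotopic_radialMap hp a.curve.isPath h0 h1, ?_, hτ.symm⟩)).symm
        exact a.plain_start (h0 ▸ C.pt_mem j)
      · obtain ⟨τ, hτ⟩ := exists_tag a.tagStart
        refine ⟨rad j τ, valid_rad j τ, ?_⟩
        rw [toArc_of_valid hp (valid_rad j τ)]
        refine (Quotient.sound (Or.inr ⟨?_, hτ.symm, a.plain_end (h1 ▸ C.pt_mem j)⟩)).symm
        have h2 : X.IsPathBetween (reverseMap a.curve.toMap 0) (reverseMap a.curve.toMap 1)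
            (reverseMap a.curve.toMap) := by simpa using a.curve.isPath.reverse
        have h3 := (homotopic_radialMap hp h2 (by simpa using h1) (by simpa using h0)).reverse
        rw [reverseMap_reverseMap] at h3
        exact h3

theorem exists_toArc {A : X.TaggedArc} (hA : A.IsAdmissible) :
    ∃ α, (Valid C.n α ∧ Normalized C.n α) ∧ toArc hp α = A := by
  obtain ⟨α, hv, rfl⟩ := exists_toArc_valid hp hA
  have key : ∀ j : ℤ, ∃ q : ℤ, 0 ≤ j + q * C.n ∧ j + q * C.n < C.n := fun j => by
    obtain ⟨q, r, h1, h2, h3, -⟩ := exists_quotient C.n_pos 0 j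
    have e : j + -q * C.n = r := by rw [h1]; ring
    exact ⟨-q, by omega, by omega⟩
  cases α with
  | chord i k =>
    obtain ⟨q, hq⟩ := key i
    exact ⟨shift C.n q (chord i k), ⟨hv.shift q, hq⟩, toArc_shift hp hv q⟩
  | rad j τ =>
    obtain ⟨q, hq⟩ := key j
    exact ⟨shift C.n q (rad j τ), ⟨hv.shift q, hq⟩, toArc_shift hp hv q⟩

theorem compatible_iff_of_marked {A B : X.TaggedArc} (h : ∀ e ∈ A.ends, e.1 ∈ X.marked)
    (hAB : A.underlying = B.underlying → ∃ a b : X.TaggedCurve, ⟦a⟧ = A ∧ ⟦b⟧ = B ∧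
      X.Homotopic a.curve.toMap b.curve.toMap ∧ (a.tagStart = b.tagStart ∨ a.tagEnd = b.tagEnd)) :
    A.Compatible B ↔ crossingNumber A.underlying B.underlying = 0 := by
  refine ⟨fun hc => hc.1, fun hc => ⟨hc, fun _ e he e' he' hee => ?_, hAB⟩⟩
  rw [A.plain_of_mem_ends he (h e he), B.plain_of_mem_ends he' (hee ▸ h e he)]

theorem natCast_eq_zero_iff_encard {m : ℕ} {P : ℤ → Prop} (h : (m : ℕ∞) = {t | P t}.encard) :
    m = 0 ↔ ∀ t, ¬ P t := by
  have : m = 0 ↔ (m : ℕ∞) = 0 := by simp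
  rw [this, h, Set.encard_eq_zero, Set.eq_empty_iff_forall_notMem]
  exact Iff.rfl

/-- The ends of a chord are marked points, where all tags are plain, and its class differs from that
of an arc to the puncture; only the crossing number matters. -/
theorem compatible_toArc_chord_rad {i k c : ℤ} {ρ : Bool} (h : Valid C.n (chord i k)) :
    (toArc hp (chord i k)).Compatible (toArc hp (rad c ρ)) ↔
      Compat C.n (chord i k) (rad c ρ) := by
  rw [compatible_iff_of_marked (ends_marked hp h)]
  · rw [underlying_toArc hp h, underlying_toArc hp (valid_rad c ρ)]
    exact natCast_eq_zero_iff_encard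
      (crossingNumber_chordCurve_radialCurve hp one_pos (isProper hp h))
  · rw [underlying_toArc hp h, underlying_toArc hp (valid_rad c ρ)]
    exact fun he => absurd he (chordCurve_ne_radialCurve hp one_pos (isProper hp h))

theorem dvd_sub_iff {n j c : ℤ} : n ∣ j - c ↔ ∃ t : ℤ, j = c + t * n :=
  ⟨fun ⟨t, ht⟩ => ⟨t, by linarith⟩, fun ⟨t, ht⟩ => ⟨t, by linarith⟩⟩

/-- Compatibility of tagged arcs is compatibility of combinatorial arcs. -/
theorem compatible_toArc (hα : Valid C.n α) (hβ : Valid C.n β) :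
    (toArc hp α).Compatible (toArc hp β) ↔ Compat C.n α β := by
  cases α with
  | chord i k =>
    cases β with
    | chord c d =>
      rw [compatible_iff_of_marked (ends_marked hp hα)]
      · rw [underlying_toArc hp hα, underlying_toArc hp hβ]
        exact natCast_eq_zero_iff_encard
          (crossingNumber_chordCurve hp one_pos (isProper hp hα) (isProper hp hβ))
      · intro he
        rw [underlying_toArc hp hα, underlying_toArc hp hβ] at he
        obtain ⟨t, rfl, rfl⟩ := (chordCurve_eq_iff hp one_pos (isProper hp hα)
          (isProper hp hβ)).1 he
        have := toArc_shift hp hα t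
        refine ⟨taggedCurve hp _ hα, taggedCurve hp _ hα, (toArc_of_valid hp hα).symm, ?_,
          Curve.homotopic_refl _, Or.inl rfl⟩
        rw [← toArc_of_valid]; exact this.symm
    | rad c ρ => exact compatible_toArc_chord_rad hp hα
  | rad j τ =>
    cases β with
    | chord c d =>
      have := compatible_toArc_chord_rad hp (c := j) (ρ := τ) hβ
      exact ⟨fun h => (this.1 h.symm).symm,
        fun h => (this.2 h.symm).symm⟩
    | rad c ρ =>
      have hund : (toArc hp (rad j τ)).underlying = (toArc hp (rad c ρ)).underlying ↔
          C.n ∣ j - c := by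
        rw [underlying_toArc hp (valid_rad j τ), underlying_toArc hp (valid_rad c ρ), dvd_sub_iff]
        exact radialCurve_eq_iff hp
      constructor
      · intro h
        by_cases hd : C.n ∣ j - c
        · exact Or.inr hd
        · have := h.2.1 (fun he => hd (hund.1 he)) (C.p, tag τ) (by rw [ends_toArc_rad]; simp)
            (C.p, tag ρ) (by rw [ends_toArc_rad]; simp) rfl
          exact Or.inl (tag_inj.1 this)
      · intro h
        refine ⟨?_, fun hne e he e' he' hee => ?_, fun he => ?_⟩
        · rw [underlying_toArc hp (valid_rad j τ), underlying_toArc hp (valid_rad c ρ)]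
          exact crossingNumber_radialCurve hp
        · have hτ : τ = ρ := h.resolve_right fun hd => hne (hund.2 hd)
          subst hτ
          by_cases hm : e.1 ∈ X.marked
          · rw [TaggedArc.plain_of_mem_ends _ he hm, TaggedArc.plain_of_mem_ends _ he' (hee ▸ hm)]
          · have key : ∀ j, ∀ e ∈ (toArc hp (rad j τ)).ends, e.1 ∉ X.marked → e.2 = tag τ := by
              intro j e he hm
              rw [ends_toArc_rad] at he
              rcases Multiset.mem_cons.1 he with rfl | he
              · exact absurd (C.pt_mem j) hm
              · rw [Multiset.mem_singleton] at he
                subst he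
                rfl
            rw [key j e he hm, key c e' he' (hee ▸ hm)]
        · rw [hund, dvd_sub_iff] at he
          refine ⟨taggedCurve hp (rad j τ) (valid_rad j τ), taggedCurve hp (rad c ρ) (valid_rad c ρ),
            (toArc_of_valid hp _).symm, (toArc_of_valid hp _).symm, ?_, Or.inl rfl⟩
          exact homotopic_radialMap hp (arcCurve hp (rad j τ) (valid_rad j τ)).isPath
            (radialMap_zero.trans (C.pt_eq_iff.2 he)) radialMap_one

open Classical in
/-- Intersection numbers of a chord. -/
theorem int_toArc_chord {i k : ℤ} (h : Valid C.n (chord i k)) (hi : -C.n ≤ i) (hk : k ≤ 2 * C.n)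
    (hα : Valid C.n α) (hα' : Normalized C.n α) :
    TaggedArc.int (toArc hp (chord i k)) (toArc hp α) = inter (lifts C.n α) i k := by
  have hn := C.n_pos
  have hcusp : cusp C.n = 10 * C.n := rfl
  have hu := underlying_toArc hp h
  rw [TaggedArc.int, TaggedArc.intB_eq_zero hu (arcCurve_ne hp _ h),
    TaggedArc.intD_eq_zero (ends_marked hp h), add_zero, add_zero, TaggedArc.intA,
    TaggedArc.intC, hu, underlying_toArc hp hα, inter, sub_eq_add_neg]
  have hb : ∀ t : ℤ, -4 * C.n < t * C.n → t * C.n < 4 * C.n → -3 ≤ t ∧ t ≤ 3 := fun t h1 h2 => by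
    have := mul_lt_cancel hn h1
    have := mul_lt_cancel hn h2
    omega
  have hv : 2 ≤ k - i ∧ k - i < C.n := h
  cases α with
  | chord a b =>
    have hα1 : 2 ≤ b - a ∧ b - a < C.n := hα
    have hα2 : 0 ≤ a ∧ a < C.n := hα'
    congr 1
    · rw [crossCount, cnt_lifts_chord]
      refine (sum_indic_eq (fun t ht => hb t ?_ ?_) (crossingNumber_chordCurve hp one_pos
        (isProper hp h) (isProper hp hα))).symm <;> unfold Interleave at ht <;>
        omega
    · rw [mult, cnt_lifts_chord]
      have he := chordCurve_eq_iff hp one_pos (isProper hp h) (isProper hp hα)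
      split_ifs with hif
      · obtain ⟨t, ht⟩ := he.1 hif
        rw [sum_window_eq_single (t := -t)]
        · rw [indic_pos (by simp only [ht]; constructor <;> ring)]
        · have : -t * C.n = -(t * C.n) := by ring
          exact hb _ (by omega) (by omega)
        · intro s _ hs
          refine indic_neg fun h' => hs ?_
          simp only at h'
          have e : s * C.n = -t * C.n := by rw [neg_mul]; omega
          exact mul_right_cancel₀ hn.ne' e
      · rw [Finset.sum_eq_zero, neg_zero]
        intro t _
        refine indic_neg fun h' => hif (he.2 ⟨-t, ?_, ?_⟩) <;> simp only at h' <;>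
          rw [neg_mul] <;> omega
  | rad c ρ =>
    have hα2 : 0 ≤ c ∧ c < C.n := hα'
    congr 1
    · rw [crossCount, cnt_lifts_rad]
      have h1 := sum_indic_eq (fun t ht => hb t (by omega) (by omega))
        (crossingNumber_chordCurve_radialCurve hp (j := c) one_pos (isProper hp h))
      refine Eq.trans h1.symm (Finset.sum_congr rfl fun t _ => indic_congr ?_)
      unfold Interleave
      simp only
      omega
    · have hne : (⟦arcCurve hp (chord i k) h⟧ : X.CurveClass) ≠ ⟦arcCurve hp (rad c ρ) hα⟧ :=
        chordCurve_ne_radialCurve hp one_pos (isProper hp h)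
      rw [if_neg hne, mult, cnt_lifts_rad,
        Finset.sum_eq_zero, neg_zero]
      intro t _
      refine indic_neg fun h' => ?_
      simp only at h'
      omega

open Classical in
/-- Intersection numbers of an arc that ends at the puncture. -/
theorem int_toArc_rad {j : ℤ} {τ : Bool} (hj : -C.n ≤ j ∧ j ≤ 2 * C.n) (hα : Valid C.n α)
    (hα' : Normalized C.n α) :
    TaggedArc.int (toArc hp (rad j τ)) (toArc hp α) = radInter C.n j τ α := by
  have hn := C.n_pos
  have hcusp : cusp C.n = 10 * C.n := rfl
  have hu := underlying_toArc hp (valid_rad j τ)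
  rw [TaggedArc.int, TaggedArc.intB_eq_zero hu (arcCurve_ne hp _ (valid_rad j τ)), add_zero,
    TaggedArc.intA, TaggedArc.intC, hu, underlying_toArc hp hα]
  cases α with
  | chord a b =>
    have hα1 : 2 ≤ b - a ∧ b - a < C.n := hα
    have hα2 : 0 ≤ a ∧ a < C.n := hα'
    have hD : TaggedArc.intD (toArc hp (rad j τ)) (toArc hp (chord a b)) = 0 := by
      unfold TaggedArc.intD
      rw [Nat.cast_eq_zero, Multiset.countP_eq_zero]
      rintro e he ⟨e', he', h1, h2⟩
      have hm := ends_marked hp hα e he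
      refine h2 ?_
      rw [TaggedArc.plain_of_mem_ends _ he hm, TaggedArc.plain_of_mem_ends _ he' (h1 ▸ hm)]
    have hne : (⟦arcCurve hp (rad j τ) (valid_rad j τ)⟧ : X.CurveClass) ≠
        ⟦arcCurve hp (chord a b) hα⟧ :=
      (chordCurve_ne_radialCurve hp one_pos (isProper hp hα)).symm
    rw [hD, if_neg hne, add_zero, add_zero, crossingNumber_comm, radInter, crossCount,
      cnt_lifts_chord]
    -- Translating the vertex by t amounts to translating the chord by -t.
    have h2 : {t : ℤ | a < j + t * C.n ∧ j + t * C.n < b}.encard =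
        {t : ℤ | a + t * C.n < j ∧ j < b + t * C.n}.encard := by
      rw [← neg_injective.encard_image]
      congr 1
      ext t
      simp only [Set.image_neg_eq_neg, Set.mem_neg]
      change a < j + -t * C.n ∧ j + -t * C.n < b ↔ a + t * C.n < j ∧ j < b + t * C.n
      have e : -t * C.n = -(t * C.n) := by ring
      rw [e]
      constructor <;> intro ht <;> omega
    have h1 := (crossingNumber_chordCurve_radialCurve hp (j := j) one_pos (isProper hp hα)).trans h2
    refine Eq.trans (sum_indic_eq (fun t ht => ?_) h1).symm
      (Finset.sum_congr rfl fun t ht => indic_congr ?_)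
    · have := mul_lt_cancel (t := -4) (s := t) hn (by omega)
      have := mul_lt_cancel (t := t) (s := 4) hn (by omega)
      omega
    · have := window_bounds hn (Finset.mem_Icc.1 ht)
      change _ ↔ Interleave j (cusp C.n) (a + t * C.n) (b + t * C.n)
      unfold Interleave
      omega
  | rad c ρ =>
    have hα2 : 0 ≤ c ∧ c < C.n := hα'
    have hD : TaggedArc.intD (toArc hp (rad j τ)) (toArc hp (rad c ρ)) = indic (ρ ≠ τ) := by
      unfold TaggedArc.intD indic
      rw [ends_toArc_rad hp c, ends_toArc_rad hp j]
      have hc : ¬ ∃ e' ∈ ({(C.pt j, ArcTag.plain), (C.p, tag τ)} : Multiset (ℂ × ArcTag)),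
          e'.1 = (C.pt c, ArcTag.plain).1 ∧ e'.2 ≠ (C.pt c, ArcTag.plain).2 := by
        rintro ⟨e', he', h1, h2⟩
        rcases Multiset.mem_cons.1 he' with rfl | he'
        · exact h2 rfl
        · rw [Multiset.mem_singleton] at he'
          subst he'
          exact C.pt_ne_p c h1.symm
      have hd : (∃ e' ∈ ({(C.pt j, ArcTag.plain), (C.p, tag τ)} : Multiset (ℂ × ArcTag)),
          e'.1 = (C.p, tag ρ).1 ∧ e'.2 ≠ (C.p, tag ρ).2) ↔ ρ ≠ τ := by
        constructor
        · rintro ⟨e', he', h1, h2⟩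
          rcases Multiset.mem_cons.1 he' with rfl | he'
          · exact absurd h1 (C.pt_ne_p j)
          · rw [Multiset.mem_singleton] at he'
            subst he'
            exact fun h => h2 (tag_inj.2 h.symm)
        · intro h
          exact ⟨(C.p, tag τ), by simp, rfl, fun h' => h (tag_inj.1 h').symm⟩
      exact (Multiset.countP_pair (fun e : ℂ × ArcTag => ∃ e' ∈ ({(C.pt j, ArcTag.plain),
        (C.p, tag τ)} : Multiset (ℂ × ArcTag)), e'.1 = e.1 ∧ e'.2 ≠ e.2) hc).trans
          (by by_cases h : ρ ≠ τ
              · rw [if_pos (hd.2 h), if_pos h]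
              · rw [if_neg (fun h' => h (hd.1 h')), if_neg h])
    have hcr : crossingNumber (⟦arcCurve hp (rad j τ) (valid_rad j τ)⟧ : X.CurveClass)
        ⟦arcCurve hp (rad c ρ) hα⟧ = 0 := crossingNumber_radialCurve hp
    have he : ((⟦arcCurve hp (rad j τ) (valid_rad j τ)⟧ : X.CurveClass) =
        ⟦arcCurve hp (rad c ρ) hα⟧) ↔ C.n ∣ j - c := by
      rw [dvd_sub_iff]; exact radialCurve_eq_iff hp
    rw [hD, hcr, radInter, Nat.cast_zero, zero_add]
    by_cases h : C.n ∣ j - c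
    · rw [if_pos (he.2 h), indic_pos h]; ring
    · rw [if_neg (fun h' => h (he.1 h')), indic_neg h]; ring

end Chart

end MarkedDisc

/-! ### The once-punctured disc -/

namespace MarkedDisc

open CombArc ChordSystem

variable {X : MarkedDisc}

/-- An admissible tagged arc that is compatible with itself and with all arcs of a tagged
triangulation belongs to it. -/
theorem IsTaggedTriangulation.mem {T : Set X.TaggedArc} (hT : IsTaggedTriangulation T)
    {A : X.TaggedArc} (hA : A.IsAdmissible) (h : ∀ B ∈ T, A.Compatible B) : A ∈ T := by
  have h1 := hT.prop
  refine hT.mem_of_prop_insert ⟨?_, h1.2.insert fun B hB _ =>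
    ⟨h B hB, (h B hB).symm⟩⟩
  rintro B (rfl | hB)
  · exact hA
  · exact h1.1 B hB

theorem sum_int_eq {T : Set X.TaggedArc} {M N : Multiset X.TaggedArc}
    (hint : intVector T M = intVector T N) {A : X.TaggedArc} (hA : A ∈ T) :
    (M.map fun B => TaggedArc.int A B).sum = (N.map fun B => TaggedArc.int A B).sum :=
  congrFun hint ⟨A, hA⟩

namespace Chart

variable {C : Chart X} (hp : C.p ∈ X.punctures)

/-- Pairwise compatibility says nothing about two representatives of the same arc; for these it
follows from the compatibility of a valid arc with itself. -/
theorem compat_of_pairwise {U : Set X.TaggedArc} (hU : U.Pairwise TaggedArc.Compatible)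
    {α β : CombArc} (hα : Valid C.n α) (hβ : Valid C.n β) (h1 : toArc hp α ∈ U)
    (h2 : toArc hp β ∈ U) : Compat C.n α β := by
  rw [← compatible_toArc hp hα hβ]
  by_cases h : toArc hp α = toArc hp β
  · rw [← h, compatible_toArc hp hα hα]
    exact Compat.refl hα C.n_pos
  · exact hU h1 h2 h

theorem isTriangulation {T : Set X.TaggedArc} (hT : IsTaggedTriangulation T) :
    IsTriangulation C.n {α | Valid C.n α ∧ toArc hp α ∈ T} where
  valid _ h := h.1
  shift α h t := ⟨h.1.shift t, by rw [toArc_shift hp h.1]; exact h.2⟩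
  compat _ hα _ hβ := compat_of_pairwise hp hT.prop.2 hα.1 hβ.1 hα.2 hβ.2
  maximal α hα h := by
    refine ⟨hα, hT.mem (isAdmissible_toArc hp hα) fun B hB => ?_⟩
    obtain ⟨β, hβ, rfl⟩ := exists_toArc_valid hp (hT.prop.1 B hB)
    exact (compatible_toArc hp hα hβ).2 (h β ⟨hβ, hB⟩)

theorem exists_isSystem {M : Multiset X.TaggedArc} (hM : ∀ A ∈ M, A.IsAdmissible)
    (hMc : {A | A ∈ M}.Pairwise TaggedArc.Compatible) :
    ∃ L : Multiset CombArc, L.map (toArc hp) = M ∧ IsSystem C.n L := by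
  obtain ⟨L, rfl, hQ⟩ := Multiset.exists_map_eq M fun A hA => exists_toArc hp (hM A hA)
  refine ⟨L, rfl, fun α hα => (hQ α hα).1, fun α hα => (hQ α hα).2, fun α hα β hβ => ?_⟩
  exact compat_of_pairwise hp hMc (hQ α hα).1 (hQ β hβ).1 (Multiset.mem_map_of_mem _ hα)
    (Multiset.mem_map_of_mem _ hβ)

include hp in
theorem eq_of_intVector_eq {T : Set X.TaggedArc} (hT : IsTaggedTriangulation T)
    {M N : Multiset X.TaggedArc} (hM : ∀ A ∈ M, A.IsAdmissible) (hN : ∀ A ∈ N, A.IsAdmissible)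
    (hMc : {A | A ∈ M}.Pairwise TaggedArc.Compatible)
    (hNc : {A | A ∈ N}.Pairwise TaggedArc.Compatible)
    (hint : intVector T M = intVector T N) : M = N := by
  obtain ⟨L, rfl, hL⟩ := exists_isSystem hp hM hMc
  obtain ⟨K, rfl, hK⟩ := exists_isSystem hp hN hNc
  refine congrArg _ (hL.eq_of_inter_eq C.four_le (isTriangulation hp hT) hK ?_ ?_)
  · intro i k hik hi hk
    have h := sum_int_eq hint hik.2
    rw [Multiset.map_map, Multiset.map_map] at h
    rw [inter_bind, inter_bind]
    have e : ∀ L : Multiset CombArc, IsSystem C.n L →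
        (L.map fun α => inter (lifts C.n α) i k) =
          L.map ((fun B => TaggedArc.int (toArc hp (chord i k)) B) ∘ toArc hp) := fun L hL =>
      Multiset.map_congr rfl fun α hα =>
        (int_toArc_chord hp hik.1 hi hk (hL.valid α hα) (hL.normalized α hα)).symm
    rw [e L hL, e K hK, h]
  · intro j τ hjτ h1 h2
    have h := sum_int_eq hint hjτ.2
    rw [Multiset.map_map, Multiset.map_map] at h
    have e : ∀ L : Multiset CombArc, IsSystem C.n L → L.map (radInter C.n j τ) =
          L.map ((fun B => TaggedArc.int (toArc hp (rad j τ)) B) ∘ toArc hp) := fun L hL =>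
      Multiset.map_congr rfl fun α hα =>
        (int_toArc_rad hp ⟨h1, h2⟩ (hL.valid α hα) (hL.normalized α hα)).symm
    rw [e L hL, e K hK, h]

end Chart

end MarkedDisc

/-! ### The disc without punctures -/

namespace MarkedDisc

variable {X : MarkedDisc}

namespace Chart

open ChordSystem

variable {C : Chart X} {i k a b : ℤ} {p q : ℤ × ℤ}

theorem pt_injOn (hi : 0 ≤ i ∧ i < C.n) (hk : 0 ≤ k ∧ k < C.n) (h : C.pt i = C.pt k) : i = k := by
  obtain ⟨t, ht⟩ := C.pt_eq_iff.1 h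
  exact (CombArc.eq_of_add_mul (t := 0) (t' := t) hi hk (by omega)).1

/-- Only endpoints are compared, as lifts are not preserved by homotopies that may pass the center.
A boundary segment joins adjacent residues modulo n, and the bound n - 1 excludes the pair of 0 and
n - 1. -/
theorem isProper_of_isDiagonal (h : IsDiagonal C.n p) : C.IsProper p.1 p.2 := by
  obtain ⟨h1, h2, h3, h4⟩ := h
  refine ⟨by omega, by omega, fun κ hκ g hg hh => ?_⟩
  have e := hh.endpoints
  rw [chordMap_zero, chordMap_one] at e
  obtain ⟨k', hl, h5, h6⟩ := exists_hasLift_of_isBoundarySegment hg e.1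
  obtain ⟨t, rfl⟩ := C.pt_eq_iff.1 (hl.apply_one.symm.trans e.2)
  have h7 : t < 0 := CombArc.mul_lt_cancel C.n_pos (by omega)
  have := CombArc.mul_add_le_mul C.n_pos h7
  omega

theorem endpoints_of_eq_chordCurve {κ : ℝ} {hκ : 0 < κ} {h : C.IsProper i k} {c : X.Curve}
    (hc : (⟦c⟧ : X.CurveClass) = ⟦C.chordCurve hκ h⟧) :
    c.toMap 0 = C.pt i ∧ c.toMap 1 = C.pt k ∨ c.toMap 0 = C.pt k ∧ c.toMap 1 = C.pt i := by
  rcases Quotient.exact hc with h1 | h1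
  · have e := h1.endpoints
    rw [chordCurve_toMap, chordMap_zero, chordMap_one] at e
    exact Or.inl ⟨e.1.symm, e.2.symm⟩
  · have e := h1.endpoints
    simp only [reverseMap_apply, unitInterval.symm_zero, unitInterval.symm_one] at e
    rw [chordCurve_toMap, chordMap_zero, chordMap_one] at e
    exact Or.inr ⟨e.1.symm, e.2.symm⟩

/-- The tagged curve given by a diagonal. -/
def diagonalCurve (p : ℤ × ℤ) (h : IsDiagonal C.n p) : X.TaggedCurve where
  curve := C.chordCurve one_pos (isProper_of_isDiagonal h)
  isArc := ⟨_, Curve.homotopic_refl _, chordCurve_isSimple _ _⟩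
  tagStart := ArcTag.plain
  tagEnd := ArcTag.plain
  plain_start _ := rfl
  plain_end _ := rfl
  loop _ := rfl

theorem isDiagonal_zero_two (C : Chart X) : IsDiagonal C.n (0, 2) := by
  have := C.four_le
  refine ⟨le_rfl, ?_, ?_, ?_⟩ <;> simp only <;> omega

open Classical in
variable (C) in
/-- The tagged arc given by a diagonal. -/
def diagonalArc (p : ℤ × ℤ) : X.TaggedArc :=
  -- The diagonal (0, 2), available because there are at least four marked points, is a default
  -- value.
  if h : IsDiagonal C.n p then ⟦diagonalCurve p h⟧ else ⟦diagonalCurve _ C.isDiagonal_zero_two⟧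

theorem diagonalArc_of_isDiagonal (h : IsDiagonal C.n p) :
    C.diagonalArc p = ⟦diagonalCurve p h⟧ := dif_pos h

theorem underlying_diagonalArc (h : IsDiagonal C.n p) :
    (C.diagonalArc p).underlying = ⟦C.chordCurve one_pos (isProper_of_isDiagonal h)⟧ := by
  rw [diagonalArc_of_isDiagonal h]; rfl

theorem chordCurve_ends_ne (h : IsDiagonal C.n p) :
    (C.chordCurve one_pos (isProper_of_isDiagonal h)).toMap 0 ≠
      (C.chordCurve one_pos (isProper_of_isDiagonal h)).toMap 1 := by
  rw [chordCurve_toMap, chordMap_zero, chordMap_one]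
  exact (isProper_of_isDiagonal h).pt_ne

theorem isAdmissible_diagonalArc (h : IsDiagonal C.n p) : (C.diagonalArc p).IsAdmissible := by
  rw [TaggedArc.IsAdmissible, underlying_diagonalArc h]
  exact not_cutsOutPuncturedMonogon (chordCurve_ends_ne h)

theorem ends_diagonalArc_marked (h : IsDiagonal C.n p) :
    ∀ e ∈ (C.diagonalArc p).ends, e.1 ∈ X.marked := by
  rw [diagonalArc_of_isDiagonal h]
  intro e he
  change e ∈ ({(C.chordMap one_pos p.1 p.2 0, ArcTag.plain),
    (C.chordMap one_pos p.1 p.2 1, ArcTag.plain)} : Multiset (ℂ × ArcTag)) at he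
  rcases Multiset.mem_cons.1 he with rfl | he
  · exact chordMap_zero (C := C) (k := p.2) one_pos ▸ C.pt_mem p.1
  · rw [Multiset.mem_singleton] at he
    subst he
    exact chordMap_one (C := C) (i := p.1) one_pos ▸ C.pt_mem p.2

theorem chordCurve_eq_iff_of_isDiagonal (h : IsDiagonal C.n p) (h' : IsDiagonal C.n q) :
    (⟦C.chordCurve one_pos (isProper_of_isDiagonal h)⟧ : X.CurveClass) =
      ⟦C.chordCurve one_pos (isProper_of_isDiagonal h')⟧ ↔ p = q := by
  constructor
  · intro he
    have e := endpoints_of_eq_chordCurve he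
    rw [chordCurve_toMap, chordMap_zero, chordMap_one] at e
    have := h.2.1
    have := h'.2.1
    have := h.1
    have := h'.1
    have := h.2.2.1
    have := h'.2.2.1
    rcases e with ⟨e1, e2⟩ | ⟨e1, e2⟩
    · exact Prod.ext (pt_injOn (by omega) (by omega) e1) (pt_injOn (by omega) (by omega) e2)
    · have := pt_injOn (by omega) (by omega) e1
      have := pt_injOn (by omega) (by omega) e2
      omega
  · rintro rfl; rfl

/-- Both chords lie in one period, so only the trivial translation can interleave them. -/
theorem encard_interleave_le (h : IsDiagonal C.n p) (h' : IsDiagonal C.n q) :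
    {t : ℤ | Interleave p.1 p.2 (q.1 + t * C.n) (q.2 + t * C.n)}.encard ≤
      {t : ℤ | t = 0 ∧ Interleave p.1 p.2 q.1 q.2}.encard := by
  refine Set.encard_le_encard fun t ht => ?_
  change Interleave _ _ _ _ at ht
  obtain ⟨h1, h2, h3, -⟩ := h
  obtain ⟨h4, h5, h6, -⟩ := h'
  unfold Interleave at ht
  have h7 : t < 1 := CombArc.mul_lt_cancel C.n_pos (by omega)
  have h8 : -1 < t := CombArc.mul_lt_cancel C.n_pos (by omega)
  obtain rfl : t = 0 := by omega
  exact ⟨rfl, by unfold Interleave; omega⟩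

section unpunctured

variable (hX : X.punctures = ∅)
include hX

theorem eq_chordCurve_of_endpoints {κ : ℝ} (hκ : 0 < κ) (h : C.IsProper i k) {c : X.Curve}
    (hc : c.toMap 0 = C.pt i ∧ c.toMap 1 = C.pt k ∨ c.toMap 0 = C.pt k ∧ c.toMap 1 = C.pt i) :
    (⟦c⟧ : X.CurveClass) = ⟦C.chordCurve hκ h⟧ := by
  refine Quotient.sound ?_
  rcases hc with ⟨h0, h1⟩ | ⟨h0, h1⟩
  · exact Or.inl (homotopic_of_unpunctured hX c.isPath (C.chordCurve hκ h).isPath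
      (h0.trans (chordMap_zero hκ).symm) (h1.trans (chordMap_one hκ).symm))
  · refine Or.inr (homotopic_of_unpunctured hX c.isPath ?_ ?_ ?_)
    · simpa using (C.chordCurve hκ h).isPath.reverse
    · rw [reverseMap_apply, unitInterval.symm_zero, chordCurve_toMap, chordMap_one, h0]
    · rw [reverseMap_apply, unitInterval.symm_one, chordCurve_toMap, chordMap_zero, h1]

theorem exists_isDiagonal (c : X.Curve) : ∃ p, IsDiagonal C.n p ∧
    (c.toMap 0 = C.pt p.1 ∧ c.toMap 1 = C.pt p.2 ∨
      c.toMap 0 = C.pt p.2 ∧ c.toMap 1 = C.pt p.1) := by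
  have vert : ∀ z ∈ X.vertices, z ∈ X.marked := fun z hz =>
    hz.resolve_right (by rw [hX]; simp)
  obtain ⟨i, hi, h0⟩ := C.exists_pt (vert _ c.isPath.1)
  obtain ⟨k, hk, h1⟩ := C.exists_pt (vert _ c.isPath.2.1)
  have hne : i ≠ k := by
    rintro rfl
    exact c.not_nullHomotopic (nullHomotopic_of_unpunctured hX c.isPath (h0.symm.trans h1))
  have side : ∀ j, ¬ (c.toMap 0 = C.pt j ∧ c.toMap 1 = C.pt (j + 1)) ∧
      ¬ (c.toMap 0 = C.pt (j + 1) ∧ c.toMap 1 = C.pt j) := by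
    intro j
    obtain ⟨g, hg, hgl⟩ := C.exists_isBoundarySegment j
    have hg2 : X.IsPathBetween (reverseMap g 0) (reverseMap g 1) (reverseMap g) := by
      simpa using hg.2.2.reverse
    constructor
    · rintro ⟨e0, e1⟩
      exact c.not_boundary g hg (homotopic_of_unpunctured hX c.isPath hg.2.2
        (e0.trans hgl.apply_zero.symm) (e1.trans hgl.apply_one.symm))
    · rintro ⟨e0, e1⟩
      refine c.not_boundary (reverseMap g)
        ⟨hg.1.comp unitInterval.symm_bijective.injective, fun t => hg.2.1 _, hg2⟩
        (homotopic_of_unpunctured hX c.isPath hg2 (e0.trans hgl.reverse.apply_zero.symm)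
          (e1.trans hgl.reverse.apply_one.symm))
  have h1i := (side i).1
  have h2i := (side i).2
  have h1k := (side k).1
  have h2k := (side k).2
  have close : C.pt (C.n - 1 + 1) = C.pt 0 := C.pt_eq_iff.2 ⟨1, by ring⟩
  rcases lt_or_gt_of_ne hne with h | h
  · refine ⟨(i, k), ⟨hi.1, ?_, hk.2, ?_⟩, Or.inl ⟨h0.symm, h1.symm⟩⟩
    · by_contra hcon
      simp only at hcon
      obtain rfl : k = i + 1 := by omega
      exact h1i ⟨h0.symm, h1.symm⟩
    · by_contra hcon
      simp only at hcon
      obtain rfl : i = 0 := by omega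
      obtain rfl : k = C.n - 1 := by omega
      exact h2k ⟨h0.symm.trans close.symm, h1.symm⟩
  · refine ⟨(k, i), ⟨hk.1, ?_, hi.2, ?_⟩, Or.inr ⟨h0.symm, h1.symm⟩⟩
    · by_contra hcon
      simp only at hcon
      obtain rfl : i = k + 1 := by omega
      exact h2k ⟨h0.symm, h1.symm⟩
    · by_contra hcon
      simp only at hcon
      obtain rfl : k = 0 := by omega
      obtain rfl : i = C.n - 1 := by omega
      exact h1i ⟨h0.symm, h1.symm.trans close.symm⟩

theorem exists_diagonalArc (A : X.TaggedArc) : ∃ p, IsDiagonal C.n p ∧ C.diagonalArc p = A := by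
  induction A using Quotient.inductionOn with
  | h A =>
    have vert : ∀ z ∈ X.vertices, z ∈ X.marked := fun z hz =>
      hz.resolve_right (by rw [hX]; simp)
    obtain ⟨p, hp, he⟩ := exists_isDiagonal (C := C) hX A.curve
    refine ⟨p, hp, ?_⟩
    have h0 := A.plain_start (vert _ A.curve.isPath.1)
    have h1 := A.plain_end (vert _ A.curve.isPath.2.1)
    rw [diagonalArc_of_isDiagonal hp]
    refine (Quotient.sound ?_).symm
    exact (Quotient.exact (eq_chordCurve_of_endpoints hX one_pos
      (isProper_of_isDiagonal hp) he)).imp (fun h => ⟨h, h0, h1⟩) fun h => ⟨h, h0, h1⟩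

variable (hC : C.p = 0)
include hC

theorem crossingNumber_diagonal (h : IsDiagonal C.n p) (h' : IsDiagonal C.n q) :
    (crossingNumber (⟦C.chordCurve one_pos (isProper_of_isDiagonal h)⟧ : X.CurveClass)
      ⟦C.chordCurve one_pos (isProper_of_isDiagonal h')⟧ : ℤ) =
      indic (Interleave p.1 p.2 q.1 q.2) := by
  have key : (crossingNumber (⟦C.chordCurve one_pos (isProper_of_isDiagonal h)⟧ : X.CurveClass)
      ⟦C.chordCurve one_pos (isProper_of_isDiagonal h')⟧ : ℕ∞) =
      {t : ℤ | t = 0 ∧ Interleave p.1 p.2 q.1 q.2}.encard := by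
    refine crossingNumber_eq ?_ ?_ fun c d hc hd => ?_
    · exact ((Set.finite_singleton (0 : ℤ)).subset fun t ht => ht.1).encard_lt_top.ne
    · by_cases hpq : p = q
      · subst hpq
        have hP := isProper_of_isDiagonal h
        refine ⟨C.chordCurve one_pos hP, C.chordCurve two_pos hP, rfl,
          chordCurve_eq two_pos one_pos hP, ?_⟩
        rw [chordCurve_toMap, chordCurve_toMap,
          meets_chordMap_self one_pos two_pos (by norm_num) hP.lt hP.lt_add.le]
        simp
      · refine ⟨_, _, rfl, rfl, (meets_chordMap_le one_pos (isProper_of_isDiagonal h).lt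
          (isProper_of_isDiagonal h').lt fun t ht => hpq ?_).trans (encard_interleave_le h h')⟩
        rw [← chordCurve_eq_iff_of_isDiagonal h h']
        refine Quotient.sound (Or.inl (homotopic_of_unpunctured hX (C.chordCurve one_pos _).isPath
          (C.chordCurve one_pos _).isPath ?_ ?_)) <;>
          simp only [chordCurve_toMap, chordMap_zero, chordMap_one]
        · exact C.pt_eq_iff.2 ⟨t, ht.1.symm⟩
        · exact C.pt_eq_iff.2 ⟨t, ht.2.symm⟩
    · by_cases hI : Interleave p.1 p.2 q.1 q.2
      · have e1 : {t : ℤ | t = 0 ∧ Interleave p.1 p.2 q.1 q.2} = {0} := by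
          ext t; exact ⟨fun h => h.1, fun h => ⟨h, hI⟩⟩
        rw [e1, Set.encard_singleton]
        have main : ∀ f g : C(I, ℂ), X.IsPathBetween (f 0) (f 1) f →
            X.IsPathBetween (g 0) (g 1) g → f 0 = C.pt p.1 → f 1 = C.pt p.2 → g 0 = C.pt q.1 →
            g 1 = C.pt q.2 → 1 ≤ (meets f g).encard := fun f g hf hg f0 f1 g0 g1 =>
          one_le_meets hC hf hg f0 f1 g0 g1 h.1 h.2.2.1 h'.1 h'.2.2.1 hI
        have hcr : X.IsPathBetween (reverseMap c.toMap 0) (reverseMap c.toMap 1)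
          (reverseMap c.toMap) := by simpa using c.isPath.reverse
        have hdr : X.IsPathBetween (reverseMap d.toMap 0) (reverseMap d.toMap 1)
          (reverseMap d.toMap) := by simpa using d.isPath.reverse
        rcases endpoints_of_eq_chordCurve hc with ⟨c0, c1⟩ | ⟨c0, c1⟩ <;>
          rcases endpoints_of_eq_chordCurve hd with ⟨d0, d1⟩ | ⟨d0, d1⟩
        · exact main _ _ c.isPath d.isPath c0 c1 d0 d1
        · exact (main _ _ c.isPath hdr c0 c1 (by simpa using d1) (by simpa using d0)).trans
            (meets_reverse_right _ _)
        · exact (main _ _ hcr d.isPath (by simpa using c1) (by simpa using c0) d0 d1).trans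
            (meets_reverse_left _ _)
        · exact (main _ _ hcr hdr (by simpa using c1) (by simpa using c0) (by simpa using d1)
            (by simpa using d0)).trans ((meets_reverse_left _ _).trans (meets_reverse_right _ _))
      · have e1 : {t : ℤ | t = 0 ∧ Interleave p.1 p.2 q.1 q.2} = ∅ := by
          ext t; exact ⟨fun h => hI h.2, fun h => h.elim⟩
        rw [e1]; simp
  by_cases hI : Interleave p.1 p.2 q.1 q.2
  · have e1 : {t : ℤ | t = 0 ∧ Interleave p.1 p.2 q.1 q.2} = {0} := by
      ext t; exact ⟨fun h => h.1, fun h => ⟨h, hI⟩⟩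
    rw [e1, Set.encard_singleton] at key
    rw [indic_pos hI]
    exact_mod_cast key
  · have e1 : {t : ℤ | t = 0 ∧ Interleave p.1 p.2 q.1 q.2} = ∅ := by
      ext t; exact ⟨fun h => hI h.2, fun h => h.elim⟩
    rw [e1, Set.encard_empty] at key
    rw [indic_neg hI]
    exact_mod_cast key

theorem compatible_diagonalArc (h : IsDiagonal C.n p) (h' : IsDiagonal C.n q) :
    (C.diagonalArc p).Compatible (C.diagonalArc q) ↔ ¬ Interleave p.1 p.2 q.1 q.2 := by
  rw [compatible_iff_of_marked (ends_diagonalArc_marked h)]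
  · rw [underlying_diagonalArc h, underlying_diagonalArc h', ← Int.natCast_eq_zero,
      crossingNumber_diagonal hX hC h h']
    by_cases hI : Interleave p.1 p.2 q.1 q.2
    · rw [indic_pos hI]; simp [hI]
    · rw [indic_neg hI]; simp [hI]
  · rw [underlying_diagonalArc h, underlying_diagonalArc h', chordCurve_eq_iff_of_isDiagonal h h']
    rintro rfl
    exact ⟨diagonalCurve p h, diagonalCurve p h, (diagonalArc_of_isDiagonal h).symm,
      (diagonalArc_of_isDiagonal h).symm, Curve.homotopic_refl _, Or.inl rfl⟩

theorem int_diagonalArc (h : IsDiagonal C.n p) (h' : IsDiagonal C.n q) :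
    TaggedArc.int (C.diagonalArc p) (C.diagonalArc q) = inter {q} p.1 p.2 := by
  have hu := underlying_diagonalArc h
  rw [TaggedArc.int, TaggedArc.intB_eq_zero hu (chordCurve_ends_ne h),
    TaggedArc.intD_eq_zero (ends_diagonalArc_marked h), add_zero, add_zero, TaggedArc.intA,
    TaggedArc.intC, hu, underlying_diagonalArc h', inter, sub_eq_add_neg,
    crossingNumber_diagonal hX hC h h', crossCount, mult,
    cnt, cnt, Multiset.map_singleton, Multiset.map_singleton, Multiset.sum_singleton,
    Multiset.sum_singleton]
  congr 1
  have he := chordCurve_eq_iff_of_isDiagonal h h'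
  by_cases hpq : p = q
  · rw [if_pos (he.2 hpq), indic_pos (by rw [hpq]; exact ⟨rfl, rfl⟩)]
  · rw [if_neg fun e => hpq (he.1 e), indic_neg fun e => hpq (Prod.ext e.1.symm e.2.symm), neg_zero]

theorem not_interleave_of_pairwise {U : Set X.TaggedArc} (hU : U.Pairwise TaggedArc.Compatible)
    (h : IsDiagonal C.n p) (h' : IsDiagonal C.n q) (h1 : C.diagonalArc p ∈ U)
    (h2 : C.diagonalArc q ∈ U) : ¬ Interleave p.1 p.2 q.1 q.2 := by
  by_cases hpq : C.diagonalArc p = C.diagonalArc q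
  · have h3 : p = q := by
      rw [← chordCurve_eq_iff_of_isDiagonal h h', ← underlying_diagonalArc h,
        ← underlying_diagonalArc h', hpq]
    subst h3
    unfold Interleave
    omega
  · exact (compatible_diagonalArc hX hC h h').1 (hU h1 h2 hpq)

theorem eq_of_intVector_eq_of_unpunctured {T : Set X.TaggedArc} (hT : IsTaggedTriangulation T)
    {M N : Multiset X.TaggedArc} (hMc : {A | A ∈ M}.Pairwise TaggedArc.Compatible)
    (hNc : {A | A ∈ N}.Pairwise TaggedArc.Compatible)
    (hint : intVector T M = intVector T N) : M = N := by
  obtain ⟨L, rfl, hL⟩ := Multiset.exists_map_eq M fun A _ => exists_diagonalArc (C := C) hX A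
  obtain ⟨K, rfl, hK⟩ := Multiset.exists_map_eq N fun A _ => exists_diagonalArc (C := C) hX A
  refine congrArg _ (eq_of_inter_eq (n := C.n)
    (T := {p | IsDiagonal C.n p ∧ C.diagonalArc p ∈ T}) (fun p hp => hp.1)
    (fun p hp q hq => not_interleave_of_pairwise hX hC hT.prop.2 hp.1 hq.1 hp.2 hq.2)
    (fun p hp h => ⟨hp, hT.mem (isAdmissible_diagonalArc hp) fun B hB => ?_⟩) hL hK
    (fun p hp q hq => not_interleave_of_pairwise hX hC hMc (hL p hp) (hL q hq)
      (Multiset.mem_map_of_mem _ hp) (Multiset.mem_map_of_mem _ hq))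
    (fun p hp q hq => not_interleave_of_pairwise hX hC hNc (hK p hp) (hK q hq)
      (Multiset.mem_map_of_mem _ hp) (Multiset.mem_map_of_mem _ hq)) fun p hp => ?_)
  · obtain ⟨q, hq, rfl⟩ := exists_diagonalArc (C := C) hX B
    exact (compatible_diagonalArc hX hC hp hq).2 (h q ⟨hq, hB⟩)
  · have h := sum_int_eq hint hp.2
    rw [Multiset.map_map, Multiset.map_map] at h
    have e : ∀ L : Multiset (ℤ × ℤ), (∀ q ∈ L, IsDiagonal C.n q) → inter L p.1 p.2 =
        (L.map ((fun B => TaggedArc.int (C.diagonalArc p) B) ∘ C.diagonalArc)).sum := by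
      intro L hL
      have e1 : L.bind (fun q => ({q} : Multiset (ℤ × ℤ))) = L := by
        rw [Multiset.bind_singleton, Multiset.map_id']
      conv_lhs => rw [← e1]
      rw [inter_bind]
      exact congrArg _ (Multiset.map_congr rfl fun q hq =>
        (int_diagonalArc hX hC hp.1 (hL q hq)).symm)
    rw [e L hL, e K hK, h]

end unpunctured

end Chart

end MarkedDisc

end

theorem theoremt (X : MarkedDisc) (T : Set X.TaggedArc)
    (hT : MarkedDisc.IsTaggedTriangulation T)
    (M N : Multiset X.TaggedArc)
    (hMadm : ∀ α ∈ M, MarkedDisc.TaggedArc.IsAdmissible α)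
    (hNadm : ∀ α ∈ N, MarkedDisc.TaggedArc.IsAdmissible α)
    (hMcomp : {α | α ∈ M}.Pairwise MarkedDisc.TaggedArc.Compatible)
    (hNcomp : {α | α ∈ N}.Pairwise MarkedDisc.TaggedArc.Compatible)
    (hint : MarkedDisc.intVector T M = MarkedDisc.intVector T N) :
    M = N := by
  rcases X.punctures.eq_empty_or_nonempty with hX | ⟨p, hp⟩
  -- Without a puncture the center 0 merely supplies coordinates, in which the marked points are the
  -- exponentials of their angles.
  · obtain ⟨C, hC⟩ := MarkedDisc.exists_chart (X := X) (p := 0) (by simp) (by simp [hX])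
    exact MarkedDisc.Chart.eq_of_intVector_eq_of_unpunctured hX hC hT hMcomp hNcomp hint
  · obtain ⟨C, rfl⟩ := MarkedDisc.exists_chart (X.norm_punctures p hp) fun z hz =>
      Finset.card_le_one.1 X.card_punctures_le_one z hz p hp
    exact MarkedDisc.Chart.eq_of_intVector_eq hp hT hMadm hNadm hMcomp hNcomp hint
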